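/- Let $k$ be a field of characteristic $0$, and let all modules be over $k[\partial]$. **Conformal algebras.** Let $P$ be a $k[\partial]$-module and $\lambda$ an indeterminate. A Lie conformal algebra is $P$ with a $k$-bilinear map $[\cdot_\lambda\cdot]:P\times P\to P[\lambda]$ such that $[(\partial a)_\lambda b]=-\lambda[a_\lambda b]$, $[a_\lambda(\partial b)]=(\partial+\lambda)[a_\lambda b]$, $[a_\lambda b]=-[b_{-\lambda-\partial}a]$ and $[a_\lambda[b_\mu c]]=[[a_\lambda b]_{\lambda+\mu}c]+[b_\mu[a_\lambda c]]$. A commutative associative conformal algebra is $P$ with a $k$-bilinear map $\cdot_\lambda\cdot:P\times P\to P[\lambda]$ such that $(\partial a)_\lambda b=-\lambda\,a_\lambda b$, $a_\lambda(\partial b)=(\partial+\lambda)a_\lambda b$, $(a_\lambda b)_{\lambda+\mu}c=a_\lambda(b_\mu c)$ and $a_\lambda b=b_{-\lambda-\partial}a$. A Poisson conformal algebra carries both structures, with $[a_\lambda(b_\mu c)]=[a_\lambda b]_{\lambda+\mu}c+b_\mu[a_\lambda c]$. Write $\mathfrak{ad}_P(a)_\lambda b=[a_\lambda b]$ and $\mathfrak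 L_P(a)_\lambda b=a_\lambda b$. **Conformal coalgebras.** Let $\partial$ act on $P\otimes_k P$ by $\partial^{\otimes 2}=\partial\otimes I+I\otimes\partial$, and let $\tau$ be the flip. A Poisson conformal coalgebra is $P$ with $k[\partial]$-module homomorphisms $\delta,\Delta:P\to P\otimes_k P$ such that $\delta=-\tau\delta$, $(I\otimes\delta)\delta-(\tau\otimes I)(I\otimes\delta)\delta=(\delta\otimes I)\delta$ (Lie conformal coalgebra), $\Delta=\tau\Delta$, $(I\otimes\Delta)\Delta=(\Delta\otimes I)\Delta$ (cocommutative associative conformal coalgebra), and $(I\otimes\Delta)\delta=(\delta\otimes I)\Delta+(\tau\otimes I)(I\otimes\delta)\Delta$. **Bialgebras.** A Poisson conformal bialgebra is $(P,[\cdot_\lambda\cdot],\cdot_\lambda\cdot,\delta,\Delta)$ that is a Poisson conformal algebra and a Poisson conformal coalgebra such that for all $a,b\in P$ $$\delta([a_\lambda b])=(\mathfrak{ad}_P(a)_\lambda\otimes I+I\otimes\mathfrak{ad}_P(a)_\lambda)\delta(b)-(\mathfrak{ad}_P(b)_{-\lambda-\partial^{\otimes2}}\otimes I+I\otimes\mathfrak{ad}_P(b)_{-\lambda-\partial^{\otimes2}})\delta(a)$$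 (Lie conformal bialgebra), $$\Delta(a_\lambda b)=(I\otimes\mathfrak L_P(a)_\lambda)\Delta(b)+(\mathfrak R_P(b)_{-\lambda-\partial^{\otimes2}}\otimes I)\Delta(a),$$ $$(\mathfrak L_P(b)_{-\lambda-\partial^{\otimes2}}\otimes I-I\otimes\mathfrak R_P(b)_{-\lambda-\partial^{\otimes2}})\Delta(a)+\tau(\mathfrak L_P(a)_\lambda\otimes I-I\otimes\mathfrak R_P(a)_\lambda)\Delta(b)=0$$ with $\mathfrak R_P(a)_\lambda b=b_{-\lambda-\partial}a$ (commutative and cocommutative antisymmetric infinitesimal conformal bialgebra), and $$\delta(a_\lambda b)=(\mathfrak L_P(a)_\lambda\otimes I)\delta(b)+(\mathfrak L_P(b)_{-\lambda-\partial^{\otimes2}}\otimes I)\delta(a)+(I\otimes\mathfrak{ad}_P(a)_\lambda)\Delta(b)+(I\otimes\mathfrak{ad}_P(b)_{-\lambda-\partial^{\otimes2}})\Delta(a),$$ $$\Delta([a_\lambda b])=(\mathfrak{ad}_P(a)_\lambda\otimes I+I\otimes\mathfrak{ad}_P(a)_\lambda)\Delta(b)-(I\otimes\mathfrak L_P(b)_{-\lambda-\partial^{\otimes2}})\delta(a)+(\mathfrak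 L_P(b)_{-\lambda-\partial^{\otimes2}}\otimes I)\delta(a).$$ **Duals.** $\mathrm{gc}(V)$ is the $k[\partial]$-module of $k$-linear maps $\varphi_\lambda:V\to V[\lambda]$ with $\varphi_\lambda(\partial v)=(\partial+\lambda)\varphi_\lambda(v)$, where $(\partial\varphi)_\lambda=-\lambda\varphi_\lambda$. The conformal dual $V^{*c}$ is the $k[\partial]$-module of $k$-linear maps $f:V\to k[\lambda]$ with $f_\lambda(\partial v)=\lambda f_\lambda(v)$, where $(\partial f)_\lambda=-\lambda f_\lambda$. For a homomorphism $\sigma:P\to\mathrm{gc}(V)$ of $k[\partial]$-modules, $V$ being finitely generated, $\sigma^*:P\to\mathrm{gc}(V^{*c})$ is given by $(\sigma^*(a)_\lambda f)_\mu u=-f_{\mu-\lambda}(\sigma(a)_\lambda u)$. If $V$ is free of finite rank, $V^{*c*c}$ is identified with $V$ by letting $v\in V$ correspond to $f\mapsto f_{-\lambda}(v)$. **Matched pairs.** Let $P,Q$ be Poisson conformal algebras and $\rho_P,l_P:P\to\mathrm{gc}(Q)$, $\rho_Q,l_Q:Q\to\mathrm{gc}(P)$ homomorphisms of $k[\partial]$-modules.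 $(P,Q,\rho_P,l_P,\rho_Q,l_Q)$ is a matched pair of Poisson conformal algebras if $P\oplus Q$ is a Poisson conformal algebra under $$[(a+x)_\lambda(b+y)]=([a_\lambda b]+\rho_Q(x)_\lambda b-\rho_Q(y)_{-\lambda-\partial}a)+([x_\lambda y]+\rho_P(a)_\lambda y-\rho_P(b)_{-\lambda-\partial}x),$$ $$(a+x)_\lambda(b+y)=(a_\lambda b+l_Q(x)_\lambda b+l_Q(y)_{-\lambda-\partial}a)+(x_\lambda y+l_P(a)_\lambda y+l_P(b)_{-\lambda-\partial}x).$$ **Manin triples.** A conformal bilinear form on $R$ is a $k$-bilinear map $\langle\cdot,\cdot\rangle_\lambda:R\times R\to k[\lambda]$ with $\langle\partial a,b\rangle_\lambda=-\lambda\langle a,b\rangle_\lambda$ and $\langle a,\partial b\rangle_\lambda=\lambda\langle a,b\rangle_\lambda$; it is symmetric if $\langle a,b\rangle_\lambda=\langle b,a\rangle_{-\lambda}$, and nondegenerate if $a\mapsto\langle a,\cdot\rangle_\lambda$ is a bijection $R\to R^{*c}$. A Manin triple $(R,P_1,P_2)$ of Poisson conformal algebras consists of a Poisson conformal algebra $R$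 with a nondegenerate symmetric conformal bilinear form that is invariant, that is, $\langle[a_\lambda b],c\rangle_\mu=\langle a,[b_{\mu-\partial}c]\rangle_\lambda$ and $\langle a_\lambda b,c\rangle_\mu=\langle a,b_{\mu-\partial}c\rangle_\lambda$, and of Poisson conformal subalgebras $P_1,P_2$ with $R=P_1\oplus P_2$ as $k[\partial]$-modules and $\langle P_i,P_i\rangle_\lambda=0$ for $i=1,2$. **Theorem.** Let $(P,[\cdot_\lambda\cdot],\cdot_\lambda\cdot)$ be a Poisson conformal algebra and $(P,\delta,\Delta)$ a Poisson conformal coalgebra, where $P$ is free of finite rank over $k[\partial]$. Endow $P^{*c}$ with $$([f_\lambda g])_\mu(a)=\sum f_\lambda(a_{[1]})\,g_{\mu-\lambda}(a_{[2]}),\qquad (f_\lambda g)_\mu(a)=\sum f_\lambda(a_{(1)})\,g_{\mu-\lambda}(a_{(2)}),$$ where $\delta(a)=\sum a_{[1]}\otimes a_{[2]}$ and $\Delta(a)=\sum a_{(1)}\otimes a_{(2)}$. The following conditions are equivalent. (a) $(P,[\cdot_\lambda\cdot],\cdot_\lambda\cdot,\delta,\Delta)$ is a Poisson conformal bialgebra.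 (b) $(P,P^{*c},\mathfrak{ad}_P^*,-\mathfrak L_P^*,\mathfrak{ad}_{P^{*c}}^*,-\mathfrak L_{P^{*c}}^*)$ is a matched pair of Poisson conformal algebras. (c) There is a Poisson conformal algebra structure on the $k[\partial]$-module $P\oplus P^{*c}$, having $P$ and $P^{*c}$ with their given structures as subalgebras, for which $(P\oplus P^{*c},P,P^{*c})$ is a Manin triple of Poisson conformal algebras with respect to the form $$\langle a+f,b+g\rangle_\lambda=f_\lambda(b)+g_{-\lambda}(a),\qquad a,b\in P,\ f,g\in P^{*c}.$$ -/

import Mathlib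

open scoped TensorProduct Polynomial

noncomputable section

namespace PoissonConformal

/-! ### Modules over `k[∂]` and polynomials with coefficients in a vector space

A `k[∂]`-module is a vector space `V` over `k` that is also a module over `k[X]` (compatibly),
the variable `X` acting as `∂`. -/

/-- The operator `∂` on a `k[∂]`-module. -/
def del (k V : Type*) [Field k] [AddCommGroup V] [Module k V] [Module k[X] V]
    [IsScalarTower k k[X] V] : Module.End k V where
  toFun v := (Polynomial.X : k[X]) • v
  map_add' := smul_add _
  map_smul' c v := by
    rw [RingHom.id_apply, ← algebraMap_smul k[X] c v, ← algebraMap_smul k[X] c (_ : V), smul_smul,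
      smul_smul, mul_comm]

theorem linear_of_del {k V W : Type*} [Field k] [AddCommGroup V] [Module k V] [Module k[X] V]
    [IsScalarTower k k[X] V] [AddCommGroup W] [Module k W] [Module k[X] W]
    [IsScalarTower k k[X] W] (F : V →ₗ[k] W) (hF : ∀ v, F (del k V v) = del k W (F v))
    (p : k[X]) (v : V) : F (p • v) = p • F v := by
  induction p using Polynomial.induction_on' generalizing v with
  | add p q hp hq => rw [add_smul, add_smul, map_add, hp, hq]
  | monomial n c =>
    induction n generalizing v with
    | zero =>
      have : (Polynomial.monomial 0 c : k[X]) = algebraMap k k[X] c := rfl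
      rw [this, algebraMap_smul, algebraMap_smul, map_smul]
    | succ n ih =>
      have : (Polynomial.monomial (n + 1) c : k[X]) = Polynomial.monomial n c * Polynomial.X :=
        (Polynomial.monomial_mul_X n c).symm
      rw [this, mul_smul, mul_smul, ih]
      exact congrArg _ (hF v)

/-- `V[λ]`: polynomials in one indeterminate `λ` with coefficients in `V`;
`p n` is the coefficient of `λ ^ n`. Accordingly `LPoly (LPoly V)` is `V[λ, μ]`, where the outer
exponent is that of `λ` and the inner exponent is that of `μ`. -/
abbrev LPoly (V : Type*) [AddCommGroup V] : Type _ := ℕ →₀ V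

section Poly

variable (k : Type*) {V W : Type*} [Field k] [AddCommGroup V] [Module k V]
  [AddCommGroup W] [Module k W]

/-- The inclusion of `V` in `V[λ]` as the constant polynomials. -/
def const (V : Type*) [AddCommGroup V] [Module k V] : V →ₗ[k] LPoly V := Finsupp.lsingle 0

/-- Multiplication by the indeterminate `λ` on `V[λ]`. -/
def lam (V : Type*) [AddCommGroup V] [Module k V] : Module.End k (LPoly V) :=
  Finsupp.lmapDomain V k Nat.succ

/-- Apply a linear map to all the coefficients: `V[λ] → W[λ]`. -/
abbrev coeffMap {k : Type*} [Field k] {V W : Type*} [AddCommGroup V] [Module k V]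
    [AddCommGroup W] [Module k W] (f : V →ₗ[k] W) : LPoly V →ₗ[k] LPoly W :=
  Finsupp.mapRange.linearMap f

/-- Substitution of an operator `T` for the indeterminate: `∑ λ ^ n v_n ↦ ∑ T ^ n (f v_n)`. -/
def subst {k : Type*} [Field k] {V W : Type*} [AddCommGroup V] [Module k V]
    [AddCommGroup W] [Module k W] (T : Module.End k W) (f : V →ₗ[k] W) : LPoly V →ₗ[k] W :=
  Finsupp.lsum k fun n => (T ^ n) ∘ₗ f

/-- The substitution `p(λ) ↦ p(-λ-D)` on `V[λ]`, where the operator `D` of `V` acts (after the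
substitution) on the coefficients. -/
def opp {k : Type*} [Field k] {V : Type*} [AddCommGroup V] [Module k V] (D : Module.End k V) :
    Module.End k (LPoly V) :=
  subst (-lam k V - coeffMap D) (const k V)

/-- Multiplication by `λ` on `V[λ, μ]`. -/
def lam₂ (V : Type*) [AddCommGroup V] [Module k V] : Module.End k (LPoly (LPoly V)) :=
  lam k (LPoly V)

/-- Multiplication by `μ` on `V[λ, μ]`. -/
def mu₂ (V : Type*) [AddCommGroup V] [Module k V] : Module.End k (LPoly (LPoly V)) :=
  coeffMap (lam k V)

/-- The inclusion of `V` in `V[λ, μ]` as the constant polynomials. -/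
def const₂ (V : Type*) [AddCommGroup V] [Module k V] : V →ₗ[k] LPoly (LPoly V) :=
  const k (LPoly V) ∘ₗ const k V

end Poly

/-! ### Conformal algebras -/

/-- `k`-bilinear maps `P × P → P[λ]`, `(a, b) ↦ a_λ b`. -/
abbrev LambdaProduct (k P : Type*) [Field k] [AddCommGroup P] [Module k P] : Type _ :=
  P →ₗ[k] P →ₗ[k] LPoly P

section Algebra

variable {k P : Type*} [Field k] [AddCommGroup P] [Module k P]

/-- For two `λ`-products `m` and `n`: `(a ₘ_S b) ₙ_T c`, with values in `P[λ, μ]`, where the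
operators `S` and `T` of `P[λ, μ]` are substituted for the indeterminates. -/
def nestLeft (m n : LambdaProduct k P) (S T : Module.End k (LPoly (LPoly P))) (a b c : P) :
    LPoly (LPoly P) :=
  subst S (subst T (const₂ k P) ∘ₗ n.flip c) (m a b)

/-- For two `λ`-products `m` and `n`: `a ₘ_S (b ₙ_T c)`, with values in `P[λ, μ]`, where the
operators `S` and `T` of `P[λ, μ]` are substituted for the indeterminates. -/
def nestRight (m n : LambdaProduct k P) (S T : Module.End k (LPoly (LPoly P))) (a b c : P) :
    LPoly (LPoly P) :=
  subst T (subst S (const₂ k P) ∘ₗ m a) (n b c)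

variable [Module k[X] P] [IsScalarTower k k[X] P]

/-- `(∂a)_λ b = -λ (a_λ b)` and `a_λ (∂b) = (∂ + λ)(a_λ b)`. -/
structure IsSesquilinear (m : LambdaProduct k P) : Prop where
  del_left : ∀ a b, m (del k P a) b = -lam k P (m a b)
  del_right : ∀ a b, m a (del k P b) = coeffMap (del k P) (m a b) + lam k P (m a b)

/-- Associative conformal algebras. -/
structure IsAssociativeConformalAlgebra (m : LambdaProduct k P) : Prop where
  sesq : IsSesquilinear m
  /-- `(a_λ b)_{λ+μ} c = a_λ (b_μ c)` -/
  assoc : ∀ a b c, nestLeft m m (lam₂ k P) (lam₂ k P + mu₂ k P) a b c =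
    nestRight m m (lam₂ k P) (mu₂ k P) a b c

/-- Commutativity: `a_λ b = b_{-λ-∂} a`. -/
def IsCommutative (m : LambdaProduct k P) : Prop :=
  ∀ a b, m a b = opp (del k P) (m b a)

/-- Lie conformal algebras. -/
structure IsLieConformalAlgebra (br : LambdaProduct k P) : Prop where
  sesq : IsSesquilinear br
  /-- `[a_λ b] = -[b_{-λ-∂} a]` -/
  skew : ∀ a b, br a b = -opp (del k P) (br b a)
  /-- `[a_λ [b_μ c]] = [[a_λ b]_{λ+μ} c] + [b_μ [a_λ c]]` -/
  jacobi : ∀ a b c, nestRight br br (lam₂ k P) (mu₂ k P) a b c =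
    nestLeft br br (lam₂ k P) (lam₂ k P + mu₂ k P) a b c +
      nestRight br br (mu₂ k P) (lam₂ k P) b a c

/-- Poisson conformal algebras `(P, [·_λ ·], ·_λ ·)`. -/
structure IsPoissonConformalAlgebra (br mul : LambdaProduct k P) : Prop where
  lie : IsLieConformalAlgebra br
  assoc : IsAssociativeConformalAlgebra mul
  comm : IsCommutative mul
  /-- `[a_λ (b_μ c)] = [a_λ b]_{λ+μ} c + b_μ [a_λ c]` -/
  leibniz : ∀ a b c, nestRight br mul (lam₂ k P) (mu₂ k P) a b c =
    nestLeft br mul (lam₂ k P) (lam₂ k P + mu₂ k P) a b c +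
      nestRight mul br (mu₂ k P) (lam₂ k P) b a c

end Algebra

/-! ### Conformal coalgebras -/

section Coalgebra

variable (k P : Type*) [Field k] [AddCommGroup P] [Module k P] [Module k[X] P]
  [IsScalarTower k k[X] P]

/-- `∂ ⊗ I + I ⊗ ∂`, the action of `∂` on `P ⊗ P`. -/
def del₂ : Module.End k (P ⊗[k] P) :=
  (del k P).rTensor P + (del k P).lTensor P

/-- `k[∂]`-module homomorphisms `P → P ⊗ P`. -/
structure Coproduct where
  toLin : P →ₗ[k] P ⊗[k] P
  map_del : ∀ a, toLin (del k P a) = del₂ k P (toLin a)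

/-- The flip of `P ⊗ P`. -/
abbrev flip₂ : P ⊗[k] P →ₗ[k] P ⊗[k] P := (TensorProduct.comm k P P).toLinearMap

/-- `τ ⊗ I` on `P ⊗ P ⊗ P`, bracketed as `P ⊗ (P ⊗ P)`: `x ⊗ (y ⊗ z) ↦ y ⊗ (x ⊗ z)`. -/
abbrev flip₁₂ : P ⊗[k] (P ⊗[k] P) →ₗ[k] P ⊗[k] (P ⊗[k] P) :=
  (TensorProduct.leftComm k P P P).toLinearMap

variable {k P}

/-- `(I ⊗ F) G a`, in `P ⊗ (P ⊗ P)`. -/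
def coRight (F G : Coproduct k P) (a : P) : P ⊗[k] (P ⊗[k] P) :=
  F.toLin.lTensor P (G.toLin a)

/-- `(F ⊗ I) G a`, in `P ⊗ (P ⊗ P)` (after reassociating). -/
def coLeft (F G : Coproduct k P) (a : P) : P ⊗[k] (P ⊗[k] P) :=
  TensorProduct.assoc k P P P (F.toLin.rTensor P (G.toLin a))

/-- Associative conformal coalgebras. -/
def IsAssociativeConformalCoalgebra (Δ : Coproduct k P) : Prop :=
  ∀ a, coRight Δ Δ a = coLeft Δ Δ a

/-- Cocommutativity: `Δ = τ Δ`. -/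
def IsCocommutative (Δ : Coproduct k P) : Prop :=
  ∀ a, Δ.toLin a = flip₂ k P (Δ.toLin a)

/-- Lie conformal coalgebras. -/
structure IsLieConformalCoalgebra (δ : Coproduct k P) : Prop where
  skew : ∀ a, δ.toLin a = -flip₂ k P (δ.toLin a)
  jacobi : ∀ a, coRight δ δ a - flip₁₂ k P (coRight δ δ a) = coLeft δ δ a

/-- Poisson conformal coalgebras `(P, δ, Δ)`. -/
structure IsPoissonConformalCoalgebra (δ Δ : Coproduct k P) : Prop where
  lie : IsLieConformalCoalgebra δ
  assoc : IsAssociativeConformalCoalgebra Δ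
  cocomm : IsCocommutative Δ
  /-- `(I ⊗ Δ) δ = (δ ⊗ I) Δ + (τ ⊗ I)(I ⊗ δ) Δ` -/
  compat : ∀ a, coRight Δ δ a = coLeft δ Δ a + flip₁₂ k P (coRight δ Δ a)

end Coalgebra

/-! ### Conformal bialgebras -/

section Bialgebra

variable {k P : Type*} [Field k] [AddCommGroup P] [Module k P]

/-- For `φ_λ : P → P[λ]`, the map `φ_λ ⊗ I : P ⊗ P → (P ⊗ P)[λ]`. -/
def actLeft (φ : P →ₗ[k] LPoly P) : P ⊗[k] P →ₗ[k] LPoly (P ⊗[k] P) :=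
  (TensorProduct.finsuppLeft k k P P ℕ).toLinearMap ∘ₗ φ.rTensor P

/-- For `φ_λ : P → P[λ]`, the map `I ⊗ φ_λ : P ⊗ P → (P ⊗ P)[λ]`. -/
def actRight (φ : P →ₗ[k] LPoly P) : P ⊗[k] P →ₗ[k] LPoly (P ⊗[k] P) :=
  (TensorProduct.finsuppRight k k P P ℕ).toLinearMap ∘ₗ φ.lTensor P

variable [Module k[X] P] [IsScalarTower k k[X] P]

/-- The right multiplications `ℜ(b)_λ c = c_{-λ-∂} b`. -/
def rightMul (m : LambdaProduct k P) (b : P) : P →ₗ[k] LPoly P :=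
  opp (del k P) ∘ₗ m.flip b

/-- The substitution of `-λ-∂^{⊗2}` for `λ` in `(P ⊗ P)[λ]`. -/
abbrev opp₂ : Module.End k (LPoly (P ⊗[k] P)) := opp (del₂ k P)

/-- Antisymmetric infinitesimal conformal bialgebras. -/
structure IsASIConformalBialgebra (mul : LambdaProduct k P) (Δ : Coproduct k P) : Prop where
  alg : IsAssociativeConformalAlgebra mul
  coalg : IsAssociativeConformalCoalgebra Δ
  /-- `Δ(a_λ b) = (I ⊗ 𝔏(a)_λ) Δ(b) + (ℜ(b)_{-λ-∂^{⊗2}} ⊗ I) Δ(a)` -/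
  compat₁ : ∀ a b, coeffMap Δ.toLin (mul a b) =
    actRight (mul a) (Δ.toLin b) + opp₂ (actLeft (rightMul mul b) (Δ.toLin a))
  /-- `(𝔏(b)_{-λ-∂^{⊗2}} ⊗ I - I ⊗ ℜ(b)_{-λ-∂^{⊗2}}) Δ(a)
      + τ (𝔏(a)_λ ⊗ I - I ⊗ ℜ(a)_λ) Δ(b) = 0` -/
  compat₂ : ∀ a b,
    opp₂ (actLeft (mul b) (Δ.toLin a) - actRight (rightMul mul b) (Δ.toLin a)) +
      coeffMap (flip₂ k P)
        (actLeft (mul a) (Δ.toLin b) - actRight (rightMul mul a) (Δ.toLin b)) = 0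

/-- Lie conformal bialgebras. -/
structure IsLieConformalBialgebra (br : LambdaProduct k P) (δ : Coproduct k P) : Prop where
  alg : IsLieConformalAlgebra br
  coalg : IsLieConformalCoalgebra δ
  /-- `δ([a_λ b]) = (𝔞𝔡(a)_λ ⊗ I + I ⊗ 𝔞𝔡(a)_λ) δ(b)
      - (𝔞𝔡(b)_{-λ-∂^{⊗2}} ⊗ I + I ⊗ 𝔞𝔡(b)_{-λ-∂^{⊗2}}) δ(a)` -/
  compat : ∀ a b, coeffMap δ.toLin (br a b) =
    (actLeft (br a) (δ.toLin b) + actRight (br a) (δ.toLin b)) -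
      opp₂ (actLeft (br b) (δ.toLin a) + actRight (br b) (δ.toLin a))

/-- Poisson conformal bialgebras `(P, [·_λ ·], ·_λ ·, δ, Δ)`. -/
structure IsPoissonConformalBialgebra (br mul : LambdaProduct k P) (δ Δ : Coproduct k P) :
    Prop where
  alg : IsPoissonConformalAlgebra br mul
  coalg : IsPoissonConformalCoalgebra δ Δ
  lie : IsLieConformalBialgebra br δ
  asi : IsASIConformalBialgebra mul Δ
  comm : IsCommutative mul
  cocomm : IsCocommutative Δ
  /-- `δ(a_λ b) = (𝔏(a)_λ ⊗ I) δ(b) + (𝔏(b)_{-λ-∂^{⊗2}} ⊗ I) δ(a)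
      + (I ⊗ 𝔞𝔡(a)_λ) Δ(b) + (I ⊗ 𝔞𝔡(b)_{-λ-∂^{⊗2}}) Δ(a)` -/
  compat₁ : ∀ a b, coeffMap δ.toLin (mul a b) =
    actLeft (mul a) (δ.toLin b) + opp₂ (actLeft (mul b) (δ.toLin a)) +
      actRight (br a) (Δ.toLin b) + opp₂ (actRight (br b) (Δ.toLin a))
  /-- `Δ([a_λ b]) = (𝔞𝔡(a)_λ ⊗ I + I ⊗ 𝔞𝔡(a)_λ) Δ(b)
      - (I ⊗ 𝔏(b)_{-λ-∂^{⊗2}}) δ(a) + (𝔏(b)_{-λ-∂^{⊗2}} ⊗ I) δ(a)` -/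
  compat₂ : ∀ a b, coeffMap Δ.toLin (br a b) =
    (actLeft (br a) (Δ.toLin b) + actRight (br a) (Δ.toLin b)) -
      opp₂ (actRight (mul b) (δ.toLin a)) + opp₂ (actLeft (mul b) (δ.toLin a))

end Bialgebra

/-! ### Conformal linear maps and conformal duals -/

section Chom

variable (k U V : Type*) [Field k] [AddCommGroup U] [Module k U] [Module k[X] U]
  [IsScalarTower k k[X] U] [AddCommGroup V] [Module k V] [Module k[X] V] [IsScalarTower k k[X] V]

/-- The conformal linear maps `f_λ : U → V[λ]`: `f_λ(∂u) = (∂ + λ) f_λ(u)`. -/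
def chomSubmodule : Submodule k (U →ₗ[k] LPoly V) where
  carrier := {f | ∀ u, f (del k U u) = coeffMap (del k V) (f u) + lam k V (f u)}
  zero_mem' := by intro u; simp
  add_mem' := by
    intro f g hf hg u
    simp only [LinearMap.add_apply, hf u, hg u, map_add]
    abel
  smul_mem' := by
    intro c f hf u
    simp only [LinearMap.smul_apply, hf u, map_smul, smul_add]

/-- The `k[∂]`-module of conformal linear maps from `U` to `V`. -/
def Chom : Type _ := chomSubmodule k U V

instance : AddCommGroup (Chom k U V) := inferInstanceAs (AddCommGroup (chomSubmodule k U V))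

instance : Module k (Chom k U V) := inferInstanceAs (Module k (chomSubmodule k U V))

variable {k U V}

/-- The underlying `k`-linear map `U → V[λ]`. -/
def Chom.lin (f : Chom k U V) : U →ₗ[k] LPoly V := f.1

theorem Chom.ext' {f g : Chom k U V} (h : ∀ u, f.lin u = g.lin u) : f = g :=
  Subtype.ext (LinearMap.ext h)

theorem Chom.lin_del (f : Chom k U V) (u : U) :
    f.lin (del k U u) = coeffMap (del k V) (f.lin u) + lam k V (f.lin u) := f.2 u

theorem coeffMap_lam_comm {V W : Type*} [AddCommGroup V] [Module k V] [AddCommGroup W] [Module k W]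
    (T : V →ₗ[k] W) (x : LPoly V) :
    coeffMap T (lam k V x) = lam k W (coeffMap T x) := by
  induction x using Finsupp.induction_linear with
  | zero => simp
  | add a b ha hb => simp only [map_add, ha, hb]
  | single n v => simp [lam, Finsupp.lmapDomain_apply, Finsupp.mapDomain_single]

/-- The operator `(∂f)_λ = -λ f_λ` on conformal linear maps. -/
def Chom.delOp (k U V : Type*) [Field k] [AddCommGroup U] [Module k U] [Module k[X] U]
    [IsScalarTower k k[X] U] [AddCommGroup V] [Module k V] [Module k[X] V]
    [IsScalarTower k k[X] V] : Module.End k (Chom k U V) where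
  toFun f := ⟨-(lam k V ∘ₗ f.lin), fun u => by
    have h : f.lin (del k U u) = _ := f.2 u
    simp only [LinearMap.neg_apply, LinearMap.comp_apply, h, map_add, map_neg, coeffMap_lam_comm]
    abel⟩
  map_add' f g := Chom.ext' fun u => by
    change -(lam k V (f.lin u + g.lin u)) = -(lam k V (f.lin u)) + -(lam k V (g.lin u))
    rw [map_add]; abel
  map_smul' c f := Chom.ext' fun u => by
    change -(lam k V (c • f.lin u)) = c • -(lam k V (f.lin u))
    rw [map_smul, smul_neg]

/-- The `k[∂]`-module structure on `Chom(U, V)`, with `(∂f)_λ = -λ f_λ`. -/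
instance : Module k[X] (Chom k U V) :=
  Module.compHom _ (Polynomial.aeval (Chom.delOp k U V)).toRingHom

theorem Chom.smul_def (p : k[X]) (f : Chom k U V) :
    p • f = Polynomial.aeval (Chom.delOp k U V) p f := rfl

instance : IsScalarTower k k[X] (Chom k U V) where
  smul_assoc c p f := by
    rw [Chom.smul_def, Chom.smul_def, map_smul]; rfl

theorem Chom.del_lin (f : Chom k U V) (u : U) :
    (del k (Chom k U V) f).lin u = -lam k V (f.lin u) := by
  change ((Polynomial.X : k[X]) • f).lin u = _
  rw [Chom.smul_def, Polynomial.aeval_X]; rfl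

/-- A sesquilinear `λ`-product on `P`, as a homomorphism of `k[∂]`-modules from `P` to
`gc(P) = Chom(P, P)`. For a Lie conformal algebra this is `𝔞𝔡_P`, for an associative conformal
algebra it is `𝔏_P`. -/
def leftRep (m : LambdaProduct k V) (hm : IsSesquilinear m) : V →ₗ[k[X]] Chom k V V :=
  { toFun := fun a => ⟨m a, hm.del_right a⟩
    map_add' := fun a b => Subtype.ext (map_add m a b)
    map_smul' := fun p a => by
      set F : V →ₗ[k] Chom k V V :=
        { toFun := fun a => ⟨m a, hm.del_right a⟩
          map_add' := fun a b => Subtype.ext (map_add m a b)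
          map_smul' := fun c a => Subtype.ext (map_smul m c a) } with hF
      change F (p • a) = p • F a
      exact linear_of_del F (fun a => Chom.ext' fun u => by
        rw [Chom.del_lin]; exact hm.del_left a u) p a }

end Chom

/-! Polynomials in two indeterminates: in `k[X][X]` the outer indeterminate is `λ`, the inner one
is `μ`. -/

section DualForm

variable {k V : Type*} [Field k] [AddCommGroup V] [Module k V]

/-- For `φ_λ = ∑ λ ^ i φ_i` conformal linear and `f` in `V^{*c}`: the map
`u ↦ -f_{μ-λ}(φ_λ u)`. -/
def dualForm (φ : V →ₗ[k] LPoly V) (f : V →ₗ[k] k[X]) : V →ₗ[k] k[X][X] :=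
  -((Finsupp.lsum k fun i => LinearMap.mulLeft k (Polynomial.X ^ i : k[X][X]) ∘ₗ
    (Polynomial.aeval (Polynomial.C Polynomial.X - Polynomial.X : k[X][X])).toLinearMap ∘ₗ f) ∘ₗ φ)

theorem dualForm_apply (φ : V →ₗ[k] LPoly V) (f : V →ₗ[k] k[X]) (u : V) :
    dualForm φ f u = -((φ u).sum fun i v => Polynomial.X ^ i *
      Polynomial.aeval (Polynomial.C Polynomial.X - Polynomial.X : k[X][X]) (f v)) := rfl

theorem dualForm_aux (f : V →ₗ[k] k[X]) (x : LPoly V) :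
    (Finsupp.lsum k fun i => LinearMap.mulLeft k (Polynomial.X ^ i : k[X][X]) ∘ₗ
      (Polynomial.aeval (Polynomial.C Polynomial.X - Polynomial.X : k[X][X])).toLinearMap ∘ₗ f)
      (lam k V x) = Polynomial.X *
    (Finsupp.lsum k fun i => LinearMap.mulLeft k (Polynomial.X ^ i : k[X][X]) ∘ₗ
      (Polynomial.aeval (Polynomial.C Polynomial.X - Polynomial.X : k[X][X])).toLinearMap ∘ₗ f)
      x := by
  induction x using Finsupp.induction_linear with
  | zero => simp
  | add a b ha hb => simp only [map_add, ha, hb, mul_add]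
  | single n v =>
    simp [lam, Finsupp.lmapDomain_apply, Finsupp.mapDomain_single, pow_succ]; ring

theorem dualForm_lam (φ : V →ₗ[k] LPoly V) (f : V →ₗ[k] k[X]) (u : V) :
    dualForm (-(lam k V ∘ₗ φ)) f u = -(Polynomial.X * dualForm φ f u) := by
  simp only [dualForm, LinearMap.neg_apply, LinearMap.comp_apply, map_neg, dualForm_aux]
  ring

end DualForm

section Dual

variable (k V : Type*) [Field k] [AddCommGroup V] [Module k V] [Module k[X] V]
  [IsScalarTower k k[X] V]

/-- `k`-linear maps `f : V → k[λ]` with `f_λ(∂v) = λ f_λ(v)`. -/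
def dualSubmodule : Submodule k (V →ₗ[k] k[X]) where
  carrier := {f | ∀ v, f (del k V v) = Polynomial.X * f v}
  zero_mem' := by intro v; simp
  add_mem' := by
    intro f g hf hg v
    simp only [LinearMap.add_apply, hf v, hg v, mul_add]
  smul_mem' := by
    intro c f hf v
    simp only [LinearMap.smul_apply, hf v, mul_smul_comm]

/-- The conformal dual `V^{*c} = Chom(V, k)`. -/
def ConformalDual : Type _ := dualSubmodule k V

instance : AddCommGroup (ConformalDual k V) := inferInstanceAs (AddCommGroup (dualSubmodule k V))

instance : Module k (ConformalDual k V) := inferInstanceAs (Module k (dualSubmodule k V))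

variable {k V}

/-- The underlying `k`-linear map `V → k[λ]`. -/
def ConformalDual.lin (f : ConformalDual k V) : V →ₗ[k] k[X] := f.1

theorem ConformalDual.lin_del (f : ConformalDual k V) (v : V) :
    f.lin (del k V v) = Polynomial.X * f.lin v := f.2 v

theorem ConformalDual.lin_smul (f : ConformalDual k V) (p : k[X]) (v : V) :
    f.lin (p • v) = p * f.lin v :=
  linear_of_del (W := k[X]) f.lin (fun v => f.2 v) p v

theorem ConformalDual.ext' {f g : ConformalDual k V} (h : ∀ v, f.lin v = g.lin v) : f = g :=
  Subtype.ext (LinearMap.ext h)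

/-- The `k[∂]`-module structure on `V^{*c}`, with `(∂f)_λ = -λ f_λ`, that is,
`(p(∂) f)_λ = p(-λ) f_λ`. -/
instance : Module k[X] (ConformalDual k V) where
  smul p f := ⟨LinearMap.mulLeft k (p.comp (-Polynomial.X)) ∘ₗ f.lin, fun v => by
    simp only [LinearMap.comp_apply, LinearMap.mulLeft_apply, f.lin_del]; ring⟩
  one_smul f := ConformalDual.ext' fun v => by
    change (1 : k[X]).comp (-Polynomial.X) * f.lin v = f.lin v; simp
  mul_smul p q f := ConformalDual.ext' fun v => by
    change (p * q).comp (-Polynomial.X) * f.lin v =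
      p.comp (-Polynomial.X) * (q.comp (-Polynomial.X) * f.lin v)
    rw [Polynomial.mul_comp, mul_assoc]
  smul_zero p := ConformalDual.ext' fun v => by
    change p.comp (-Polynomial.X) * (0 : k[X]) = 0; simp
  smul_add p f g := ConformalDual.ext' fun v => by
    change p.comp (-Polynomial.X) * (f.lin v + g.lin v) = p.comp (-Polynomial.X) * f.lin v +
      p.comp (-Polynomial.X) * g.lin v
    rw [mul_add]
  add_smul p q f := ConformalDual.ext' fun v => by
    change (p + q).comp (-Polynomial.X) * f.lin v = p.comp (-Polynomial.X) * f.lin v +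
      q.comp (-Polynomial.X) * f.lin v
    rw [Polynomial.add_comp, add_mul]
  zero_smul f := ConformalDual.ext' fun v => by
    change (0 : k[X]).comp (-Polynomial.X) * f.lin v = 0; simp

theorem ConformalDual.smul_lin (p : k[X]) (f : ConformalDual k V) (v : V) :
    (p • f).lin v = p.comp (-Polynomial.X) * f.lin v := rfl

theorem ConformalDual.add_lin (f g : ConformalDual k V) (v : V) :
    (f + g).lin v = f.lin v + g.lin v := rfl

theorem ConformalDual.csmul_lin (c : k) (f : ConformalDual k V) (v : V) :
    (c • f).lin v = c • f.lin v := rfl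

instance : IsScalarTower k k[X] (ConformalDual k V) where
  smul_assoc c p f := ConformalDual.ext' fun v => by
    rw [ConformalDual.smul_lin, ConformalDual.csmul_lin, ConformalDual.smul_lin,
      Polynomial.smul_comp, smul_mul_assoc]

theorem ConformalDual.del_lin (f : ConformalDual k V) (v : V) :
    (del k (ConformalDual k V) f).lin v = -(Polynomial.X * f.lin v) := by
  change ((Polynomial.X : k[X]) • f).lin v = _
  rw [ConformalDual.smul_lin, Polynomial.X_comp, neg_mul]

theorem exists_natDegree_le [Module.Finite k[X] V] (G : V →ₗ[k] k[X][X])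
    (hG : ∀ v, G (del k V v) = Polynomial.C Polynomial.X * G v) :
    ∃ N : ℕ, ∀ v, (G v).natDegree ≤ N := by
  obtain ⟨S, hS⟩ := (Module.Finite.fg_top : (⊤ : Submodule k[X] V).FG)
  have hsm : ∀ (p : k[X]) (v : V), G (p • v) = Polynomial.C p * G v := by
    intro p v
    have := linear_of_del (W := k[X][X]) G (fun v => by
      rw [hG]; exact (Polynomial.smul_eq_C_mul _).symm) p v
    rw [this, Polynomial.smul_eq_C_mul]
  refine ⟨S.sup fun s => (G s).natDegree, fun v => ?_⟩
  have hv : v ∈ Submodule.span k[X] (S : Set V) := hS ▸ Submodule.mem_top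
  induction hv using Submodule.span_induction with
  | mem x hx => exact Finset.le_sup (f := fun s => (G s).natDegree) hx
  | zero => simp
  | add x y _ _ hx hy => rw [map_add]; exact (Polynomial.natDegree_add_le _ _).trans (max_le hx hy)
  | smul p x _ hx => rw [hsm]; exact (Polynomial.natDegree_C_mul_le _ _).trans hx

/-- A linear map `G : V → k[λ, μ]` with `G(∂v) = μ G(v)` is the same thing as an element
`F_λ` of `V^{*c}[λ]`, through `(F_λ)_μ(v) = G(v)`. -/
def curry [Module.Finite k[X] V] (G : V →ₗ[k] k[X][X])
    (hG : ∀ v, G (del k V v) = Polynomial.C Polynomial.X * G v) : LPoly (ConformalDual k V) :=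
  Finsupp.ofSupportFinite
    (fun n => ⟨(Polynomial.lcoeff k[X] n).restrictScalars k ∘ₗ G, fun v => by
      simp [hG, Polynomial.coeff_C_mul]⟩)
    (by
      obtain ⟨N, hN⟩ := exists_natDegree_le G hG
      refine (Set.finite_le_nat N).subset fun n hn => ?_
      by_contra h
      refine hn (Subtype.ext (LinearMap.ext fun v => ?_))
      exact Polynomial.coeff_eq_zero_of_natDegree_lt ((hN v).trans_lt (not_le.1 h)))

theorem curry_lin [Module.Finite k[X] V] (G : V →ₗ[k] k[X][X])
    (hG : ∀ v, G (del k V v) = Polynomial.C Polynomial.X * G v) (n : ℕ) (v : V) :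
    (curry G hG n).lin v = (G v).coeff n := rfl

theorem lam_zero {W : Type*} [AddCommGroup W] [Module k W] (x : LPoly W) : lam k W x 0 = 0 := by
  induction x using Finsupp.induction_linear with
  | zero => simp
  | add a b ha hb => rw [map_add, Finsupp.add_apply, ha, hb, add_zero]
  | single n v => simp [lam, Finsupp.lmapDomain_apply, Finsupp.mapDomain_single]

theorem lam_succ {W : Type*} [AddCommGroup W] [Module k W] (x : LPoly W) (n : ℕ) :
    lam k W x (n + 1) = x n :=
  Finsupp.mapDomain_apply Nat.succ_injective x n

theorem dualForm_aux' (f : V →ₗ[k] k[X]) (hf : ∀ v, f (del k V v) = Polynomial.X * f v)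
    (x : LPoly V) :
    (Finsupp.lsum k fun i => LinearMap.mulLeft k (Polynomial.X ^ i : k[X][X]) ∘ₗ
      (Polynomial.aeval (Polynomial.C Polynomial.X - Polynomial.X : k[X][X])).toLinearMap ∘ₗ f)
      (coeffMap (del k V) x) = (Polynomial.C Polynomial.X - Polynomial.X) *
    (Finsupp.lsum k fun i => LinearMap.mulLeft k (Polynomial.X ^ i : k[X][X]) ∘ₗ
      (Polynomial.aeval (Polynomial.C Polynomial.X - Polynomial.X : k[X][X])).toLinearMap ∘ₗ f)
      x := by
  induction x using Finsupp.induction_linear with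
  | zero => simp
  | add a b ha hb => simp only [map_add, ha, hb, mul_add]
  | single n v => simp [hf]; ring

theorem dualForm_del (φ : Chom k V V) (f : ConformalDual k V) (u : V) :
    dualForm φ.lin f.lin (del k V u) = Polynomial.C Polynomial.X * dualForm φ.lin f.lin u := by
  simp only [dualForm, LinearMap.neg_apply, LinearMap.comp_apply, φ.lin_del, map_add, dualForm_aux,
    dualForm_aux' f.lin f.2]
  ring

/-- For `φ` in `gc(V)`, the conformal linear map `φ^*` in `gc(V^{*c})` given by
`(φ^*_λ f)_μ u = -f_{μ-λ}(φ_λ u)`. -/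
def dualEnd [Module.Finite k[X] V] :
    Chom k V V →ₗ[k] Chom k (ConformalDual k V) (ConformalDual k V) where
  toFun φ := ⟨
    { toFun := fun f => curry (dualForm φ.lin f.lin) (dualForm_del φ f)
      map_add' := fun f g => Finsupp.ext fun n => ConformalDual.ext' fun v => by
        rw [Finsupp.add_apply, ConformalDual.add_lin]
        simp only [curry_lin, ← Polynomial.coeff_add]
        congr 1
        simp only [dualForm_apply, ConformalDual.add_lin, map_add, mul_add, Finsupp.sum_add]
        abel
      map_smul' := fun c f => Finsupp.ext fun n => ConformalDual.ext' fun v => by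
        rw [RingHom.id_apply, Finsupp.smul_apply, ConformalDual.csmul_lin]
        simp only [curry_lin, ← Polynomial.coeff_smul]
        congr 1
        simp only [dualForm_apply, ConformalDual.csmul_lin, map_smul, mul_smul_comm, smul_neg,
          Finsupp.smul_sum] },
    fun f => Finsupp.ext fun n => ConformalDual.ext' fun v => by
      have key : dualForm φ.lin (del k (ConformalDual k V) f).lin v =
          Polynomial.X * dualForm φ.lin f.lin v
            - Polynomial.C Polynomial.X * dualForm φ.lin f.lin v := by
        simp only [dualForm_apply, ConformalDual.del_lin, Finsupp.sum, map_neg, map_mul,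
          Polynomial.aeval_X, Finset.mul_sum, ← Finset.sum_neg_distrib,
          ← Finset.sum_sub_distrib]
        exact Finset.sum_congr rfl fun i _ => by ring
      change (dualForm φ.lin (del k (ConformalDual k V) f).lin v).coeff n = _
      rw [Finsupp.add_apply, ConformalDual.add_lin, key, Polynomial.coeff_sub,
        Polynomial.coeff_C_mul]
      rw [Finsupp.mapRange.linearMap_apply, Finsupp.mapRange_apply, ConformalDual.del_lin]
      change _ = -(Polynomial.X * (dualForm φ.lin f.lin v).coeff n) + _
      rw [sub_eq_add_neg, add_comm]
      congr 1
      cases n with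
      | zero => rw [lam_zero, Polynomial.coeff_X_mul_zero]; rfl
      | succ n => rw [lam_succ, Polynomial.coeff_X_mul]; rfl⟩
  map_add' φ ψ := Chom.ext' fun f => Finsupp.ext fun n => ConformalDual.ext' fun v => by
    change (dualForm (φ.lin + ψ.lin) f.lin v).coeff n =
      (dualForm φ.lin f.lin v).coeff n + (dualForm ψ.lin f.lin v).coeff n
    rw [← Polynomial.coeff_add]
    congr 1
    simp only [dualForm, LinearMap.neg_apply, LinearMap.comp_apply, LinearMap.add_apply, map_add]
    abel
  map_smul' c φ := Chom.ext' fun f => Finsupp.ext fun n => ConformalDual.ext' fun v => by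
    change (dualForm (c • φ.lin) f.lin v).coeff n = c • (dualForm φ.lin f.lin v).coeff n
    rw [← Polynomial.coeff_smul]
    congr 1
    simp only [dualForm, LinearMap.neg_apply, LinearMap.comp_apply, LinearMap.smul_apply, map_smul,
      smul_neg]

theorem dualEnd_lin [Module.Finite k[X] V] (φ : Chom k V V) (f : ConformalDual k V) (n : ℕ)
    (v : V) : ((dualEnd φ).lin f n).lin v = (dualForm φ.lin f.lin v).coeff n := rfl

theorem dualEnd_del [Module.Finite k[X] V] (φ : Chom k V V) :
    dualEnd (del k (Chom k V V) φ) =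
      del k (Chom k (ConformalDual k V) (ConformalDual k V)) (dualEnd φ) := by
  refine Chom.ext' fun f => Finsupp.ext fun n => ConformalDual.ext' fun v => ?_
  have h : (del k (Chom k V V) φ).lin = -(lam k V ∘ₗ φ.lin) :=
    LinearMap.ext fun u => Chom.del_lin φ u
  rw [Chom.del_lin, dualEnd_lin, h, dualForm_lam, Polynomial.coeff_neg]
  change _ = -(ConformalDual.lin (lam k _ _ n) v)
  congr 1
  cases n with
  | zero => rw [lam_zero, Polynomial.coeff_X_mul_zero]; rfl
  | succ n => rw [lam_succ, Polynomial.coeff_X_mul, dualEnd_lin]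

/-- The dual `ρ^* : P → gc(V^{*c})` of a homomorphism `ρ : P → gc(V)` of `k[∂]`-modules:
`(ρ^*(a)_λ f)_μ u = -f_{μ-λ}(ρ(a)_λ u)`. -/
def dualRep {P : Type*} [AddCommGroup P] [Module k P] [Module k[X] P] [IsScalarTower k k[X] P]
    [Module.Finite k[X] V] (ρ : P →ₗ[k[X]] Chom k V V) :
    P →ₗ[k[X]] Chom k (ConformalDual k V) (ConformalDual k V) where
  toFun a := dualEnd (ρ a)
  map_add' a b := by rw [map_add, map_add]
  map_smul' p a := by
    rw [map_smul, RingHom.id_apply]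
    exact linear_of_del (V := Chom k V V)
      (W := Chom k (ConformalDual k V) (ConformalDual k V)) dualEnd dualEnd_del p (ρ a)

/-- For a coproduct `F` on `V` and `f, g` in `V^{*c}`: the map
`v ↦ (f ⊗ g)_{λ, μ-λ}(F v) = ∑ f_λ(v₁) g_{μ-λ}(v₂)`. -/
def coproductForm (F : Coproduct k V) (f g : V →ₗ[k] k[X]) : V →ₗ[k] k[X][X] :=
  LinearMap.mul' k k[X][X] ∘ₗ
    TensorProduct.map ((Polynomial.aeval (Polynomial.X : k[X][X])).toLinearMap ∘ₗ f)
      ((Polynomial.aeval (Polynomial.C Polynomial.X - Polynomial.X : k[X][X])).toLinearMap ∘ₗ g) ∘ₗ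
    F.toLin

theorem coproductForm_del (F : Coproduct k V) (f g : ConformalDual k V) (v : V) :
    coproductForm F f.lin g.lin (del k V v) =
      Polynomial.C Polynomial.X * coproductForm F f.lin g.lin v := by
  simp only [coproductForm, LinearMap.comp_apply, F.map_del]
  induction F.toLin v using TensorProduct.induction_on with
  | zero => simp
  | add x y hx hy => simp only [map_add, hx, hy, mul_add]
  | tmul x y =>
    simp [del₂, f.lin_del, g.lin_del]
    ring

/-- The `λ`-product on `V^{*c}` obtained from a coproduct `F` on `V`:
`(f_λ g)_μ(v) = ∑ f_λ(v₁) g_{μ-λ}(v₂)` where `F v = ∑ v₁ ⊗ v₂`. -/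
def dualProduct [Module.Finite k[X] V] (F : Coproduct k V) :
    LambdaProduct k (ConformalDual k V) :=
  LinearMap.mk₂ k (fun f g => curry (coproductForm F f.lin g.lin) (coproductForm_del F f g))
    (fun f f' g => Finsupp.ext fun n => ConformalDual.ext' fun v => by
      rw [Finsupp.add_apply, ConformalDual.add_lin]
      simp only [curry_lin, ← Polynomial.coeff_add]
      have : (f + f').lin = f.lin + f'.lin := rfl
      simp only [coproductForm, this, LinearMap.comp_add, TensorProduct.map_add_left,
        LinearMap.add_apply, LinearMap.comp_apply, map_add])
    (fun c f g => Finsupp.ext fun n => ConformalDual.ext' fun v => by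
      rw [Finsupp.smul_apply, ConformalDual.csmul_lin]
      simp only [curry_lin, ← Polynomial.coeff_smul]
      have : (c • f).lin = c • f.lin := rfl
      simp only [coproductForm, this, LinearMap.comp_smul, TensorProduct.map_smul_left,
        LinearMap.smul_apply, LinearMap.comp_apply, map_smul])
    (fun f g g' => Finsupp.ext fun n => ConformalDual.ext' fun v => by
      rw [Finsupp.add_apply, ConformalDual.add_lin]
      simp only [curry_lin, ← Polynomial.coeff_add]
      have : (g + g').lin = g.lin + g'.lin := rfl
      simp only [coproductForm, this, LinearMap.comp_add, TensorProduct.map_add_right,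
        LinearMap.add_apply, LinearMap.comp_apply, map_add])
    (fun c f g => Finsupp.ext fun n => ConformalDual.ext' fun v => by
      rw [Finsupp.smul_apply, ConformalDual.csmul_lin]
      simp only [curry_lin, ← Polynomial.coeff_smul]
      have : (c • g).lin = c • g.lin := rfl
      simp only [coproductForm, this, LinearMap.comp_smul, TensorProduct.map_smul_right,
        LinearMap.smul_apply, LinearMap.comp_apply, map_smul])

theorem dualProduct_lin [Module.Finite k[X] V] (F : Coproduct k V) (f g : ConformalDual k V)
    (n : ℕ) (v : V) :
    (dualProduct F f g n).lin v = (coproductForm F f.lin g.lin v).coeff n := rfl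

theorem dualProduct_sesq [Module.Finite k[X] V] (F : Coproduct k V) :
    IsSesquilinear (dualProduct F) where
  del_left f g := Finsupp.ext fun n => ConformalDual.ext' fun v => by
    have key : coproductForm F (del k (ConformalDual k V) f).lin g.lin v =
        -(Polynomial.X * coproductForm F f.lin g.lin v) := by
      simp only [coproductForm, LinearMap.comp_apply]
      induction F.toLin v using TensorProduct.induction_on with
      | zero => simp
      | add x y hx hy => simp only [map_add, hx, hy, mul_add, neg_add]
      | tmul x y => simp [ConformalDual.del_lin]; ring
    rw [dualProduct_lin, key, Polynomial.coeff_neg]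
    change _ = -(ConformalDual.lin (lam k _ _ n) v)
    congr 1
    cases n with
    | zero => rw [lam_zero, Polynomial.coeff_X_mul_zero]; rfl
    | succ n => rw [lam_succ, Polynomial.coeff_X_mul]; rfl
  del_right f g := Finsupp.ext fun n => ConformalDual.ext' fun v => by
    have key : coproductForm F f.lin (del k (ConformalDual k V) g).lin v =
        -(Polynomial.C Polynomial.X * coproductForm F f.lin g.lin v) +
          Polynomial.X * coproductForm F f.lin g.lin v := by
      simp only [coproductForm, LinearMap.comp_apply]
      induction F.toLin v using TensorProduct.induction_on with
      | zero => simp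
      | add x y hx hy => simp only [map_add, hx, hy, mul_add]; ring
      | tmul x y => simp [ConformalDual.del_lin]; ring
    rw [dualProduct_lin, key, Polynomial.coeff_add, Polynomial.coeff_neg, Polynomial.coeff_C_mul,
      Finsupp.add_apply, ConformalDual.add_lin, Finsupp.mapRange.linearMap_apply,
      Finsupp.mapRange_apply, ConformalDual.del_lin, dualProduct_lin]
    congr 1
    cases n with
    | zero => rw [lam_zero, Polynomial.coeff_X_mul_zero]; rfl
    | succ n => rw [lam_succ, Polynomial.coeff_X_mul]; rfl

theorem comp_neg_neg (p : k[X]) :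
    (p.comp (-Polynomial.X)).comp (-Polynomial.X) = p := by
  rw [Polynomial.comp_assoc]; simp

/-- The element of `V^{*c}` with prescribed values on a basis of `V`. -/
def dualOfBasis {ι : Type*} [Fintype ι] (b : Module.Basis ι k[X] V) (q : ι → k[X]) :
    ConformalDual k V :=
  ⟨∑ i, LinearMap.mulLeft k (q i) ∘ₗ (b.coord i).restrictScalars k, fun v => by
    have : del k V v = (Polynomial.X : k[X]) • v := rfl
    simp only [LinearMap.sum_apply, LinearMap.comp_apply, LinearMap.mulLeft_apply,
      LinearMap.restrictScalars_apply, this, map_smul, smul_eq_mul, Finset.mul_sum]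
    exact Finset.sum_congr rfl fun i _ => by ring⟩

theorem dualOfBasis_lin {ι : Type*} [Fintype ι] (b : Module.Basis ι k[X] V) (q : ι → k[X])
    (v : V) : (dualOfBasis b q).lin v = ∑ i, q i * b.repr v i := by
  change (∑ i, LinearMap.mulLeft k (q i) ∘ₗ (b.coord i).restrictScalars k :
    V →ₗ[k] k[X]) v = _
  simp [LinearMap.sum_apply]

theorem dual_lin_eq_sum {ι : Type*} [Fintype ι] (b : Module.Basis ι k[X] V)
    (f : ConformalDual k V) (v : V) : f.lin v = ∑ i, f.lin (b i) * b.repr v i := by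
  conv_lhs => rw [← b.sum_repr v]
  rw [map_sum]
  exact Finset.sum_congr rfl fun i _ => by rw [f.lin_smul, mul_comm]

theorem dual_eq_sum {ι : Type*} [Fintype ι] [DecidableEq ι] (b : Module.Basis ι k[X] V)
    (f : ConformalDual k V) :
    f = ∑ i, (f.lin (b i)).comp (-Polynomial.X) • dualOfBasis b (Pi.single i 1) := by
  refine ConformalDual.ext' fun v => ?_
  have hsum : ∀ (s : Finset ι) (F : ι → ConformalDual k V),
      (∑ i ∈ s, F i).lin v = ∑ i ∈ s, (F i).lin v := by
    intro s F
    exact map_sum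
      ({ toFun := fun f : ConformalDual k V => f.lin v, map_zero' := rfl,
         map_add' := fun _ _ => rfl } : ConformalDual k V →+ k[X]) F s
  rw [hsum, dual_lin_eq_sum b f v]
  refine Finset.sum_congr rfl fun i _ => ?_
  rw [ConformalDual.smul_lin, comp_neg_neg, dualOfBasis_lin]
  simp [Pi.single_apply]

instance [Module.Free k[X] V] [Module.Finite k[X] V] :
    Module.Finite k[X] (ConformalDual k V) := by
  classical
  have b := Module.Free.chooseBasis k[X] V
  refine ⟨⟨Finset.univ.image fun i => dualOfBasis b (Pi.single i 1), ?_⟩⟩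
  refine eq_top_iff.2 fun f _ => ?_
  rw [dual_eq_sum b f]
  refine Submodule.sum_mem _ fun i _ => Submodule.smul_mem _ _ (Submodule.subset_span ?_)
  simp

/-- The canonical map `V → (V^{*c})^{*c}`, `v ↦ (f ↦ f_{-λ}(v))`. -/
def toDoubleDual (k V : Type*) [Field k] [AddCommGroup V] [Module k V] [Module k[X] V]
    [IsScalarTower k k[X] V] : V →ₗ[k[X]] ConformalDual k (ConformalDual k V) where
  toFun v := ⟨
    { toFun := fun f => (f.lin v).comp (-Polynomial.X)
      map_add' := fun f g => by rw [ConformalDual.add_lin, Polynomial.add_comp]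
      map_smul' := fun c f => by
        rw [ConformalDual.csmul_lin, Polynomial.smul_comp, RingHom.id_apply] },
    fun f => by
      change ((del k (ConformalDual k V) f).lin v).comp (-Polynomial.X) =
        Polynomial.X * (f.lin v).comp (-Polynomial.X)
      rw [ConformalDual.del_lin]; simp⟩
  map_add' v w := ConformalDual.ext' fun f => by
    change (f.lin (v + w)).comp (-Polynomial.X) =
      (f.lin v).comp (-Polynomial.X) + (f.lin w).comp (-Polynomial.X)
    rw [map_add, Polynomial.add_comp]
  map_smul' p v := ConformalDual.ext' fun f => by
    change (f.lin (p • v)).comp (-Polynomial.X) =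
      p.comp (-Polynomial.X) * (f.lin v).comp (-Polynomial.X)
    rw [f.lin_smul, Polynomial.mul_comp]

theorem toDoubleDual_lin (v : V) (f : ConformalDual k V) :
    (toDoubleDual k V v).lin f = (f.lin v).comp (-Polynomial.X) := rfl

theorem toDoubleDual_bijective (k V : Type*) [Field k] [AddCommGroup V] [Module k V]
    [Module k[X] V] [IsScalarTower k k[X] V] [Module.Free k[X] V] [Module.Finite k[X] V] :
    Function.Bijective (toDoubleDual k V) := by
  classical
  have b := Module.Free.chooseBasis k[X] V
  constructor
  · rw [injective_iff_map_eq_zero]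
    intro v hv
    refine b.ext_elem fun i => ?_
    have h : (toDoubleDual k V v).lin (dualOfBasis b (Pi.single i 1)) = 0 := by rw [hv]; rfl
    rw [toDoubleDual_lin, dualOfBasis_lin] at h
    have h2 := congrArg (fun p : k[X] => p.comp (-Polynomial.X)) h
    simp only [comp_neg_neg] at h2
    simpa [Pi.single_apply] using h2
  · intro F
    refine ⟨∑ i, (F.lin (dualOfBasis b (Pi.single i 1))).comp (-Polynomial.X) • b i, ?_⟩
    refine ConformalDual.ext' fun f => ?_
    rw [toDoubleDual_lin]
    conv_rhs => rw [dual_eq_sum b f]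
    rw [map_sum, map_sum, Polynomial.sum_comp]
    refine Finset.sum_congr rfl fun i _ => ?_
    rw [f.lin_smul, F.lin_smul, Polynomial.mul_comp, comp_neg_neg, mul_comm]

/-- The canonical isomorphism `V ≅ (V^{*c})^{*c}` for `V` free of finite rank. -/
def doubleDualEquiv (k V : Type*) [Field k] [AddCommGroup V] [Module k V]
    [Module k[X] V] [IsScalarTower k k[X] V] [Module.Free k[X] V] [Module.Finite k[X] V] :
    V ≃ₗ[k[X]] ConformalDual k (ConformalDual k V) :=
  LinearEquiv.ofBijective (toDoubleDual k V) (toDoubleDual_bijective k V)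

end Dual

section Transport

variable {k V W : Type*} [Field k] [AddCommGroup V] [Module k V] [Module k[X] V]
  [IsScalarTower k k[X] V] [AddCommGroup W] [Module k W] [Module k[X] W] [IsScalarTower k k[X] W]

/-- Transport of conformal linear maps along an isomorphism `E : V ≅ W`:
`φ_λ ↦ E⁻¹ φ_λ E`. -/
def Chom.transport (E : V ≃ₗ[k[X]] W) : Chom k W W →ₗ[k] Chom k V V where
  toFun φ := ⟨coeffMap (E.symm.toLinearMap.restrictScalars k) ∘ₗ φ.lin ∘ₗ
      E.toLinearMap.restrictScalars k, fun v => by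
    have h1 : E (del k V v) = del k W (E v) := map_smul E _ v
    have h2 : ∀ x : LPoly W, coeffMap (E.symm.toLinearMap.restrictScalars k)
        (coeffMap (del k W) x) =
        coeffMap (del k V) (coeffMap (E.symm.toLinearMap.restrictScalars k) x) := fun x =>
      Finsupp.ext fun n => map_smul E.symm _ (x n)
    change coeffMap _ (φ.lin (E (del k V v))) = coeffMap _ (coeffMap _ (φ.lin (E v))) +
      lam k V (coeffMap _ (φ.lin (E v)))
    rw [h1, φ.lin_del, map_add, h2, coeffMap_lam_comm]⟩
  map_add' φ ψ := Chom.ext' fun v => by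
    change coeffMap (E.symm.toLinearMap.restrictScalars k) (φ.lin (E v) + ψ.lin (E v)) =
      coeffMap (E.symm.toLinearMap.restrictScalars k) (φ.lin (E v)) +
        coeffMap (E.symm.toLinearMap.restrictScalars k) (ψ.lin (E v))
    rw [map_add]
  map_smul' c φ := Chom.ext' fun v => by
    change coeffMap (E.symm.toLinearMap.restrictScalars k) (c • φ.lin (E v)) =
      c • coeffMap (E.symm.toLinearMap.restrictScalars k) (φ.lin (E v))
    rw [map_smul]

theorem Chom.transport_lin (E : V ≃ₗ[k[X]] W) (φ : Chom k W W) (v : V) :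
    (Chom.transport E φ).lin v =
      coeffMap (E.symm.toLinearMap.restrictScalars k) (φ.lin (E v)) := rfl

theorem Chom.transport_del (E : V ≃ₗ[k[X]] W) (φ : Chom k W W) :
    Chom.transport E (del k (Chom k W W) φ) = del k (Chom k V V) (Chom.transport E φ) :=
  Chom.ext' fun v => by
    rw [Chom.del_lin, Chom.transport_lin, Chom.transport_lin, Chom.del_lin, map_neg,
      coeffMap_lam_comm]

/-- Transport of a homomorphism `ρ : P → gc(W)` to `P → gc(V)` along an isomorphism
`E : V ≅ W`: `ρ(a)_λ ↦ E⁻¹ ρ(a)_λ E`. -/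
def transportRep {P : Type*} [AddCommGroup P] [Module k P] [Module k[X] P]
    [IsScalarTower k k[X] P] (E : V ≃ₗ[k[X]] W) (ρ : P →ₗ[k[X]] Chom k W W) :
    P →ₗ[k[X]] Chom k V V where
  toFun a := Chom.transport E (ρ a)
  map_add' a b := by rw [map_add, map_add]
  map_smul' p a := by
    rw [map_smul, RingHom.id_apply]
    exact linear_of_del (V := Chom k W W) (W := Chom k V V) (Chom.transport E)
      (Chom.transport_del E) p (ρ a)

/-- For a `λ`-product `m` on `V^{*c}`, with left multiplications `𝔏` (`𝔏 = 𝔞𝔡` for a Lie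
bracket): the dual `𝔏^* : V^{*c} → gc(V^{*c*c}) = gc(V)`, where `V^{*c*c}` is identified
with `V` canonically. -/
def codualRep [Module.Free k[X] V] [Module.Finite k[X] V]
    (m : LambdaProduct k (ConformalDual k V)) (hm : IsSesquilinear m) :
    ConformalDual k V →ₗ[k[X]] Chom k V V :=
  transportRep (doubleDualEquiv k V) (dualRep (leftRep m hm))

end Transport

/-! ### Matched pairs -/

section MatchedPair

variable {k P Q : Type*} [Field k]
  [AddCommGroup P] [Module k P] [Module k[X] P] [IsScalarTower k k[X] P]
  [AddCommGroup Q] [Module k Q] [Module k[X] Q] [IsScalarTower k k[X] Q]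

theorem Chom.add_lin (φ ψ : Chom k P Q) : (φ + ψ).lin = φ.lin + ψ.lin := rfl

theorem Chom.smul_lin (c : k) (φ : Chom k P Q) : (c • φ).lin = c • φ.lin := rfl

theorem rep_smul (σ : P →ₗ[k[X]] Chom k Q Q) (c : k) (a : P) : σ (c • a) = c • σ a := by
  rw [← algebraMap_smul k[X] c a, map_smul, algebraMap_smul]

/-- The `λ`-product on `P ⊕ Q`, for a sign `ε`:
`(a + x)_λ (b + y) = (a_λ b + σ_Q(x)_λ b + ε σ_Q(y)_{-λ-∂} a)
  + (x_λ y + σ_P(a)_λ y + ε σ_P(b)_{-λ-∂} x)`. -/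
def sumProduct (ε : k) (mP : LambdaProduct k P) (mQ : LambdaProduct k Q)
    (σP : P →ₗ[k[X]] Chom k Q Q) (σQ : Q →ₗ[k[X]] Chom k P P) : LambdaProduct k (P × Q) :=
  LinearMap.mk₂ k (fun u v =>
      coeffMap (LinearMap.inl k P Q) (mP u.1 v.1 + (σQ u.2).lin v.1 +
        ε • opp (del k P) ((σQ v.2).lin u.1)) +
      coeffMap (LinearMap.inr k P Q) (mQ u.2 v.2 + (σP u.1).lin v.2 +
        ε • opp (del k Q) ((σP v.1).lin u.2)))
    (fun u u' v => by
      simp only [Prod.fst_add, Prod.snd_add, map_add, LinearMap.add_apply, Chom.add_lin, smul_add]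
      abel)
    (fun c u v => by
      simp only [Prod.smul_fst, Prod.smul_snd, map_smul, LinearMap.smul_apply, rep_smul,
        Chom.smul_lin, smul_add, smul_comm ε c, map_add])
    (fun u v v' => by
      simp only [Prod.fst_add, Prod.snd_add, map_add, LinearMap.add_apply, Chom.add_lin, smul_add]
      abel)
    (fun c u v => by
      simp only [Prod.smul_fst, Prod.smul_snd, map_smul, LinearMap.smul_apply, rep_smul,
        Chom.smul_lin, smul_add, smul_comm ε c, map_add])

/-- Matched pairs of Poisson conformal algebras `(P, Q, ρ_P, l_P, ρ_Q, l_Q)`. -/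
structure IsMatchedPair (brP mulP : LambdaProduct k P) (brQ mulQ : LambdaProduct k Q)
    (ρP lP : P →ₗ[k[X]] Chom k Q Q) (ρQ lQ : Q →ₗ[k[X]] Chom k P P) : Prop where
  left : IsPoissonConformalAlgebra brP mulP
  right : IsPoissonConformalAlgebra brQ mulQ
  sum : IsPoissonConformalAlgebra (sumProduct (-1) brP brQ ρP ρQ) (sumProduct 1 mulP mulQ lP lQ)

end MatchedPair

/-! ### Conformal bilinear forms and Manin triples -/

section ManinTriple

variable {k R : Type*} [Field k] [AddCommGroup R] [Module k R]

/-- `⟨a_λ b, c⟩_μ = ⟨a, b_{μ-∂} c⟩_λ`, as an identity in `k[λ, μ]` (in `k[X][X]` the outer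
indeterminate `Polynomial.X` is `λ` and the inner one `Polynomial.C Polynomial.X` is `μ`).
Here `b_{μ-∂} c` is first computed in `R[μ]`. -/
def IsInvariantForm [Module k[X] R] [IsScalarTower k k[X] R] (m : LambdaProduct k R)
    (B : R →ₗ[k] R →ₗ[k] k[X]) : Prop :=
  ∀ a b c : R,
    ((m a b).sum fun i x => (Polynomial.X : k[X][X]) ^ i *
      Polynomial.aeval (Polynomial.C Polynomial.X : k[X][X]) (B x c)) =
    (subst (lam k R - coeffMap (del k R)) (const k R) (m b c)).sum fun j y =>
      (Polynomial.C Polynomial.X : k[X][X]) ^ j *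
        Polynomial.aeval (Polynomial.X : k[X][X]) (B a y)

variable [Module k[X] R] [IsScalarTower k k[X] R]

/-- Conformal bilinear forms `⟨·, ·⟩_λ : R × R → k[λ]`. -/
structure IsConformalForm (B : R →ₗ[k] R →ₗ[k] k[X]) : Prop where
  del_left : ∀ a b, B (del k R a) b = -(Polynomial.X * B a b)
  del_right : ∀ a b, B a (del k R b) = Polynomial.X * B a b

/-- Symmetry: `⟨a, b⟩_λ = ⟨b, a⟩_{-λ}`. -/
def IsSymmetricForm (B : R →ₗ[k] R →ₗ[k] k[X]) : Prop :=
  ∀ a b, B a b = (B b a).comp (-Polynomial.X)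

/-- Nondegeneracy: `a ↦ ⟨a, ·⟩_λ` is a bijection from `R` to `R^{*c}`. -/
def IsNondegenerateForm (B : R →ₗ[k] R →ₗ[k] k[X]) : Prop :=
  (∀ a, (∀ b, B a b = 0) → a = 0) ∧ ∀ φ : ConformalDual k R, ∃ a, ∀ b, B a b = φ.lin b

variable {P Q : Type*}
  [AddCommGroup P] [Module k P] [Module k[X] P] [IsScalarTower k k[X] P]
  [AddCommGroup Q] [Module k Q] [Module k[X] Q] [IsScalarTower k k[X] Q]

/-- The homomorphism `i : P → R` of `k[∂]`-modules is compatible with the `λ`-products `m` of `P`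
and `n` of `R`; when `i` is injective, `(P, m)` is a subalgebra of `(R, n)` through `i`. -/
def IsSubproduct (i : P →ₗ[k[X]] R) (m : LambdaProduct k P) (n : LambdaProduct k R) : Prop :=
  ∀ a b, n (i a) (i b) = coeffMap (i.restrictScalars k) (m a b)

/-- Manin triples of Poisson conformal algebras `(R, P, Q)`, with respect to the bilinear form
`B` on `R`; `P` and `Q` are considered as submodules of `R` through the maps `i` and `j`. -/
structure IsManinTriple (brR mulR : LambdaProduct k R) (brP mulP : LambdaProduct k P)
    (brQ mulQ : LambdaProduct k Q) (i : P →ₗ[k[X]] R) (j : Q →ₗ[k[X]] R)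
    (B : R →ₗ[k] R →ₗ[k] k[X]) : Prop where
  algR : IsPoissonConformalAlgebra brR mulR
  algP : IsPoissonConformalAlgebra brP mulP
  algQ : IsPoissonConformalAlgebra brQ mulQ
  conformal : IsConformalForm B
  symm : IsSymmetricForm B
  nondeg : IsNondegenerateForm B
  inv_br : IsInvariantForm brR B
  inv_mul : IsInvariantForm mulR B
  sub_brP : IsSubproduct i brP brR
  sub_mulP : IsSubproduct i mulP mulR
  sub_brQ : IsSubproduct j brQ brR
  sub_mulQ : IsSubproduct j mulQ mulR
  /-- `R = P ⊕ Q` as `k[∂]`-modules -/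
  directSum : Function.Bijective (i.coprod j)
  isotropicP : ∀ a b, B (i a) (i b) = 0
  isotropicQ : ∀ x y, B (j x) (j y) = 0

/-- The bilinear form `⟨a + f, b + g⟩_λ = f_λ(b) + g_{-λ}(a)` on `P ⊕ P^{*c}`. -/
def standardForm (k P : Type*) [Field k] [AddCommGroup P] [Module k P] [Module k[X] P]
    [IsScalarTower k k[X] P] :
    (P × ConformalDual k P) →ₗ[k] (P × ConformalDual k P) →ₗ[k] k[X] :=
  LinearMap.mk₂ k (fun u v => u.2.lin v.1 + (v.2.lin u.1).comp (-Polynomial.X))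
    (fun u u' v => by
      simp only [Prod.fst_add, Prod.snd_add, map_add, ConformalDual.add_lin, Polynomial.add_comp]
      abel)
    (fun c u v => by
      simp only [Prod.smul_fst, Prod.smul_snd, map_smul, ConformalDual.csmul_lin,
        Polynomial.smul_comp, smul_add])
    (fun u v v' => by
      simp only [Prod.fst_add, Prod.snd_add, map_add, ConformalDual.add_lin, Polynomial.add_comp]
      abel)
    (fun c u v => by
      simp only [Prod.smul_fst, Prod.smul_snd, map_smul, ConformalDual.csmul_lin,
        Polynomial.smul_comp, smul_add])

end ManinTriple

end PoissonConformal

end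

open PoissonConformal

/-! Since `k` is infinite, an identity in `P[λ]` or `P[λ, μ]` holds as soon as it holds for all
scalar values of the indeterminates. Attach to each element of `R = P ⊕ P^{*c}` a weight `x` in `k`,
as if passing to the fibre of `R` at `∂ = x`. A product of elements of weights `x` and `y` is taken
at `λ = -x` and gets weight `x + y`; the form pairs weights `x` and `-x` only. Then `-λ-∂` is minus
the weight of the other factor, and the conformal axioms turn into those of an ordinary algebra with
a symmetric form satisfying `F(uv, w) = F(u, vw)`.

For such products, the Jacobi, associative and Leibniz identities paired with a fourth element `t`
become relations between the ways of splitting `u, v, w, t` into two pairs. Jacobi, for instance,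
reads `F([u,v],[w,t]) + F([v,w],[u,t]) + F([w,u],[v,t]) = 0`. The Jacobi and associativity
conditions are stable under all permutations. The Leibniz condition is symmetric in its last three
arguments, and its versions for the four choices of first argument add up to zero. So each argument
may be taken in `P` or in `P^{*c}`, in few configurations. If three arguments lie in one summand,
the identity is an axiom of `P`, or an axiom of `P^{*c}`, that is, a dualized coalgebra axiom.

There remain two arguments `a, b` in `P` and two arguments `f, g` in `P^{*c}`. There
`F([a,b],[f,g])` is `f ⊗ g` applied to `δ([a_λ b])`, while `F([a,f],[b,g])` is a sum of two terms in
which `𝔞𝔡` acts on `δ(a)` or `δ(b)`; similarly with the other products. Thus Jacobi is the Lie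
bialgebra condition, associativity is the pair of infinitesimal bialgebra conditions, and Leibniz is
the condition on `Δ([a_λ b])` or on `δ(a_λ b)`, according to whether its first argument lies in `P`
or in `P^{*c}`.

This computation uses only that the products on `P ⊕ P^{*c}` are invariant and extend the given ones
(`IsDouble`). The products in (b) have this property (`isDouble_sumProduct`), and so do those of
every Manin triple in (c). Hence `isPoissonConformalAlgebra_double_iff` gives all the implications.
-/

noncomputable section

namespace PoissonConformal

/-! ### Specialization of the indeterminates at scalars -/

section Specialize

variable {k V W : Type*} [Field k] [AddCommGroup V] [Module k V] [AddCommGroup W] [Module k W]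

/-- The value at `λ = x` of a polynomial in `V[λ]`. -/
def ev (x : k) : LPoly V →ₗ[k] V := Finsupp.lsum k fun n => x ^ n • LinearMap.id

theorem ev_apply (x : k) (p : LPoly V) : ev x p = p.sum fun n v => x ^ n • v := rfl

theorem ev_single (x : k) (n : ℕ) (v : V) : ev x (Finsupp.single n v : LPoly V) = x ^ n • v := by
  simp [ev]

theorem ev_const (x : k) (v : V) : ev x (const k V v) = v := by
  simp [const, ev_single]

theorem ev_lam (x : k) (p : LPoly V) : ev x (lam k V p) = x • ev x p := by
  induction p using Finsupp.induction_linear with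
  | zero => simp
  | add a b ha hb => simp only [map_add, ha, hb, smul_add]
  | single n v =>
    simp [lam, Finsupp.lmapDomain_apply, Finsupp.mapDomain_single, ev_single, pow_succ', mul_smul]

theorem ev_coeffMap (x : k) (T : V →ₗ[k] W) (p : LPoly V) : ev x (coeffMap T p) = T (ev x p) := by
  induction p using Finsupp.induction_linear with
  | zero => simp
  | add a b ha hb => simp only [map_add, ha, hb]
  | single n v => simp [ev_single]

/-- If `φ` turns `T` into the scalar `c`, it cannot distinguish substitution of `T` from evaluation
at `c`. All the substitutions `λ + μ`, `-λ-∂` and `μ-∂` are evaluated in this way. -/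
theorem map_subst {W' : Type*} [AddCommGroup W'] [Module k W'] (φ : W →ₗ[k] W')
    {T : Module.End k W} {c : k} (hT : ∀ w, φ (T w) = c • φ w) (f : V →ₗ[k] W) (p : LPoly V) :
    φ (subst T f p) = φ (f (ev c p)) := by
  have hpow : ∀ (n : ℕ) (w : W), φ ((T ^ n) w) = c ^ n • φ w := by
    intro n
    induction n with
    | zero => intro w; simp
    | succ n ih => intro w; rw [pow_succ', Module.End.mul_apply, hT, ih, pow_succ', mul_smul]
  induction p using Finsupp.induction_linear with
  | zero => simp
  | add a b ha hb => simp only [map_add, ha, hb]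
  | single n v => simp [subst, ev_single, hpow]

theorem map_ev_opp (φ : V →ₗ[k] W) {D : Module.End k V} {β : k} (hφ : ∀ v, φ (D v) = β • φ v)
    (x : k) (p : LPoly V) : φ (ev x (opp D p)) = φ (ev (-x - β) p) := by
  have := map_subst (φ ∘ₗ ev x) (T := -lam k V - coeffMap D) (c := -x - β) (fun q => by
    simp only [LinearMap.comp_apply, LinearMap.sub_apply, LinearMap.neg_apply, map_sub, map_neg,
      ev_lam, ev_coeffMap, hφ, map_smul, sub_smul, neg_smul]) (const k V) p
  rw [opp]
  simpa only [LinearMap.comp_apply, ev_const] using this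

/-- A functional applied to the coefficients reduces this to an ordinary polynomial with infinitely
many zeros. -/
theorem ev_ext [Infinite k] {p q : LPoly V} (h : ∀ x : k, ev x p = ev x q) : p = q := by
  rw [← sub_eq_zero]
  set r := p - q with hr
  have h0 : ∀ x : k, ev x r = 0 := fun x => by rw [hr, map_sub, h x, sub_self]
  ext n
  rw [Finsupp.zero_apply, ← Module.forall_dual_apply_eq_zero_iff k]
  intro φ
  have hp : ∀ s : LPoly V, ∀ x : k, ((Finsupp.lsum k fun n =>
      (Polynomial.monomial n : k →ₗ[k] k[X]) ∘ₗ φ) s).eval x = φ (ev x s) := by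
    intro s x
    induction s using Finsupp.induction_linear with
    | zero => simp
    | add a b ha hb => simp only [map_add, Polynomial.eval_add, ha, hb]
    | single n v => simp [ev_single, mul_comm]
  have hc : ∀ s : LPoly V, ((Finsupp.lsum k fun n =>
      (Polynomial.monomial n : k →ₗ[k] k[X]) ∘ₗ φ) s).coeff n = φ (s n) := by
    intro s
    induction s using Finsupp.induction_linear with
    | zero => simp
    | add a b ha hb => simp only [map_add, Polynomial.coeff_add, Finsupp.add_apply, ha, hb]
    | single m v =>
      by_cases hmn : m = n <;> simp [Polynomial.coeff_monomial, hmn]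
  have hz : (Finsupp.lsum k fun n => (Polynomial.monomial n : k →ₗ[k] k[X]) ∘ₗ φ) r = 0 :=
    Polynomial.funext fun x => by rw [hp, h0, map_zero, Polynomial.eval_zero]
  rw [← hc, hz, Polynomial.coeff_zero]

theorem ev_ev_ext [Infinite k] {p q : LPoly (LPoly V)}
    (h : ∀ x y : k, ev y (ev x p) = ev y (ev x q)) : p = q :=
  ev_ext fun x => ev_ext fun y => h x y

/-- The specialization `a_x b` at `λ = x` of a `λ`-product `a_λ b`. -/
def specialize (m : LambdaProduct k V) (x : k) : V →ₗ[k] V →ₗ[k] V := m.compr₂ (ev x)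

theorem specialize_apply (m : LambdaProduct k V) (x : k) (a b : V) :
    specialize m x a b = ev x (m a b) := rfl

theorem ev_ev_lam₂ (x y : k) (p : LPoly (LPoly V)) :
    (ev y ∘ₗ ev x) (lam₂ k V p) = x • (ev y ∘ₗ ev x) p := by
  simp [lam₂, ev_lam]

theorem ev_ev_mu₂ (x y : k) (p : LPoly (LPoly V)) :
    (ev y ∘ₗ ev x) (mu₂ k V p) = y • (ev y ∘ₗ ev x) p := by
  simp only [mu₂, LinearMap.comp_apply, ev_coeffMap, ev_lam]

theorem ev_ev_add₂ (x y : k) (p : LPoly (LPoly V)) :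
    (ev y ∘ₗ ev x) ((lam₂ k V + mu₂ k V) p) = (x + y) • (ev y ∘ₗ ev x) p := by
  rw [LinearMap.add_apply, map_add, ev_ev_lam₂, ev_ev_mu₂, add_smul]

theorem ev_ev_const₂ (x y : k) (v : V) : (ev y ∘ₗ ev x) (const₂ k V v) = v := by
  simp [const₂, ev_const]

theorem ev_nestLeft (m n : LambdaProduct k V) {x y s t : k} {S T : Module.End k (LPoly (LPoly V))}
    (hS : ∀ p, (ev y ∘ₗ ev x) (S p) = s • (ev y ∘ₗ ev x) p)
    (hT : ∀ p, (ev y ∘ₗ ev x) (T p) = t • (ev y ∘ₗ ev x) p) (a b c : V) :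
    ev y (ev x (nestLeft m n S T a b c)) = specialize n t (specialize m s a b) c := by
  change (ev y ∘ₗ ev x) (nestLeft m n S T a b c) = _
  rw [nestLeft, map_subst _ hS, LinearMap.comp_apply (subst T _), map_subst _ hT, ev_ev_const₂]
  rfl

theorem ev_nestRight (m n : LambdaProduct k V) {x y s t : k}
    {S T : Module.End k (LPoly (LPoly V))}
    (hS : ∀ p, (ev y ∘ₗ ev x) (S p) = s • (ev y ∘ₗ ev x) p)
    (hT : ∀ p, (ev y ∘ₗ ev x) (T p) = t • (ev y ∘ₗ ev x) p) (a b c : V) :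
    ev y (ev x (nestRight m n S T a b c)) = specialize m s a (specialize n t b c) := by
  change (ev y ∘ₗ ev x) (nestRight m n S T a b c) = _
  rw [nestRight, map_subst _ hT, LinearMap.comp_apply (subst S _), map_subst _ hS, ev_ev_const₂]
  rfl

/-- Three products are allowed so that one statement serves the Jacobi identity (all equal) and the
Leibniz rule (`m` the bracket, `n = r` the commutative product). -/
theorem jacobi_iff [Infinite k] (m n r : LambdaProduct k V) :
    (∀ a b c, nestRight m n (lam₂ k V) (mu₂ k V) a b c =
      nestLeft m r (lam₂ k V) (lam₂ k V + mu₂ k V) a b c +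
        nestRight r m (mu₂ k V) (lam₂ k V) b a c) ↔
    ∀ x y a b c, specialize m x a (specialize n y b c) =
      specialize r (x + y) (specialize m x a b) c + specialize r y b (specialize m x a c) := by
  have h1 : ∀ x y a b c, ev y (ev x (nestRight m n (lam₂ k V) (mu₂ k V) a b c)) =
      specialize m x a (specialize n y b c) := fun x y =>
    ev_nestRight m n (ev_ev_lam₂ x y) (ev_ev_mu₂ x y)
  have h2 : ∀ x y a b c, ev y (ev x (nestLeft m r (lam₂ k V) (lam₂ k V + mu₂ k V) a b c +
        nestRight r m (mu₂ k V) (lam₂ k V) b a c)) =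
      specialize r (x + y) (specialize m x a b) c + specialize r y b (specialize m x a c) := by
    intro x y a b c
    rw [map_add, map_add, ev_nestLeft m r (ev_ev_lam₂ x y) (ev_ev_add₂ x y),
      ev_nestRight r m (ev_ev_mu₂ x y) (ev_ev_lam₂ x y)]
  constructor
  · intro h x y a b c
    rw [← h1, h, h2]
  · intro h a b c
    exact ev_ev_ext fun x y => by rw [h1, h2, h]

theorem assoc_iff [Infinite k] (m : LambdaProduct k V) :
    (∀ a b c, nestLeft m m (lam₂ k V) (lam₂ k V + mu₂ k V) a b c =
      nestRight m m (lam₂ k V) (mu₂ k V) a b c) ↔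
    ∀ x y a b c, specialize m (x + y) (specialize m x a b) c =
      specialize m x a (specialize m y b c) := by
  have h1 : ∀ x y a b c, ev y (ev x (nestRight m m (lam₂ k V) (mu₂ k V) a b c)) =
      specialize m x a (specialize m y b c) := fun x y =>
    ev_nestRight m m (ev_ev_lam₂ x y) (ev_ev_mu₂ x y)
  have h2 : ∀ x y a b c, ev y (ev x (nestLeft m m (lam₂ k V) (lam₂ k V + mu₂ k V) a b c)) =
      specialize m (x + y) (specialize m x a b) c := fun x y =>
    ev_nestLeft m m (ev_ev_lam₂ x y) (ev_ev_add₂ x y)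
  constructor
  · intro h x y a b c
    rw [← h1, ← h, h2]
  · intro h a b c
    exact ev_ev_ext fun x y => by rw [h1, h2, h]

end Specialize

/-! ### Functionals on which `∂` acts as a scalar. -/

section Separation

variable {k V : Type*} [Field k] [AddCommGroup V] [Module k V] [Module k[X] V]
  [IsScalarTower k k[X] V]

/-- Under a functional of weight `β` the operator `∂` becomes `β`, so that `-λ-∂` at `λ = x` becomes
the scalar `-x-β`. -/
theorem eval_opp {φ : V →ₗ[k] k} {β : k} (hφ : ∀ v, φ (del k V v) = β * φ v) (x : k)
    (p : LPoly V) : φ (ev x (opp (del k V) p)) = φ (ev (-x - β) p) :=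
  map_ev_opp φ hφ x p

/-- A family of linear functionals on `V` that separates points, each of them factoring through
a fibre `V / (∂ - β)V`. -/
structure IsSeparating {ι : Type*} (φ : ι → V →ₗ[k] k) (β : ι → k) : Prop where
  weight : ∀ i v, φ i (del k V v) = β i * φ i v
  eq_of_forall : ∀ v w, (∀ i, φ i v = φ i w) → v = w

variable {ι : Type*} {φ : ι → V →ₗ[k] k} {β : ι → k}

theorem IsSeparating.isSesquilinear_iff [Infinite k] (h : IsSeparating φ β)
    (m : LambdaProduct k V) : IsSesquilinear m ↔
    (∀ i x a b, φ i (specialize m x (del k V a) b) = -(x * φ i (specialize m x a b))) ∧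
    (∀ i x a b, φ i (specialize m x a (del k V b)) = (β i + x) * φ i (specialize m x a b)) := by
  simp only [specialize_apply]
  constructor
  · intro hm
    refine ⟨fun i x a b => ?_, fun i x a b => ?_⟩
    · rw [hm.del_left, map_neg, ev_lam, map_neg, map_smul, smul_eq_mul]
    · rw [hm.del_right, map_add, ev_lam, ev_coeffMap, map_add, map_smul, h.weight, smul_eq_mul,
        add_mul]
  · rintro ⟨h1, h2⟩
    refine ⟨fun a b => ev_ext (k := k) fun x => h.eq_of_forall _ _ fun i => ?_,
      fun a b => ev_ext (k := k) fun x => h.eq_of_forall _ _ fun i => ?_⟩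
    · rw [h1, map_neg, ev_lam, map_neg, map_smul, smul_eq_mul]
    · rw [h2, map_add, ev_lam, ev_coeffMap, map_add, map_smul, h.weight, smul_eq_mul, add_mul]

theorem IsSeparating.isCommutative_iff [Infinite k] (h : IsSeparating φ β)
    (m : LambdaProduct k V) : IsCommutative m ↔
    ∀ i x a b, φ i (specialize m x a b) = φ i (specialize m (-x - β i) b a) := by
  simp only [specialize_apply]
  constructor
  · intro hm i x a b
    rw [hm a b, eval_opp (h.weight i)]
  · intro hm a b
    exact ev_ext (k := k) fun x => h.eq_of_forall _ _ fun i => by rw [eval_opp (h.weight i), hm]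

theorem IsSeparating.isSkew_iff [Infinite k] (h : IsSeparating φ β)
    (m : LambdaProduct k V) : (∀ a b, m a b = -opp (del k V) (m b a)) ↔
    ∀ i x a b, φ i (specialize m x a b) = -φ i (specialize m (-x - β i) b a) := by
  simp only [specialize_apply]
  constructor
  · intro hm i x a b
    rw [hm a b, map_neg, map_neg, eval_opp (h.weight i)]
  · intro hm a b
    exact ev_ext (k := k) fun x => h.eq_of_forall _ _ fun i => by
      rw [map_neg, map_neg, eval_opp (h.weight i), hm]

end Separation

/-! ### Products that are invariant with respect to a symmetric form -/

section Invariant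

variable {H K : Type*} [Field K]

/-- `m` is invariant with respect to the symmetric form `F`, and commutative (`ε = 1`) or
skew-commutative (`ε = -1`) as far as `F` sees. -/
structure IsInvariantProduct (F : H → H → K) (ε : K) (m : H → H → H) : Prop where
  symm : ∀ u v, F u v = F v u
  inv : ∀ u v w, F (m u v) w = F u (m v w)
  swap : ∀ u v w, F (m u v) w = ε * F (m v u) w

/-- The Jacobi identity, paired with a fourth element. -/
def JacobiAt (F : H → H → K) (br : H → H → H) (u v w t : H) : Prop :=
  F (br u v) (br w t) + F (br v w) (br u t) + F (br w u) (br v t) = 0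

/-- Associativity of a commutative product, paired with a fourth element. -/
def AssocAt (F : H → H → K) (mul : H → H → H) (u v w t : H) : Prop :=
  F (mul u v) (mul w t) = F (mul v w) (mul u t) ∧ F (mul u w) (mul v t) = F (mul v w) (mul u t)

/-- The Leibniz rule, paired with a fourth element. -/
def LeibnizAt (F : H → H → K) (br mul : H → H → H) (u v w t : H) : Prop :=
  F (br u v) (mul w t) + F (br u w) (mul v t) + F (br u t) (mul v w) = 0

variable {F : H → H → K} {br mul : H → H → H} {u v w t : H}

theorem IsInvariantProduct.cycle {ε : K} {m : H → H → H} (hm : IsInvariantProduct F ε m)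
    (u v w : H) : F (m u v) w = F (m v w) u := by
  rw [hm.inv, hm.symm]

theorem IsInvariantProduct.swap_right {ε : K} {m : H → H → H} (hm : IsInvariantProduct F ε m)
    (u v w : H) : F w (m u v) = ε * F w (m v u) := by
  rw [hm.symm, hm.swap, hm.symm w]

/-- Invariance moves the outer factor of each double bracket onto `t`, which leaves a sum over the
three splittings of the four arguments into pairs. -/
theorem jacobiAt_iff (hbr : IsInvariantProduct F (-1) br) : JacobiAt F br u v w t ↔
    F (br u (br v w)) t = F (br (br u v) w) t + F (br v (br u w)) t := by
  have h1 : F (br u (br v w)) t = -F (br v w) (br u t) := by rw [hbr.swap, hbr.inv]; ring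
  have h2 : F (br v (br u w)) t = F (br w u) (br v t) := by
    rw [hbr.swap, hbr.inv, hbr.swap]; ring
  rw [h1, h2, hbr.inv (br u v), JacobiAt]
  constructor <;> intro h <;> linear_combination -h

/-- A transposition permutes the three splittings into pairs and reverses the sign of every summand.
-/
theorem JacobiAt.swap₁₂ (hbr : IsInvariantProduct F (-1) br) (h : JacobiAt F br u v w t) :
    JacobiAt F br v u w t := by
  rw [JacobiAt] at *
  linear_combination -h + hbr.swap v u (br w t) + hbr.swap u w (br v t) + hbr.swap w v (br u t)

theorem JacobiAt.swap₂₃ (hbr : IsInvariantProduct F (-1) br) (h : JacobiAt F br u v w t) :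
    JacobiAt F br u w v t := by
  rw [JacobiAt] at *
  linear_combination -h + hbr.swap u w (br v t) + hbr.swap w v (br u t) + hbr.swap v u (br w t)

theorem JacobiAt.swap₃₄ (hbr : IsInvariantProduct F (-1) br) (h : JacobiAt F br u v w t) :
    JacobiAt F br u v t w := by
  rw [JacobiAt] at *
  linear_combination -h + hbr.swap_right t w (br u v) + hbr.symm (br v t) (br u w) +
    hbr.swap u w (br v t) + hbr.symm (br t u) (br v w) + hbr.swap_right t u (br v w)

/-- Two instances of associativity are taken together because they say that all three splittings of
the arguments into pairs give the same value. That condition is stable under permutations; either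
equality alone is not. -/
theorem assocAt_iff (hmul : IsInvariantProduct F 1 mul) : AssocAt F mul u v w t ↔
    F (mul (mul u v) w) t = F (mul u (mul v w)) t ∧
      F (mul (mul u w) v) t = F (mul u (mul w v)) t := by
  rw [AssocAt, hmul.inv (mul u v), hmul.inv (mul u w), hmul.swap u (mul v w),
    hmul.swap u (mul w v), hmul.inv (mul v w), hmul.inv (mul w v), hmul.swap w v]
  simp only [one_mul]

theorem AssocAt.swap₁₂ (hmul : IsInvariantProduct F 1 mul) (h : AssocAt F mul u v w t) :
    AssocAt F mul v u w t := by
  obtain ⟨h1, h2⟩ := h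
  have h3 := hmul.swap v u (mul w t)
  rw [one_mul] at h3
  exact ⟨by rw [h3, h1, h2], h2.symm⟩

theorem AssocAt.swap₂₃ (hmul : IsInvariantProduct F 1 mul) (h : AssocAt F mul u v w t) :
    AssocAt F mul u w v t := by
  obtain ⟨h1, h2⟩ := h
  have h3 := hmul.swap w v (mul u t)
  rw [one_mul] at h3
  exact ⟨by rw [h3, h2], by rw [h3, h1]⟩

theorem AssocAt.swap₃₄ (hmul : IsInvariantProduct F 1 mul) (h : AssocAt F mul u v w t) :
    AssocAt F mul u v t w := by
  obtain ⟨h1, h2⟩ := h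
  have h3 := hmul.swap_right t w (mul u v)
  rw [one_mul] at h3
  have h4 := hmul.symm (mul v t) (mul u w)
  exact ⟨by rw [h3, h1, h4, h2], by rw [hmul.symm, h4, h2]⟩

theorem leibnizAt_iff (hbr : IsInvariantProduct F (-1) br) (hmul : IsInvariantProduct F 1 mul) :
    LeibnizAt F br mul u v w t ↔
    F (br u (mul v w)) t = F (mul (br u v) w) t + F (mul v (br u w)) t := by
  rw [LeibnizAt, hbr.swap u (mul v w), hbr.inv (mul v w), hbr.symm (mul v w), hmul.inv (br u v),
    hmul.swap v (br u w), hmul.inv (br u w)]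
  constructor <;> intro h <;> linear_combination -h

theorem LeibnizAt.swap₂₃ (hmul : IsInvariantProduct F 1 mul) (h : LeibnizAt F br mul u v w t) :
    LeibnizAt F br mul u w v t := by
  rw [LeibnizAt] at *
  linear_combination h + hmul.swap_right w v (br u t)

theorem LeibnizAt.swap₃₄ (hmul : IsInvariantProduct F 1 mul) (h : LeibnizAt F br mul u v w t) :
    LeibnizAt F br mul u v t w := by
  rw [LeibnizAt] at *
  linear_combination h - hmul.swap_right w t (br u v)

/-- The four Leibniz sums, one for each choice of first argument, have twelve terms that cancel in
pairs: `F([u,v], wt)` from the choice `u` against `F([v,u], wt)` from the choice `v`. Three of the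
sums therefore determine the fourth. -/
theorem LeibnizAt.of_rotations (hbr : IsInvariantProduct F (-1) br)
    (hv : LeibnizAt F br mul v w t u)
    (hw : LeibnizAt F br mul w v t u) (ht : LeibnizAt F br mul t v w u) :
    LeibnizAt F br mul u v w t := by
  rw [LeibnizAt] at *
  linear_combination -hv - hw - ht + hbr.swap v w (mul t u) + hbr.swap v t (mul w u) +
    hbr.swap w t (mul v u) + hbr.swap v u (mul w t) + hbr.swap w u (mul v t) +
    hbr.swap t u (mul v w)

end Invariant

/-! ### Weighted elements -/

section Weighted

variable {k R : Type*} [Field k] [AddCommGroup R] [Module k R]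

/-- For a `λ`-product `m`, the product of elements of the fibres of `R` at `∂ = x` and `∂ = y`,
which lies in the fibre at `∂ = x + y`. -/
def wmul (m : LambdaProduct k R) (u v : R × k) : R × k :=
  (specialize m (-u.2) u.1 v.1, u.2 + v.2)

/-- The pairing, given by a conformal form, of elements of the fibres of `R` at `∂ = x` and
`∂ = y`; it vanishes unless `x + y = 0`. -/
def wform (B : R →ₗ[k] R →ₗ[k] k[X]) (u v : R × k) : k :=
  open Classical in if u.2 + v.2 = 0 then (B u.1 v.1).eval v.2 else 0

theorem wform_of_add_ne {B : R →ₗ[k] R →ₗ[k] k[X]} {u v : R × k} (h : u.2 + v.2 ≠ 0) :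
    wform B u v = 0 := if_neg h

theorem wform_of_add_eq {B : R →ₗ[k] R →ₗ[k] k[X]} {u v : R × k} (h : u.2 + v.2 = 0) :
    wform B u v = (B u.1 v.1).eval v.2 := if_pos h

theorem wform_add_left (B : R →ₗ[k] R →ₗ[k] k[X]) (r s : R) (x : k) (v : R × k) :
    wform B (r + s, x) v = wform B (r, x) v + wform B (s, x) v := by
  by_cases h : x + v.2 = 0
  · rw [wform_of_add_eq h, wform_of_add_eq h, wform_of_add_eq h, map_add, LinearMap.add_apply,
      Polynomial.eval_add]
  · rw [wform_of_add_ne h, wform_of_add_ne h, wform_of_add_ne h, add_zero]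

theorem wform_add_right (B : R →ₗ[k] R →ₗ[k] k[X]) (r s : R) (x : k) (v : R × k) :
    wform B v (r + s, x) = wform B v (r, x) + wform B v (s, x) := by
  by_cases h : v.2 + x = 0
  · rw [wform_of_add_eq h, wform_of_add_eq h, wform_of_add_eq h, map_add, Polynomial.eval_add]
  · rw [wform_of_add_ne h, wform_of_add_ne h, wform_of_add_ne h, add_zero]

theorem wmul_add_left (m : LambdaProduct k R) (r s : R) (x : k) (v : R × k) :
    wmul m (r + s, x) v = ((wmul m (r, x) v).1 + (wmul m (s, x) v).1, x + v.2) := by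
  simp [wmul]

theorem wmul_add_right (m : LambdaProduct k R) (r s : R) (x : k) (v : R × k) :
    wmul m v (r + s, x) = ((wmul m v (r, x)).1 + (wmul m v (s, x)).1, v.2 + x) := by
  simp [wmul]

theorem wform_wmul_add₁ (B : R →ₗ[k] R →ₗ[k] k[X]) (m : LambdaProduct k R) (r s : R) (x : k)
    (v w : R × k) : wform B (wmul m (r + s, x) v) w =
      wform B (wmul m (r, x) v) w + wform B (wmul m (s, x) v) w := by
  rw [wmul_add_left, wform_add_left]; rfl

theorem wform_wmul_add₂ (B : R →ₗ[k] R →ₗ[k] k[X]) (m : LambdaProduct k R) (r s : R) (x : k)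
    (v w : R × k) : wform B (wmul m v (r + s, x)) w =
      wform B (wmul m v (r, x)) w + wform B (wmul m v (s, x)) w := by
  rw [wmul_add_right, wform_add_left]; rfl

theorem wform_wmul_add₃ (B : R →ₗ[k] R →ₗ[k] k[X]) (m : LambdaProduct k R) (r s : R) (x : k)
    (v w : R × k) : wform B w (wmul m (r + s, x) v) =
      wform B w (wmul m (r, x) v) + wform B w (wmul m (s, x) v) := by
  rw [wmul_add_left, wform_add_right]; rfl

/-- Additivity holds at a fixed weight, which is enough to split an element of `P ⊕ Q` into its
components. -/
theorem JacobiAt.add {B : R →ₗ[k] R →ₗ[k] k[X]} {m : LambdaProduct k R} {r s : R} {x : k}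
    {v w t : R × k} (hr : JacobiAt (wform B) (wmul m) (r, x) v w t)
    (hs : JacobiAt (wform B) (wmul m) (s, x) v w t) :
    JacobiAt (wform B) (wmul m) (r + s, x) v w t := by
  rw [JacobiAt] at *
  rw [wform_wmul_add₁, wform_wmul_add₂, wform_wmul_add₃]
  linear_combination hr + hs

theorem AssocAt.add {B : R →ₗ[k] R →ₗ[k] k[X]} {m : LambdaProduct k R} {r s : R} {x : k}
    {v w t : R × k} (hr : AssocAt (wform B) (wmul m) (r, x) v w t)
    (hs : AssocAt (wform B) (wmul m) (s, x) v w t) :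
    AssocAt (wform B) (wmul m) (r + s, x) v w t := by
  rw [AssocAt] at *
  rw [wform_wmul_add₁, wform_wmul_add₁, wform_wmul_add₃, hr.1, hr.2, hs.1, hs.2]
  exact ⟨rfl, rfl⟩

theorem LeibnizAt.add₁ {B : R →ₗ[k] R →ₗ[k] k[X]} {m n : LambdaProduct k R} {r s : R} {x : k}
    {v w t : R × k} (hr : LeibnizAt (wform B) (wmul m) (wmul n) (r, x) v w t)
    (hs : LeibnizAt (wform B) (wmul m) (wmul n) (s, x) v w t) :
    LeibnizAt (wform B) (wmul m) (wmul n) (r + s, x) v w t := by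
  rw [LeibnizAt] at *
  rw [wform_wmul_add₁, wform_wmul_add₁, wform_wmul_add₁]
  linear_combination hr + hs

theorem LeibnizAt.add₂ {B : R →ₗ[k] R →ₗ[k] k[X]} {m n : LambdaProduct k R} {r s : R} {x : k}
    {u w t : R × k} (hr : LeibnizAt (wform B) (wmul m) (wmul n) u (r, x) w t)
    (hs : LeibnizAt (wform B) (wmul m) (wmul n) u (s, x) w t) :
    LeibnizAt (wform B) (wmul m) (wmul n) u (r + s, x) w t := by
  rw [LeibnizAt] at *
  rw [wform_wmul_add₂, wform_wmul_add₃, wform_wmul_add₃]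
  linear_combination hr + hs

theorem evalEval_aeval (x y : k) (r : k[X][X]) (q : k[X]) :
    (Polynomial.aeval r q).evalEval y x = q.eval (r.evalEval y x) := by
  induction q using Polynomial.induction_on' with
  | add p q hp hq => rw [map_add, Polynomial.evalEval_add, hp, hq, Polynomial.eval_add]
  | monomial n c =>
    have : algebraMap k k[X][X] c = Polynomial.C (Polynomial.C c) := rfl
    rw [Polynomial.aeval_monomial, Polynomial.evalEval_mul, Polynomial.evalEval_pow, this,
      Polynomial.evalEval_C, Polynomial.eval_C, Polynomial.eval_monomial]

theorem evalEval_sum (x y : k) (r s : k[X][X]) (L : R →ₗ[k] k[X]) (p : LPoly R) :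
    (p.sum fun i v => r ^ i * Polynomial.aeval s (L v)).evalEval y x =
      (L (ev (r.evalEval y x) p)).eval (s.evalEval y x) := by
  rw [ev_apply, Finsupp.sum, Polynomial.evalEval_finsetSum, Finsupp.sum, map_sum,
    Polynomial.eval_finsetSum]
  refine Finset.sum_congr rfl fun i _ => ?_
  rw [Polynomial.evalEval_mul, Polynomial.evalEval_pow, evalEval_aeval, map_smul,
    Polynomial.eval_smul, smul_eq_mul]

theorem evalEval_ext [Infinite k] {p q : k[X][X]}
    (h : ∀ x y, p.evalEval y x = q.evalEval y x) : p = q := by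
  refine Polynomial.eq_of_infinite_eval_eq p q
    -- The constants are infinitely many points of `k[X]` at which the outer variable can be
    -- evaluated.
    ((Set.infinite_range_of_injective Polynomial.C_injective).mono ?_)
  rintro _ ⟨x, rfl⟩
  exact Polynomial.funext fun y => h x y

/-- The functional `v ↦ ⟨v, w⟩_z`. -/
def formFunctional (B : R →ₗ[k] R →ₗ[k] k[X]) (w : R × k) : R →ₗ[k] k :=
  Polynomial.leval w.2 ∘ₗ B.flip w.1

theorem formFunctional_apply (B : R →ₗ[k] R →ₗ[k] k[X]) (w : R × k) (v : R) :
    formFunctional B w v = (B v w.1).eval w.2 := rfl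

theorem wform_symm {B : R →ₗ[k] R →ₗ[k] k[X]} (hs : IsSymmetricForm B) (u v : R × k) :
    wform B u v = wform B v u := by
  by_cases h : u.2 + v.2 = 0
  · have h' : v.2 + u.2 = 0 := by rw [add_comm, h]
    rw [wform_of_add_eq h, wform_of_add_eq h', hs, Polynomial.eval_comp]
    simp [neg_eq_of_add_eq_zero_right h']
  · have h' : v.2 + u.2 ≠ 0 := by rwa [add_comm]
    rw [wform_of_add_ne h, wform_of_add_ne h']

/-- A `λ`-product that is invariant with respect to a symmetric conformal form, and commutative
(`ε = 1`) or skew-commutative (`ε = -1`). -/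
abbrev IsInvariantLambdaProduct (B : R →ₗ[k] R →ₗ[k] k[X]) (ε : k) (m : LambdaProduct k R) : Prop :=
  IsInvariantProduct (wform B) ε (wmul m)

/-- The functional `⟨·, w⟩` has weight `-w.2`; when the total weight is zero, `-x-∂` is therefore
minus the weight of the second factor. -/
theorem forall_wform_wmul_eq_iff {B : R →ₗ[k] R →ₗ[k] k[X]} (m : LambdaProduct k R) (ε : k) :
    (∀ u v w, wform B (wmul m u v) w = ε * wform B (wmul m v u) w) ↔
    ∀ (i : R × k) x a b, formFunctional B i (specialize m x a b) =
      ε * formFunctional B i (specialize m (-x - -i.2) b a) := by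
  constructor
  · intro h i x a b
    -- The weight `-x` makes the product the one at `λ = x`; the second weight is then forced by
    -- total weight zero.
    have := h (a, -x) (b, x - i.2) i
    rw [wform_of_add_eq (by simp only [wmul]; ring), wform_of_add_eq (by simp only [wmul]; ring)]
        at this
    simp only [wmul, neg_neg] at this
    rw [formFunctional_apply, formFunctional_apply, this]
    ring_nf
  · intro h u v w
    by_cases hw : u.2 + v.2 + w.2 = 0
    · have hw' : v.2 + u.2 + w.2 = 0 := by rw [← hw]; ring
      rw [wform_of_add_eq (u := wmul m u v) hw, wform_of_add_eq (u := wmul m v u) hw']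
      have := h w (-u.2) u.1 v.1
      have e : - -u.2 - -w.2 = -v.2 := by linear_combination hw
      rw [e] at this
      exact this
    · have hw' : v.2 + u.2 + w.2 ≠ 0 := by rwa [add_comm v.2]
      rw [wform_of_add_ne (u := wmul m u v) hw, wform_of_add_ne (u := wmul m v u) hw', mul_zero]

variable [Module k[X] R] [IsScalarTower k k[X] R]

theorem isSeparating_formFunctional [Infinite k] {B : R →ₗ[k] R →ₗ[k] k[X]}
    (hc : IsConformalForm B) (hn : IsNondegenerateForm B) :
    IsSeparating (formFunctional B) (fun w => -w.2) where
  weight w v := by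
    simp [formFunctional_apply, hc.del_left]
  eq_of_forall v w h := by
    rw [← sub_eq_zero]
    refine hn.1 _ fun b => Polynomial.funext fun z => ?_
    have := h (b, z)
    rw [formFunctional_apply, formFunctional_apply] at this
    rw [map_sub, LinearMap.sub_apply, Polynomial.eval_sub, this, sub_self, Polynomial.eval_zero]

/-- In `⟨a, b_{μ-∂} c⟩_λ` the operator `∂` acts through the form as `λ`. With `λ = -u.2` and `μ =
w.2` the product is taken at `μ - λ = -v.2`, exactly as weights prescribe, so conformal invariance
is ordinary invariance. -/
theorem isInvariantForm_iff [Infinite k] {B : R →ₗ[k] R →ₗ[k] k[X]} (hc : IsConformalForm B)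
    (m : LambdaProduct k R) : IsInvariantForm m B ↔
      ∀ u v w, wform B (wmul m u v) w = wform B u (wmul m v w) := by
  have h1 : ∀ x y : k, ∀ a b c,
      ((m a b).sum fun i v => (Polynomial.X : k[X][X]) ^ i *
        Polynomial.aeval (Polynomial.C Polynomial.X : k[X][X]) (B v c)).evalEval y x =
      (B (specialize m x a b) c).eval y := by
    intro x y a b c
    have := evalEval_sum x y (Polynomial.X) (Polynomial.C Polynomial.X) (B.flip c) (m a b)
    rwa [Polynomial.evalEval_X, Polynomial.evalEval_C, Polynomial.eval_X] at this
  have h2 : ∀ x y : k, ∀ a b c,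
      ((subst (lam k R - coeffMap (del k R)) (const k R) (m b c)).sum fun j v =>
      (Polynomial.C Polynomial.X : k[X][X]) ^ j *
        Polynomial.aeval (Polynomial.X : k[X][X]) (B a v)).evalEval y x =
      (B a (specialize m (y - x) b c)).eval x := by
    intro x y a b c
    rw [evalEval_sum, Polynomial.evalEval_X, Polynomial.evalEval_C, Polynomial.eval_X]
    have := map_subst (Polynomial.leval x ∘ₗ B a ∘ₗ ev y) (T := lam k R - coeffMap (del k R))
      (c := y - x) (fun q => by
        simp only [LinearMap.comp_apply, LinearMap.sub_apply, map_sub, ev_lam, ev_coeffMap,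
          hc.del_right, map_smul, Polynomial.leval_apply, Polynomial.eval_mul,
          Polynomial.eval_X, smul_eq_mul, sub_mul]) (const k R) (m b c)
    simpa only [LinearMap.comp_apply, ev_const, Polynomial.leval_apply, specialize_apply] using this
  constructor
  · intro h u v w
    by_cases hw : u.2 + v.2 + w.2 = 0
    · have hw' : u.2 + (v.2 + w.2) = 0 := by rw [← add_assoc, hw]
      rw [wform_of_add_eq (u := wmul m u v) hw, wform_of_add_eq (v := wmul m v w) hw']
      have := h1 (-u.2) w.2 u.1 v.1 w.1
      rw [h, h2] at this
      refine this.symm.trans ?_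
      have e1 : w.2 - -u.2 = -v.2 := by linear_combination hw
      have e2 : -u.2 = v.2 + w.2 := by linear_combination -hw
      rw [e1, e2]; rfl
    · have hw' : u.2 + (v.2 + w.2) ≠ 0 := by rwa [← add_assoc]
      rw [wform_of_add_ne (u := wmul m u v) hw, wform_of_add_ne (v := wmul m v w) hw']
  · intro h a b c
    refine evalEval_ext fun x y => ?_
    rw [h1, h2]
    have := h (a, -x) (b, x - y) (c, y)
    rw [wform_of_add_eq (by simp only [wmul]; ring), wform_of_add_eq (by simp only [wmul]; ring)]
        at this
    simpa [wmul] using this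

/-- Invariance and symmetry bring either factor of a product into a slot of the form by itself.
There the conformal form already turns `∂` into the weight, and nondegeneracy recovers the identity
in `R[λ]`. -/
theorem IsInvariantProduct.isSesquilinear [Infinite k] {B : R →ₗ[k] R →ₗ[k] k[X]}
    (hc : IsConformalForm B) (hn : IsNondegenerateForm B) {ε : k} {m : LambdaProduct k R}
    (hm : IsInvariantLambdaProduct B ε m) : IsSesquilinear m := by
  have hdel : ∀ (a : R) (x : k) v, wform B (del k R a, x) v = x * wform B (a, x) v := by
    intro a x v
    by_cases h : x + v.2 = 0
    · rw [wform_of_add_eq h, wform_of_add_eq h, hc.del_left, Polynomial.eval_neg,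
        Polynomial.eval_mul, Polynomial.eval_X]
      linear_combination (B a v.1).eval v.2 * -h
    · rw [wform_of_add_ne h, wform_of_add_ne h, mul_zero]
  refine ((isSeparating_formFunctional hc hn).isSesquilinear_iff m).2
    ⟨fun i x a b => ?_, fun i x a b => ?_⟩
  · have h := hdel a (-x) (wmul m (b, x - i.2) i)
    rw [← hm.inv, ← hm.inv, wform_of_add_eq (by simp only [wmul]; ring),
        wform_of_add_eq (by simp only [wmul]; ring)] at h
    simpa [wmul, formFunctional_apply] using h
  · have h := hdel b (x - i.2) (wmul m i (a, -x))
    rw [← hm.inv, ← hm.inv, hm.symm, ← hm.inv, hm.symm _ (a, -x), ← hm.inv,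
      wform_of_add_eq (by simp only [wmul]; ring), wform_of_add_eq (by simp only [wmul]; ring)] at h
    simp [wmul, formFunctional_apply] at h ⊢
    rw [h]; ring

end Weighted

/-! ### Poisson conformal algebras with an invariant form -/

section FormalCriterion

variable {k R : Type*} [Field k] [AddCommGroup R] [Module k R] [Module k[X] R]
  [IsScalarTower k k[X] R] {B : R →ₗ[k] R →ₗ[k] k[X]} {m n r : LambdaProduct k R}

theorem wform_leibniz_iff [Infinite k] (hc : IsConformalForm B) (hn : IsNondegenerateForm B) :
    (∀ x y a b c, specialize m x a (specialize n y b c) =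
      specialize r (x + y) (specialize m x a b) c + specialize r y b (specialize m x a c)) ↔
    ∀ u v w t, wform B (wmul m u (wmul n v w)) t =
      wform B (wmul r (wmul m u v) w) t + wform B (wmul r v (wmul m u w)) t := by
  constructor
  · intro h u v w t
    by_cases hw : u.2 + (v.2 + w.2) + t.2 = 0
    · have h2 : u.2 + v.2 + w.2 + t.2 = 0 := by rw [← hw]; ring
      have h3 : v.2 + (u.2 + w.2) + t.2 = 0 := by rw [← hw]; ring
      rw [wform_of_add_eq (u := wmul m u (wmul n v w)) hw,
        wform_of_add_eq (u := wmul r (wmul m u v) w) h2,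
        wform_of_add_eq (u := wmul r v (wmul m u w)) h3, ← Polynomial.eval_add,
        ← LinearMap.add_apply, ← map_add]
      simp only [wmul, neg_add]
      rw [h]
    · have h2 : u.2 + v.2 + w.2 + t.2 ≠ 0 := by rwa [add_assoc u.2]
      have h3 : v.2 + (u.2 + w.2) + t.2 ≠ 0 := by rwa [add_left_comm v.2]
      rw [wform_of_add_ne (u := wmul m u (wmul n v w)) hw,
        wform_of_add_ne (u := wmul r (wmul m u v) w) h2,
        wform_of_add_ne (u := wmul r v (wmul m u w)) h3, add_zero]
  · intro h x y a b c
    refine (isSeparating_formFunctional hc hn).eq_of_forall _ _ fun i => ?_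
    -- The third weight is chosen to cancel the others, since the form vanishes at nonzero total
    -- weight.
    have := h (a, -x) (b, -y) (c, x + y - i.2) i
    rw [wform_of_add_eq (by simp only [wmul]; ring), wform_of_add_eq (by simp only [wmul]; ring),
      wform_of_add_eq (by simp only [wmul]; ring)] at this
    simp only [wmul, neg_neg, neg_add] at this
    simpa only [map_add, formFunctional_apply] using this

theorem wform_assoc_iff [Infinite k] (hc : IsConformalForm B) (hn : IsNondegenerateForm B) :
    (∀ x y a b c, specialize m (x + y) (specialize m x a b) c =
      specialize m x a (specialize m y b c)) ↔
    ∀ u v w t, wform B (wmul m (wmul m u v) w) t = wform B (wmul m u (wmul m v w)) t := by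
  constructor
  · intro h u v w t
    by_cases hw : u.2 + (v.2 + w.2) + t.2 = 0
    · have h2 : u.2 + v.2 + w.2 + t.2 = 0 := by rw [← hw]; ring
      rw [wform_of_add_eq (u := wmul m u (wmul m v w)) hw,
        wform_of_add_eq (u := wmul m (wmul m u v) w) h2]
      simp only [wmul, neg_add]
      rw [h]
    · have h2 : u.2 + v.2 + w.2 + t.2 ≠ 0 := by rwa [add_assoc u.2]
      rw [wform_of_add_ne (u := wmul m u (wmul m v w)) hw,
        wform_of_add_ne (u := wmul m (wmul m u v) w) h2]
  · intro h x y a b c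
    refine (isSeparating_formFunctional hc hn).eq_of_forall _ _ fun i => ?_
    have := h (a, -x) (b, -y) (c, x + y - i.2) i
    rw [wform_of_add_eq (by simp only [wmul]; ring),
      wform_of_add_eq (by simp only [wmul]; ring)] at this
    simp only [wmul, neg_neg, neg_add] at this
    simpa only [formFunctional_apply] using this

theorem IsLieConformalAlgebra.isInvariantLambdaProduct [Infinite k] (hc : IsConformalForm B)
    (hs : IsSymmetricForm B) (hn : IsNondegenerateForm B) (hm : IsLieConformalAlgebra m)
    (hinv : IsInvariantForm m B) : IsInvariantLambdaProduct B (-1) m where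
  symm := wform_symm hs
  inv := (isInvariantForm_iff hc m).1 hinv
  swap := (forall_wform_wmul_eq_iff m (-1)).2 fun i x a b => by
    rw [((isSeparating_formFunctional hc hn).isSkew_iff m).1 hm.skew i x a b, neg_one_mul]

theorem IsCommutative.isInvariantLambdaProduct [Infinite k] (hc : IsConformalForm B)
    (hs : IsSymmetricForm B) (hn : IsNondegenerateForm B) (hm : IsCommutative m)
    (hinv : IsInvariantForm m B) : IsInvariantLambdaProduct B 1 m where
  symm := wform_symm hs
  inv := (isInvariantForm_iff hc m).1 hinv
  swap := (forall_wform_wmul_eq_iff m 1).2 fun i x a b => by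
    rw [((isSeparating_formFunctional hc hn).isCommutative_iff m).1 hm i x a b, one_mul]

/-- Invariance and nondegeneracy supply sesquilinearity and (skew-)commutativity, so only the three
quadratic identities remain, each tested against a fourth element. -/
theorem isPoissonConformalAlgebra_iff [Infinite k] (hc : IsConformalForm B)
    (hn : IsNondegenerateForm B)
    (hm : IsInvariantLambdaProduct B (-1) m) (hr : IsInvariantLambdaProduct B 1 r) :
    IsPoissonConformalAlgebra m r ↔
      (∀ u v w t, JacobiAt (wform B) (wmul m) u v w t) ∧
      (∀ u v w t, AssocAt (wform B) (wmul r) u v w t) ∧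
      (∀ u v w t, LeibnizAt (wform B) (wmul m) (wmul r) u v w t) := by
  have hsep := isSeparating_formFunctional hc hn
  constructor
  · intro h
    have h1 := (wform_leibniz_iff hc hn).1 ((jacobi_iff m m m).1 h.lie.jacobi)
    have h2 := (wform_assoc_iff hc hn).1 ((assoc_iff r).1 h.assoc.assoc)
    have h3 := (wform_leibniz_iff hc hn).1 ((jacobi_iff m r r).1 h.leibniz)
    exact ⟨fun u v w t => (jacobiAt_iff hm).2 (h1 u v w t),
      fun u v w t => (assocAt_iff hr).2 ⟨h2 u v w t, h2 u w v t⟩,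
      fun u v w t => (leibnizAt_iff hm hr).2 (h3 u v w t)⟩
  · rintro ⟨h1, h2, h3⟩
    exact
      { lie :=
        { sesq := hm.isSesquilinear hc hn
          skew := (hsep.isSkew_iff m).2 fun i x a b => by
            rw [(forall_wform_wmul_eq_iff m (-1)).1 hm.swap i x a b, neg_one_mul]
          jacobi := (jacobi_iff m m m).2 ((wform_leibniz_iff hc hn).2 fun u v w t =>
            (jacobiAt_iff hm).1 (h1 u v w t)) }
        assoc :=
        { sesq := hr.isSesquilinear hc hn
          assoc := (assoc_iff r).2 ((wform_assoc_iff hc hn).2 fun u v w t =>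
            ((assocAt_iff hr).1 (h2 u v w t)).1) }
        comm := (hsep.isCommutative_iff r).2 fun i x a b => by
          rw [(forall_wform_wmul_eq_iff r 1).1 hr.swap i x a b, one_mul]
        leibniz := (jacobi_iff m r r).2 ((wform_leibniz_iff hc hn).2 fun u v w t =>
          (leibnizAt_iff hm hr).1 (h3 u v w t)) }

end FormalCriterion

/-! ### Identities with three arguments in one subalgebra. -/

section Subalgebra

variable {k R S : Type*} [Field k] [AddCommGroup R] [Module k R] [Module k[X] R]
  [IsScalarTower k k[X] R] [AddCommGroup S] [Module k S] [Module k[X] S]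
  [IsScalarTower k k[X] S] {B : R →ₗ[k] R →ₗ[k] k[X]} {m n r : LambdaProduct k R}
  {m' n' r' : LambdaProduct k S} {i : S →ₗ[k[X]] R}

theorem IsSubproduct.specialize_map (h : IsSubproduct i m' m) (x : k) (a b : S) :
    specialize m x (i a) (i b) = i (specialize m' x a b) := by
  rw [specialize_apply, h, ev_coeffMap]; rfl

theorem IsSubproduct.wmul_map (h : IsSubproduct i m' m) (a b : S) (x y : k) :
    wmul m (i a, x) (i b, y) = (i (specialize m' (-x) a b), x + y) := by
  simp only [wmul, h.specialize_map]

/-- The fourth element `t` is arbitrary: if three arguments lie in a subalgebra, its own axiom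
settles the identity before pairing with `t`. -/
theorem IsSubproduct.wform_leibniz [Infinite k] (hm : IsSubproduct i m' m)
    (hn : IsSubproduct i n' n) (hr : IsSubproduct i r' r)
    (h : ∀ a b c, nestRight m' n' (lam₂ k S) (mu₂ k S) a b c =
      nestLeft m' r' (lam₂ k S) (lam₂ k S + mu₂ k S) a b c +
        nestRight r' m' (mu₂ k S) (lam₂ k S) b a c)
    (a b c : S) (x y z : k) (t : R × k) :
    wform B (wmul m (i a, x) (wmul n (i b, y) (i c, z))) t =
      wform B (wmul r (wmul m (i a, x) (i b, y)) (i c, z)) t +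
        wform B (wmul r (i b, y) (wmul m (i a, x) (i c, z))) t := by
  have h' := (jacobi_iff m' n' r').1 h (-x) (-y) a b c
  rw [hn.wmul_map, hm.wmul_map, hm.wmul_map, hm.wmul_map, hr.wmul_map, hr.wmul_map, h', map_add,
    add_assoc x, add_left_comm y, wform_add_left, neg_add]

theorem IsSubproduct.wform_assoc [Infinite k] (hm : IsSubproduct i m' m)
    (h : ∀ a b c, nestLeft m' m' (lam₂ k S) (lam₂ k S + mu₂ k S) a b c =
      nestRight m' m' (lam₂ k S) (mu₂ k S) a b c)
    (a b c : S) (x y z : k) (t : R × k) :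
    wform B (wmul m (wmul m (i a, x) (i b, y)) (i c, z)) t =
      wform B (wmul m (i a, x) (wmul m (i b, y) (i c, z))) t := by
  have h' := (assoc_iff m').1 h (-x) (-y) a b c
  rw [hm.wmul_map, hm.wmul_map, hm.wmul_map, hm.wmul_map, ← h', add_assoc x, neg_add]

end Subalgebra

/-! ### Reduction of four-argument identities to the two summands. -/

section Types

variable {k P Q : Type*} [AddCommGroup P] [AddCommGroup Q]

/-- An element of the first summand of `P × Q`, with a weight. -/
abbrev winl (Q : Type*) [AddCommGroup Q] (a : P) (x : k) : (P × Q) × k := ((a, 0), x)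

/-- An element of the second summand of `P × Q`, with a weight. -/
abbrev winr (P : Type*) [AddCommGroup P] (f : Q) (x : k) : (P × Q) × k := ((0, f), x)

theorem forall_of_summands {Φ : (P × Q) × k → Prop}
    (add : ∀ r s x, Φ (r, x) → Φ (s, x) → Φ (r + s, x)) (hl : ∀ a x, Φ (winl Q a x))
    (hr : ∀ f x, Φ (winr P f x)) (u : (P × Q) × k) : Φ u := by
  obtain ⟨⟨a, f⟩, x⟩ := u
  have h := add _ _ x (hl a x) (hr f x)
  rwa [Prod.mk_add_mk, add_zero, zero_add] at h

/-- A multiadditive symmetric condition on four weighted elements of `P ⊕ Q` can be checked on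
elements of the two summands. -/
theorem forall₄_of_summands {Φ : (P × Q) × k → (P × Q) × k → (P × Q) × k → (P × Q) × k → Prop}
    (swap₁₂ : ∀ u v w t, Φ u v w t → Φ v u w t) (swap₂₃ : ∀ u v w t, Φ u v w t → Φ u w v t)
    (swap₃₄ : ∀ u v w t, Φ u v w t → Φ u v t w)
    (add : ∀ r s x v w t, Φ (r, x) v w t → Φ (s, x) v w t → Φ (r + s, x) v w t)
    (hP : ∀ a b c x y z t, Φ (winl Q a x) (winl Q b y) (winl Q c z) t)
    (hQ : ∀ f g h x y z t, Φ (winr P f x) (winr P g y) (winr P h z) t)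
    (hPQ : ∀ a b f g x y z s, Φ (winl Q a x) (winl Q b y) (winr P f z) (winr P g s))
    (u v w t : (P × Q) × k) : Φ u v w t := by
  have add₂ : ∀ u w t r s x, Φ u (r, x) w t → Φ u (s, x) w t → Φ u (r + s, x) w t :=
    fun u w t r s x hr hs =>
      swap₁₂ _ _ _ _ (add _ _ _ _ _ _ (swap₁₂ _ _ _ _ hr) (swap₁₂ _ _ _ _ hs))
  have add₃ : ∀ u v t r s x, Φ u v (r, x) t → Φ u v (s, x) t → Φ u v (r + s, x) t :=
    fun u v t r s x hr hs =>
      swap₂₃ _ _ _ _ (add₂ _ _ _ _ _ _ (swap₂₃ _ _ _ _ hr) (swap₂₃ _ _ _ _ hs))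
  have add₄ : ∀ u v w r s x, Φ u v w (r, x) → Φ u v w (s, x) → Φ u v w (r + s, x) :=
    fun u v w r s x hr hs =>
      swap₃₄ _ _ _ _ (add₃ _ _ _ _ _ _ (swap₃₄ _ _ _ _ hr) (swap₃₄ _ _ _ _ hs))
  have hPP : ∀ a b x y w t, Φ (winl Q a x) (winl Q b y) w t := fun a b x y w t =>
    forall_of_summands (Φ := fun w => Φ _ _ w t) (add₃ _ _ t) (fun c z => hP _ _ _ _ _ _ _)
      (fun f z => forall_of_summands (Φ := fun t => Φ _ _ _ t) (add₄ _ _ _)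
        (fun c z => swap₃₄ _ _ _ _ (hP _ _ _ _ _ _ _))
        (fun g s => hPQ _ _ _ _ _ _ _ _) t) w
  have hPQ' : ∀ a f x z w t, Φ (winl Q a x) (winr P f z) w t := fun a f x z w t =>
    forall_of_summands (Φ := fun w => Φ _ _ w t) (add₃ _ _ t)
        (fun b y => swap₂₃ _ _ _ _ (hPP _ _ _ _ _ _))
      (fun g s => forall_of_summands (Φ := fun t => Φ _ _ _ t) (add₄ _ _ _)
        (fun b y => swap₃₄ _ _ _ _ (swap₂₃ _ _ _ _ (hPP _ _ _ _ _ _)))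
        -- The single element of `P` is carried from the last place, where `hQ` leaves it free, to
        -- the first.
        (fun h q => swap₁₂ _ _ _ _ (swap₂₃ _ _ _ _ (swap₃₄ _ _ _ _ (hQ _ _ _ _ _ _ _)))) t) w
  have hP' : ∀ a x v w t, Φ (winl Q a x) v w t := fun a x v w t =>
    forall_of_summands (Φ := fun v => Φ _ v w t) (add₂ _ w t) (fun b y => hPP _ _ _ _ _ _)
        (fun f z => hPQ' _ _ _ _ _ _) v
  exact forall_of_summands (Φ := fun u => Φ u v w t) (fun r s x => add r s x v w t)
      (fun a x => hP' _ _ _ _ _)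
    (fun f x => forall_of_summands (Φ := fun v => Φ _ v w t) (add₂ _ w t)
      (fun a y => swap₁₂ _ _ _ _ (hP' _ _ _ _ _))
      (fun g y => forall_of_summands (Φ := fun w => Φ _ _ w t) (add₃ _ _ t)
        (fun a z => swap₂₃ _ _ _ _ (swap₁₂ _ _ _ _ (hP' _ _ _ _ _)))
        (fun h z => hQ _ _ _ _ _ _ _) w) v) u

/-- A multiadditive condition on four weighted elements of `P ⊕ Q`, symmetric in the last three
and inherited from its rotations, can be checked on elements of the two summands. -/
theorem forall₄_of_summands' {Φ : (P × Q) × k → (P × Q) × k → (P × Q) × k → (P × Q) × k → Prop}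
    (swap₂₃ : ∀ u v w t, Φ u v w t → Φ u w v t) (swap₃₄ : ∀ u v w t, Φ u v w t → Φ u v t w)
    (rot : ∀ u v w t, Φ v w t u → Φ w v t u → Φ t v w u → Φ u v w t)
    (add₁ : ∀ v w t r s x, Φ (r, x) v w t → Φ (s, x) v w t → Φ (r + s, x) v w t)
    (add₂ : ∀ u w t r s x, Φ u (r, x) w t → Φ u (s, x) w t → Φ u (r + s, x) w t)
    (hP : ∀ a b c x y z t, Φ (winl Q a x) (winl Q b y) (winl Q c z) t)
    (hQ : ∀ f g h x y z t, Φ (winr P f x) (winr P g y) (winr P h z) t)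
    (hPQ : ∀ a b f g x y z s, Φ (winl Q a x) (winl Q b y) (winr P f z) (winr P g s))
    (hQP : ∀ f g a b x y z s, Φ (winr P f x) (winr P g y) (winl Q a z) (winl Q b s))
    (u v w t : (P × Q) × k) : Φ u v w t := by
  have add₃ : ∀ u v t r s x, Φ u v (r, x) t → Φ u v (s, x) t → Φ u v (r + s, x) t :=
    fun u v t r s x hr hs =>
      swap₂₃ _ _ _ _ (add₂ _ _ _ _ _ _ (swap₂₃ _ _ _ _ hr) (swap₂₃ _ _ _ _ hs))
  have add₄ : ∀ u v w r s x, Φ u v w (r, x) → Φ u v w (s, x) → Φ u v w (r + s, x) :=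
    fun u v w r s x hr hs =>
      swap₃₄ _ _ _ _ (add₃ _ _ _ _ _ _ (swap₃₄ _ _ _ _ hr) (swap₃₄ _ _ _ _ hs))
  have hPP : ∀ a b x y w t, Φ (winl Q a x) (winl Q b y) w t := fun a b x y w t =>
    forall_of_summands (Φ := fun w => Φ _ _ w t) (add₃ _ _ t) (fun c z => hP _ _ _ _ _ _ _)
      (fun f z => forall_of_summands (Φ := fun t => Φ _ _ _ t) (add₄ _ _ _)
        (fun c z => swap₃₄ _ _ _ _ (hP _ _ _ _ _ _ _))
        (fun g s => hPQ _ _ _ _ _ _ _ _) t) w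
  have hQQ : ∀ f g x y w t, Φ (winr P f x) (winr P g y) w t := fun f g x y w t =>
    forall_of_summands (Φ := fun w => Φ _ _ w t) (add₃ _ _ t)
      (fun a z => forall_of_summands (Φ := fun t => Φ _ _ _ t) (add₄ _ _ _)
        (fun b s => hQP _ _ _ _ _ _ _ _)
        (fun h s => swap₃₄ _ _ _ _ (hQ _ _ _ _ _ _ _)) t)
      (fun h z => hQ _ _ _ _ _ _ _) w
  have hPQ' : ∀ a f x z w t, Φ (winl Q a x) (winr P f z) w t := fun a f x z w t =>
    forall_of_summands (Φ := fun w => Φ _ _ w t) (add₃ _ _ t)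
        (fun b y => swap₂₃ _ _ _ _ (hPP _ _ _ _ _ _))
      (fun g s => forall_of_summands (Φ := fun t => Φ _ _ _ t) (add₄ _ _ _)
        (fun b y => swap₃₄ _ _ _ _ (swap₂₃ _ _ _ _ (hPP _ _ _ _ _ _)))
        -- With `P` first and `Q` three times after it no permutation of the last three helps. In
        -- the rotations an element of `Q` comes first and the element of `P` last.
        (fun h q => rot _ _ _ _ (hQQ _ _ _ _ _ _) (hQQ _ _ _ _ _ _) (hQQ _ _ _ _ _ _)) t) w
  have hQP' : ∀ f a x z w t, Φ (winr P f x) (winl Q a z) w t := fun f a x z w t =>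
    forall_of_summands (Φ := fun w => Φ _ _ w t) (add₃ _ _ t)
      (fun b y => forall_of_summands (Φ := fun t => Φ _ _ _ t) (add₄ _ _ _)
        (fun c s => rot _ _ _ _ (hPP _ _ _ _ _ _) (hPP _ _ _ _ _ _) (hPP _ _ _ _ _ _))
        (fun g s => swap₃₄ _ _ _ _ (swap₂₃ _ _ _ _ (hQQ _ _ _ _ _ _))) t)
      (fun g y => swap₂₃ _ _ _ _ (hQQ _ _ _ _ _ _)) w
  exact forall_of_summands (Φ := fun u => Φ u v w t) (add₁ v w t)
    (fun a x => forall_of_summands (Φ := fun v => Φ _ v w t) (add₂ _ w t)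
      (fun b y => hPP _ _ _ _ _ _)
      (fun f y => hPQ' _ _ _ _ _ _) v)
    (fun f x => forall_of_summands (Φ := fun v => Φ _ v w t) (add₂ _ w t)
      (fun b y => hQP' _ _ _ _ _ _)
      (fun g y => hQQ _ _ _ _ _ _) v) u

end Types

/-! ### Pairing `P ⊗ P` with functionals -/

section Pairing

variable {k V : Type*} [Field k] [AddCommGroup V] [Module k V]

/-- The functional `φ ⊗ ψ` on `V ⊗ V`. -/
def pair (φ ψ : V →ₗ[k] k) : V ⊗[k] V →ₗ[k] k := LinearMap.mul' k k ∘ₗ TensorProduct.map φ ψ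

@[simp]
theorem pair_tmul (φ ψ : V →ₗ[k] k) (v w : V) : pair φ ψ (v ⊗ₜ w) = φ v * ψ w := by
  simp [pair]

theorem pair_flip₂ (φ ψ : V →ₗ[k] k) (z : V ⊗[k] V) : pair φ ψ (flip₂ k V z) = pair ψ φ z := by
  induction z using TensorProduct.induction_on with
  | zero => simp
  | add x y hx hy => simp only [map_add, hx, hy]
  | tmul x y => simp [mul_comm]

theorem pair_lTensor (φ ψ : V →ₗ[k] k) (T : V →ₗ[k] V) (z : V ⊗[k] V) :
    pair φ ψ (T.lTensor V z) = pair φ (ψ ∘ₗ T) z := by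
  induction z using TensorProduct.induction_on with
  | zero => simp
  | add x y hx hy => simp only [map_add, hx, hy]
  | tmul x y => simp

theorem pair_rTensor (φ ψ : V →ₗ[k] k) (T : V →ₗ[k] V) (z : V ⊗[k] V) :
    pair φ ψ (T.rTensor V z) = pair (φ ∘ₗ T) ψ z := by
  induction z using TensorProduct.induction_on with
  | zero => simp
  | add x y hx hy => simp only [map_add, hx, hy]
  | tmul x y => simp

theorem ev_actLeft (φ : V →ₗ[k] LPoly V) (x : k) (z : V ⊗[k] V) :
    ev x (actLeft φ z) = (ev x ∘ₗ φ).rTensor V z := by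
  have h : ∀ (p : LPoly V) (w : V),
      ev x (TensorProduct.finsuppLeft k k V V ℕ (p ⊗ₜ w)) = ev x p ⊗ₜ[k] w := by
    intro p w
    induction p using Finsupp.induction_linear with
    | zero => simp
    | add a b ha hb => simp only [TensorProduct.add_tmul, map_add, ha, hb]
    | single n v =>
      rw [TensorProduct.finsuppLeft_apply_tmul]
      simp [ev_single, TensorProduct.smul_tmul']
  induction z using TensorProduct.induction_on with
  | zero => simp
  | add x y hx hy => simp only [map_add, hx, hy]
  | tmul v w => exact h _ _

theorem ev_actRight (φ : V →ₗ[k] LPoly V) (x : k) (z : V ⊗[k] V) :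
    ev x (actRight φ z) = (ev x ∘ₗ φ).lTensor V z := by
  have h : ∀ (p : LPoly V) (w : V),
      ev x (TensorProduct.finsuppRight k k V V ℕ (w ⊗ₜ p)) = w ⊗ₜ[k] ev x p := by
    intro p w
    induction p using Finsupp.induction_linear with
    | zero => simp
    | add a b ha hb => simp only [TensorProduct.tmul_add, map_add, ha, hb]
    | single n v =>
      rw [TensorProduct.finsuppRight_apply_tmul]
      simp [ev_single, TensorProduct.tmul_smul]
  induction z using TensorProduct.induction_on with
  | zero => simp
  | add x y hx hy => simp only [map_add, hx, hy]
  | tmul v w => exact h _ _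

/-- Contracting the first factor with `φ i` gives a vector killed by all `φ j`, hence zero.
Expanding the second factor in a basis over `k` then gives coefficients in `V` killed by all `φ i`.
-/
theorem eq_zero_of_pair {ι : Type*} {φ : ι → V →ₗ[k] k}
    (hφ : ∀ v, (∀ i, φ i v = 0) → v = 0) {z : V ⊗[k] V}
    (h : ∀ i j, pair (φ i) (φ j) z = 0) : z = 0 := by
  let b := Module.Free.chooseBasis k V
  have h1 : ∀ i, TensorProduct.lid k V ((φ i).rTensor V z) = 0 := by
    intro i
    refine hφ _ fun j => ?_
    rw [← h i j]
    generalize z = w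
    induction w using TensorProduct.induction_on with
    | zero => simp
    | add x y hx hy => simp only [map_add, hx, hy]
    | tmul x y => simp
  -- Passage to the coefficients in the first factor, along the basis `b` of the second.
  apply (TensorProduct.equivFinsuppOfBasisRight b).injective
  rw [map_zero]
  ext n
  refine hφ _ fun i => ?_
  have h2 := congrArg (fun v => b.repr v n) (h1 i)
  simp only [map_zero, Finsupp.zero_apply] at h2
  rw [← h2]
  generalize z = w
  induction w using TensorProduct.induction_on with
  | zero => simp
  | add x y hx hy => simp only [map_add, Finsupp.add_apply, hx, hy]
  | tmul x y => simp [mul_comm]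

theorem pair_ev_actLeft (φ ψ : V →ₗ[k] k) (m : LambdaProduct k V) (a : V) (x : k)
    (z : V ⊗[k] V) : pair φ ψ (ev x (actLeft (m a) z)) = pair (φ ∘ₗ specialize m x a) ψ z := by
  rw [ev_actLeft, pair_rTensor]; rfl

theorem pair_ev_actRight (φ ψ : V →ₗ[k] k) (m : LambdaProduct k V) (a : V) (x : k)
    (z : V ⊗[k] V) : pair φ ψ (ev x (actRight (m a) z)) = pair φ (ψ ∘ₗ specialize m x a) z := by
  rw [ev_actRight, pair_lTensor]; rfl

/-- The functional `φ ⊗ ψ ⊗ χ` on `V ⊗ V ⊗ V`. -/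
def pair₃ (φ ψ χ : V →ₗ[k] k) : V ⊗[k] (V ⊗[k] V) →ₗ[k] k :=
  LinearMap.mul' k k ∘ₗ TensorProduct.map φ (pair ψ χ)

theorem pair₃_flip₁₂ (φ ψ χ : V →ₗ[k] k) (z : V ⊗[k] (V ⊗[k] V)) :
    pair₃ φ ψ χ (flip₁₂ k V z) = pair₃ ψ φ χ z := by
  induction z using TensorProduct.induction_on with
  | zero => simp
  | add x y hx hy => simp only [map_add, hx, hy]
  | tmul v w =>
    induction w using TensorProduct.induction_on with
    | zero => simp
    | add x y hx hy => simp only [TensorProduct.tmul_add, map_add, hx, hy]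
    | tmul x y => simp [pair₃]; ring

variable [Module k[X] V] [IsScalarTower k k[X] V]

theorem pair₃_coRight (φ ψ χ : V →ₗ[k] k) (D D' : Coproduct k V) (v : V) :
    pair₃ φ ψ χ (coRight D D' v) = pair φ (pair ψ χ ∘ₗ D.toLin) (D'.toLin v) := by
  rw [coRight]
  induction D'.toLin v using TensorProduct.induction_on with
  | zero => simp
  | add x y hx hy => simp only [map_add, hx, hy]
  | tmul x y => simp [pair₃]

theorem pair₃_coLeft (φ ψ χ : V →ₗ[k] k) (D D' : Coproduct k V) (v : V) :
    pair₃ φ ψ χ (coLeft D D' v) = pair (pair φ ψ ∘ₗ D.toLin) χ (D'.toLin v) := by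
  rw [coLeft]
  induction D'.toLin v using TensorProduct.induction_on with
  | zero => simp
  | add x y hx hy => simp only [map_add, hx, hy]
  | tmul x y =>
    rw [LinearMap.rTensor_tmul, pair_tmul, LinearMap.comp_apply]
    induction D.toLin x using TensorProduct.induction_on with
    | zero => simp
    | add x y hx hy => simp only [TensorProduct.add_tmul, map_add, hx, hy, add_mul]
    | tmul a b => simp [pair₃, mul_assoc]

theorem pair_del₂ {φ ψ : V →ₗ[k] k} {α β : k} (hφ : ∀ v, φ (del k V v) = α * φ v)
    (hψ : ∀ v, ψ (del k V v) = β * ψ v) (z : V ⊗[k] V) :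
    pair φ ψ (del₂ k V z) = (α + β) * pair φ ψ z := by
  induction z using TensorProduct.induction_on with
  | zero => simp
  | add x y hx hy => simp only [map_add, hx, hy, mul_add]
  | tmul x y => simp [del₂, hφ, hψ]; ring

theorem pair_ev_opp₂ {φ ψ : V →ₗ[k] k} {α β : k} (hφ : ∀ v, φ (del k V v) = α * φ v)
    (hψ : ∀ v, ψ (del k V v) = β * ψ v) (x : k) (p : LPoly (V ⊗[k] V)) :
    pair φ ψ (ev x (opp₂ p)) = pair φ ψ (ev (-x - (α + β)) p) :=
  map_ev_opp (pair φ ψ) (pair_del₂ hφ hψ) x p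

end Pairing

/-! ### Specialization on the conformal dual -/

section DualSpecialize

variable {k V : Type*} [Field k] [AddCommGroup V] [Module k V] [Module k[X] V]
  [IsScalarTower k k[X] V]

/-- The functional `v ↦ f_x(v)` on `V`. -/
def ConformalDual.value (f : ConformalDual k V) (x : k) : V →ₗ[k] k := Polynomial.leval x ∘ₗ f.lin

theorem ConformalDual.value_apply (f : ConformalDual k V) (x : k) (v : V) :
    f.value x v = (f.lin v).eval x := rfl

theorem ConformalDual.value_del (f : ConformalDual k V) (x : k) (v : V) :
    f.value x (del k V v) = x * f.value x v := by
  simp [ConformalDual.value_apply, f.lin_del]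

/-- On `f_{-z} ⊗ g_{-s}` the operator `∂^{⊗2}` is the scalar `-z-s`. If the four weights add up to
zero, `-λ-∂^{⊗2}` at `λ = -x` is `-y`: operators coming from `b` are evaluated at minus the weight
of `b`. -/
theorem pair_value_ev_opp₂ (f g : ConformalDual k V) {x y z s : k} (h : x + y + z + s = 0)
    (p : LPoly (V ⊗[k] V)) : pair (f.value (-z)) (g.value (-s)) (ev (-x) (opp₂ p)) =
      pair (f.value (-z)) (g.value (-s)) (ev (-y) p) := by
  have e : - -x - (-z + -s) = -y := by linear_combination h
  rw [pair_ev_opp₂ (f.value_del _) (g.value_del _), e]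

/-- The functional `f ↦ f_x(v)` on `V^{*c}`. -/
def evalFunctional (i : V × k) : ConformalDual k V →ₗ[k] k where
  toFun f := f.value i.2 i.1
  map_add' f g := by simp [ConformalDual.value_apply, ConformalDual.add_lin]
  map_smul' c f := by simp [ConformalDual.value_apply, ConformalDual.csmul_lin]

theorem evalFunctional_apply (i : V × k) (f : ConformalDual k V) :
    evalFunctional i f = f.value i.2 i.1 := rfl

theorem isSeparating_evalFunctional [Infinite k] :
    IsSeparating (evalFunctional (k := k) (V := V)) (fun i => -i.2) where
  weight i f := by
    simp [evalFunctional_apply, ConformalDual.value_apply, ConformalDual.del_lin]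
  eq_of_forall f g h := ConformalDual.ext' fun v => Polynomial.funext fun x => h (v, x)

/-- This is the injectivity of `V → V^{*c*c}`, which is where freeness enters. -/
theorem isSeparating_value [Infinite k] [Module.Free k[X] V] [Module.Finite k[X] V] :
    IsSeparating (fun i : ConformalDual k V × k => i.1.value i.2) (fun i => i.2) where
  weight i v := i.1.value_del i.2 v
  eq_of_forall v w h := by
    apply (toDoubleDual_bijective k V).1
    refine ConformalDual.ext' fun f => ?_
    rw [toDoubleDual_lin, toDoubleDual_lin]
    congr 1
    exact Polynomial.funext fun x => h (f, x)

theorem pair_value_ext [Infinite k] [Module.Free k[X] V] [Module.Finite k[X] V] {z w : V ⊗[k] V}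
    (h : ∀ (f g : ConformalDual k V) (x y : k), pair (f.value x) (g.value y) z =
      pair (f.value x) (g.value y) w) : z = w := by
  rw [← sub_eq_zero]
  refine eq_zero_of_pair (φ := fun i : ConformalDual k V × k => i.1.value i.2) (fun v hv =>
    isSeparating_value.eq_of_forall v 0 fun i => by rw [hv, map_zero]) fun i j => ?_
  rw [map_sub, h, sub_self]

theorem value_ev {p : LPoly (ConformalDual k V)} {v : V} {q : k[X][X]}
    (h : ∀ n, (p n).lin v = q.coeff n) (x y : k) : (ev x p).value y v = q.evalEval y x := by
  have h1 : (ev x p).value y v = ∑ n ∈ p.support, x ^ n * (q.coeff n).eval y := by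
    change evalFunctional (v, y) (ev x p) = _
    rw [ev_apply, Finsupp.sum, map_sum]
    refine Finset.sum_congr rfl fun n _ => ?_
    rw [map_smul, smul_eq_mul, evalFunctional_apply, ConformalDual.value_apply, h]
  rw [h1, Polynomial.evalEval, Polynomial.eval_eq_sum (p := q), Polynomial.sum,
      Polynomial.eval_finsetSum]
  symm
  refine (Finset.sum_subset (fun n hn => ?_) fun n _ hn => ?_).trans
    (Finset.sum_congr rfl fun n _ => ?_)
  · rw [Finsupp.mem_support_iff]
    intro h0
    refine Polynomial.mem_support_iff.1 hn ?_
    rw [← h, h0]; rfl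
  · rw [Polynomial.notMem_support_iff.1 hn]; simp
  · simp [mul_comm]

theorem evalEval_coproductForm (D : Coproduct k V) (f g : ConformalDual k V) (v : V) (x y : k) :
    (coproductForm D f.lin g.lin v).evalEval y x = pair (f.value x) (g.value (y - x)) (D.toLin v)
      := by
  simp only [coproductForm, LinearMap.comp_apply]
  induction D.toLin v using TensorProduct.induction_on with
  | zero => simp
  | add a b ha hb => simp only [map_add, Polynomial.evalEval_add, ha, hb]
  | tmul a b => simp [Polynomial.evalEval_mul, Polynomial.evalEval_C, evalEval_aeval,
      ConformalDual.value_apply]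

theorem specialize_dualProduct_value [Module.Finite k[X] V] (D : Coproduct k V)
    (f g : ConformalDual k V) (x y : k) :
    (specialize (dualProduct D) x f g).value y = pair (f.value x) (g.value (y - x)) ∘ₗ D.toLin :=
  LinearMap.ext fun v => by
    rw [specialize_apply, value_ev (fun n => dualProduct_lin D f g n v),
        evalEval_coproductForm]; rfl

theorem dualEnd_value [Module.Finite k[X] V] (φ : Chom k V V) (f : ConformalDual k V) (x y : k)
    (v : V) : (ev x ((dualEnd φ).lin f)).value y v = -f.value (y - x) (ev x (φ.lin v)) := by
  rw [value_ev (fun n => dualEnd_lin φ f n v), dualForm_apply, Polynomial.evalEval_neg,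
      evalEval_sum]
  simp [Polynomial.evalEval_C, ConformalDual.value_apply]

/-- The identification of `v` with `f ↦ f_{-λ}(v)` changes the sign of the indeterminate on the way
in and on the way out. What remains is `-(f_x g)_{x+y}(v)`, which is `-(f_x ⊗ g_y)(D v)` by
definition of the dual product. -/
theorem value_codualRep [Module.Free k[X] V] [Module.Finite k[X] V] (D : Coproduct k V)
    (f g : ConformalDual k V) (x y : k) (v : V) :
    g.value y (ev x ((codualRep (dualProduct D) (dualProduct_sesq D) f).lin v)) =
      -pair (f.value x) (g.value y) (D.toLin v) := by
  set E := doubleDualEquiv k V with hE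
  have hEat : ∀ (w : V) (h : ConformalDual k V) (z : k), (E w).value z h = h.value (-z) w := by
    intro w h z
    change ((h.lin w).comp (-Polynomial.X)).eval z = _
    rw [Polynomial.eval_comp]; simp [ConformalDual.value_apply]
  set φ := dualEnd (leftRep (dualProduct D) (dualProduct_sesq D) f) with hφ
  have h1 : ev x ((codualRep (dualProduct D) (dualProduct_sesq D) f).lin v) =
      E.symm (ev x (φ.lin (E v))) := by
    change ev x ((Chom.transport E φ).lin v) = _
    rw [Chom.transport_lin, ev_coeffMap]; rfl
  have h2 := hEat (E.symm (ev x (φ.lin (E v)))) g (-y)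
  rw [LinearEquiv.apply_symm_apply, neg_neg, hφ, dualEnd_value, hEat] at h2
  rw [h1, ← h2]
  change -(specialize (dualProduct D) x f g).value (-(-y - x)) v = _
  rw [specialize_dualProduct_value]
  simp

/-- An iterated product of `f`, `g`, `h` takes as values `f_x ⊗ g_y ⊗ h_{z-x-y}` applied to an
iterated coproduct. Each algebra axiom is thus the corresponding coalgebra axiom paired with three
functionals. -/
theorem IsPoissonConformalCoalgebra.dual [Infinite k] [Module.Finite k[X] V]
    {δ Δ : Coproduct k V} (h : IsPoissonConformalCoalgebra δ Δ) :
    IsPoissonConformalAlgebra (dualProduct δ) (dualProduct Δ) := by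
  have hsep := isSeparating_evalFunctional (k := k) (V := V)
  have h1 : ∀ x y : k, -x - -y = y - x := fun x y => by ring
  have hright : ∀ (D D' : Coproduct k V) (f g h : ConformalDual k V) (x y z : k) (v : V),
      (specialize (dualProduct D') x f (specialize (dualProduct D) y g h)).value z v =
        pair₃ (f.value x) (g.value y) (h.value (z - x - y)) (coRight D D' v) := by
    intro D D' f g h x y z v
    rw [specialize_dualProduct_value, specialize_dualProduct_value, pair₃_coRight]; rfl
  have hleft : ∀ (D D' : Coproduct k V) (f g h : ConformalDual k V) (x y z : k) (v : V),
      (specialize (dualProduct D') (x + y) (specialize (dualProduct D) x f g) h).value z v =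
        pair₃ (f.value x) (g.value y) (h.value (z - x - y)) (coLeft D D' v) := by
    intro D D' f g h x y z v
    rw [specialize_dualProduct_value, specialize_dualProduct_value, pair₃_coLeft,
      add_sub_cancel_left, sub_sub]; rfl
  -- Six coproducts are left free so that both the co-Jacobi identity and the compatibility of `δ`
  -- with `Δ` are instances.
  have hleib : ∀ D D' E E' F F' : Coproduct k V,
      (∀ a, coRight D D' a = coLeft E E' a + flip₁₂ k V (coRight F F' a)) →
      ∀ x y f g h, specialize (dualProduct D') x f (specialize (dualProduct D) y g h) =
        specialize (dualProduct E') (x + y) (specialize (dualProduct E) x f g) h +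
          specialize (dualProduct F') y g (specialize (dualProduct F) x f h) := by
    intro D D' E E' F F' H x y f g h
    refine hsep.eq_of_forall _ _ fun i => ?_
    rw [map_add]
    simp only [evalFunctional_apply, hright, hleft]
    rw [H, map_add, pair₃_flip₁₂, sub_right_comm]
  exact
    { lie :=
      { sesq := dualProduct_sesq δ
        skew := (hsep.isSkew_iff _).2 fun i x f g => by
          simp only [evalFunctional_apply, specialize_dualProduct_value, LinearMap.comp_apply]
          rw [h1, sub_sub_cancel]
          conv_lhs => rw [h.lie.skew, map_neg, pair_flip₂]
        jacobi := (jacobi_iff _ _ _).2 (hleib δ δ δ δ δ δ fun a => by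
          rw [← h.lie.jacobi a, sub_add_cancel]) }
      assoc :=
      { sesq := dualProduct_sesq Δ
        assoc := (assoc_iff _).2 fun x y f g l => hsep.eq_of_forall _ _ fun i => by
          simp only [evalFunctional_apply, hright, hleft]
          rw [h.assoc] }
      comm := (hsep.isCommutative_iff _).2 fun i x f g => by
        simp only [evalFunctional_apply, specialize_dualProduct_value, LinearMap.comp_apply]
        rw [h1, sub_sub_cancel]
        conv_lhs => rw [h.cocomm, pair_flip₂]
      leibniz := (jacobi_iff _ _ _).2 (hleib Δ δ δ Δ δ Δ h.compat) }

end DualSpecialize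

/-! ### The standard form on `P ⊕ P^{*c}`. -/

section StandardForm

variable {k P : Type*} [Field k] [AddCommGroup P] [Module k P] [Module k[X] P]
  [IsScalarTower k k[X] P]

theorem standardForm_apply (u v : P × ConformalDual k P) :
    standardForm k P u v = u.2.lin v.1 + (v.2.lin u.1).comp (-Polynomial.X) := rfl

theorem del_prod (u : P × ConformalDual k P) :
    del k (P × ConformalDual k P) u = (del k P u.1, del k (ConformalDual k P) u.2) := rfl

theorem isConformalForm_standardForm : IsConformalForm (standardForm k P) where
  del_left u v := by
    simp only [standardForm_apply, del_prod, ConformalDual.del_lin, ConformalDual.lin_del,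
      Polynomial.mul_comp, Polynomial.X_comp]
    ring
  del_right u v := by
    simp only [standardForm_apply, del_prod, ConformalDual.del_lin, ConformalDual.lin_del,
      Polynomial.mul_comp, Polynomial.X_comp, Polynomial.neg_comp]
    ring

theorem isSymmetricForm_standardForm : IsSymmetricForm (standardForm k P) := fun u v => by
  simp only [standardForm_apply, Polynomial.add_comp, comp_neg_neg]
  ring

/-- A functional on `P ⊕ P^{*c}` is an element of `P^{*c}` together with an element of `P^{*c*c}`,
and the latter is `P` by reflexivity. -/
theorem isNondegenerateForm_standardForm [Module.Free k[X] P] [Module.Finite k[X] P] :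
    IsNondegenerateForm (standardForm k P) := by
  constructor
  · rintro ⟨a, f⟩ h
    have hf : f = 0 := ConformalDual.ext' fun b => by
      have := h (b, 0)
      simp only [standardForm_apply] at this
      change f.lin b + (0 : k[X]).comp _ = 0 at this
      rw [Polynomial.zero_comp, add_zero] at this
      exact this
    have ha : a = 0 := by
      apply (toDoubleDual_bijective k P).1
      refine ConformalDual.ext' fun g => ?_
      have := h (0, g)
      simp only [standardForm_apply, map_zero, zero_add] at this
      rw [map_zero, toDoubleDual_lin, this]; rfl
    rw [ha, hf]; rfl
  · intro φ
    let f : ConformalDual k P := ⟨φ.lin ∘ₗ LinearMap.inl k P (ConformalDual k P), fun v => by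
      have := φ.lin_del (v, 0)
      rwa [del_prod, map_zero] at this⟩
    let F : ConformalDual k (ConformalDual k P) :=
      ⟨φ.lin ∘ₗ LinearMap.inr k P (ConformalDual k P), fun v => by
      have := φ.lin_del (0, v)
      rwa [del_prod, map_zero] at this⟩
    obtain ⟨a, ha⟩ := (toDoubleDual_bijective k P).2 F
    refine ⟨(a, f), fun b => ?_⟩
    have h1 : (b.2.lin a).comp (-Polynomial.X) = φ.lin (0, b.2) := by
      rw [← toDoubleDual_lin, ha]; rfl
    have h2 : f.lin b.1 = φ.lin (b.1, 0) := rfl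
    rw [standardForm_apply, h1, h2, ← map_add, Prod.mk_add_mk, add_zero, zero_add]

end StandardForm

/-! ### Invariant products on `P ⊕ P^{*c}` -/

section Double

variable {k P : Type*} [Field k] [AddCommGroup P] [Module k P] [Module k[X] P]
  [IsScalarTower k k[X] P]

theorem eval_standardForm (u v : P × ConformalDual k P) (z : k) :
    (standardForm k P u v).eval z = u.2.value z v.1 + v.2.value (-z) u.1 := by
  rw [standardForm_apply, Polynomial.eval_add, Polynomial.eval_comp]
  simp [ConformalDual.value_apply]

theorem value_zero (f : ConformalDual k P) (x : k) : f.value x 0 = 0 := map_zero _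

theorem zero_value (x : k) (a : P) : (0 : ConformalDual k P).value x a = 0 := by
  change Polynomial.eval x (0 : k[X]) = 0
  simp

theorem wform_winl_winr (a : P) (f : ConformalDual k P) {x y : k} (h : x + y = 0) :
    wform (standardForm k P) (winl _ a x) (winr _ f y) = f.value x a := by
  rw [wform_of_add_eq h, eval_standardForm, zero_value, zero_add, neg_eq_of_add_eq_zero_left h]

theorem wform_winr_winl (a : P) (f : ConformalDual k P) {x y : k} (h : x + y = 0) :
    wform (standardForm k P) (winr _ f x) (winl _ a y) = f.value y a := by
  rw [wform_of_add_eq h, eval_standardForm, zero_value, add_zero]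

theorem wform_winl_winl (a b : P) (x y : k) :
    wform (standardForm k P) (winl _ a x) (winl _ b y) = 0 := by
  by_cases h : x + y = 0
  · rw [wform_of_add_eq h, eval_standardForm, zero_value, zero_value, add_zero]
  · exact wform_of_add_ne h

theorem wform_winr_winr (f g : ConformalDual k P) (x y : k) :
    wform (standardForm k P) (winr _ f x) (winr _ g y) = 0 := by
  by_cases h : x + y = 0
  · rw [wform_of_add_eq h, eval_standardForm, value_zero, value_zero, add_zero]
  · exact wform_of_add_ne h

theorem wform_eq_add_left (u : P × ConformalDual k P) (x : k) (v : (P × ConformalDual k P) × k) :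
    wform (standardForm k P) (u, x) v = wform (standardForm k P) (winl _ u.1 x) v +
      wform (standardForm k P) (winr _ u.2 x) v := by
  rw [← wform_add_left, Prod.mk_add_mk, add_zero, zero_add]

theorem wform_eq_add_right (u : P × ConformalDual k P) (x : k)
    (v : (P × ConformalDual k P) × k) :
    wform (standardForm k P) v (u, x) = wform (standardForm k P) v (winl _ u.1 x) +
      wform (standardForm k P) v (winr _ u.2 x) := by
  rw [← wform_add_right, Prod.mk_add_mk, add_zero, zero_add]

variable [Module.Finite k[X] P]

/-- The invariant (skew-)commutative `λ`-products on `P ⊕ P^{*c}` extending the product `m` of `P`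
and the product of `P^{*c}` dual to the coproduct `D`. -/
structure IsDouble (ε : k) (m : LambdaProduct k P) (D : Coproduct k P)
    (n : LambdaProduct k (P × ConformalDual k P)) : Prop where
  inv : IsInvariantLambdaProduct (standardForm k P) ε n
  subP : IsSubproduct (LinearMap.inl k[X] P (ConformalDual k P)) m n
  subQ : IsSubproduct (LinearMap.inr k[X] P (ConformalDual k P)) (dualProduct D) n

section Basic

variable {ε ε' : k} {m m' : LambdaProduct k P} {D D' : Coproduct k P}
  {n n' : LambdaProduct k (P × ConformalDual k P)}

theorem IsDouble.wmul_winl (h : IsDouble ε m D n) (a b : P) (x y : k) :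
    wmul n (winl _ a x) (winl _ b y) = winl _ (specialize m (-x) a b) (x + y) :=
  h.subP.wmul_map a b x y

theorem IsDouble.wmul_winr (h : IsDouble ε m D n) (f g : ConformalDual k P) (x y : k) :
    wmul n (winr _ f x) (winr _ g y) =
      winr _ (specialize (dualProduct D) (-x) f g) (x + y) :=
  h.subQ.wmul_map f g x y

/-- Both products stay in their own summands, and the product of `P^{*c}` is by definition
evaluation on the coproduct. -/
theorem IsDouble.wform_winl_winr (h : IsDouble ε m D n) (h' : IsDouble ε' m' D' n')
    (a b : P) (f g : ConformalDual k P) {x y z s : k} (hw : x + y + z + s = 0) :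
    wform (standardForm k P) (wmul n (winl _ a x) (winl _ b y))
      (wmul n' (winr _ f z) (winr _ g s)) =
    pair (f.value (-z)) (g.value (-s)) (D'.toLin (specialize m (-x) a b)) := by
  have e1 : x + y + (z + s) = 0 := by rw [← hw]; ring
  have e2 : x + y - -z = -s := by linear_combination hw
  rw [h.wmul_winl, h'.wmul_winr, PoissonConformal.wform_winl_winr _ _ e1,
    specialize_dualProduct_value, e2]; rfl

/-- By invariance the `P^{*c}`-component of the product of `a` and `f` is, up to `ε`, the functional
`f` composed with multiplication by `a`. A second use of invariance moves `b` out, leaving a product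
inside `P^{*c}` evaluated at `b`. -/
theorem IsDouble.wform_dual_part (h : IsDouble ε m D n) (h' : IsDouble ε' m' D' n')
    (a b : P) (f g : ConformalDual k P) {x y z s : k} (hw : x + y + z + s = 0) :
    wform (standardForm k P) (winr _ (wmul n (winl _ a x) (winr _ f z)).1.2 (x + z))
      (wmul n' (winl _ b y) (winr _ g s)) =
    ε * pair (g.value (-s)) (f.value (-z) ∘ₗ specialize m (-x) a) (D'.toLin b) := by
  set U := wmul n (winl _ a x) (winr _ f z) with hU
  have hq : U.1.2.value (y + s) = ε • (f.value (-z) ∘ₗ specialize m (-x) a) := by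
    ext v
    have e1 : x + z + (y + s) = 0 := by rw [← hw]; ring
    have e2 : x + (y + s) + z = 0 := by rw [← hw]; ring
    have e3 : x + (y + s) = -z := by linear_combination e2
    have h1 := wform_eq_add_left U.1 (x + z) (winl _ v (y + s))
    rw [wform_winl_winl, zero_add, wform_winr_winl _ _ e1] at h1
    rw [← h1]
    change wform _ (wmul n (winl _ a x) (winr _ f z)) _ = _
    rw [← h.inv.cycle, h.inv.swap, h.wmul_winl, PoissonConformal.wform_winl_winr _ _ e2, e3]
    rfl
  have e4 : s + (x + z) + y = 0 := by rw [← hw]; ring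
  rw [h'.inv.symm, h'.inv.cycle, h'.wmul_winr, wform_winr_winl _ _ e4,
    specialize_dualProduct_value, sub_neg_eq_add, hq]
  change LinearMap.mul' k k (TensorProduct.map _ (ε • _) _) = _
  rw [TensorProduct.map_smul_right, LinearMap.smul_apply, map_smul]; rfl

/-- The mixed products are not given, but both summands are isotropic, so only the pairings of a
`P`-component with a `P^{*c}`-component survive. The two survivors are exchanged by interchanging
`(a, f)` with `(b, g)`, and invariance computes each of them. -/
theorem IsDouble.wform_mixed (h : IsDouble ε m D n) (h' : IsDouble ε' m' D' n')
    (a b : P) (f g : ConformalDual k P) {x y z s : k} (hw : x + y + z + s = 0) :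
    wform (standardForm k P) (wmul n (winl _ a x) (winr _ f z))
      (wmul n' (winl _ b y) (winr _ g s)) =
    ε * pair (g.value (-s)) (f.value (-z) ∘ₗ specialize m (-x) a) (D'.toLin b) +
    ε' * pair (f.value (-z)) (g.value (-s) ∘ₗ specialize m' (-y) b) (D.toLin a) := by
  have hw' : y + x + s + z = 0 := by rw [← hw]; ring
  rw [← h.wform_dual_part h' a b f g hw, ← h'.wform_dual_part h b a g f hw']
  set U := wmul n (winl _ a x) (winr _ f z) with hU
  set W := wmul n' (winl _ b y) (winr _ g s) with hW
  have hUW := wform_eq_add_left U.1 (x + z) W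
  have hUq := wform_eq_add_left U.1 (x + z) (winr _ W.1.2 (y + s))
  have hpW := wform_eq_add_right W.1 (y + s) (winl _ U.1.1 (x + z))
  rw [wform_winr_winr, add_zero] at hUq
  rw [wform_winl_winl, zero_add] at hpW
  change wform _ (U.1, x + z) W = _
  rw [hUW, add_comm]
  congr 1
  rw [h.inv.symm (winr _ _ _)]
  exact hpW.trans hUq.symm

end Basic

end Double

/-! ### Values and restrictions of the product on a direct sum. -/

section SumProduct

variable {k P Q : Type*} [Field k] [AddCommGroup P] [Module k P] [Module k[X] P]
  [IsScalarTower k k[X] P] [AddCommGroup Q] [Module k Q] [Module k[X] Q] [IsScalarTower k k[X] Q]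

theorem specialize_sumProduct (ε : k) (mP : LambdaProduct k P) (mQ : LambdaProduct k Q)
    (σP : P →ₗ[k[X]] Chom k Q Q) (σQ : Q →ₗ[k[X]] Chom k P P) (x : k) (u v : P × Q) :
    specialize (sumProduct ε mP mQ σP σQ) x u v =
      (specialize mP x u.1 v.1 + ev x ((σQ u.2).lin v.1) +
          ε • ev x (opp (del k P) ((σQ v.2).lin u.1)),
        specialize mQ x u.2 v.2 + ev x ((σP u.1).lin v.2) +
          ε • ev x (opp (del k Q) ((σP v.1).lin u.2))) := by
  rw [specialize_apply, sumProduct, LinearMap.mk₂_apply, map_add, ev_coeffMap, ev_coeffMap]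
  simp only [map_add, map_smul, LinearMap.inl_apply, LinearMap.inr_apply, Prod.mk_add_mk,
    add_zero, zero_add, Prod.smul_mk, smul_zero]
  rfl

theorem isSubproduct_inl_sumProduct (ε : k) (mP : LambdaProduct k P) (mQ : LambdaProduct k Q)
    (σP : P →ₗ[k[X]] Chom k Q Q) (σQ : Q →ₗ[k[X]] Chom k P P) :
    IsSubproduct (LinearMap.inl k[X] P Q) mP (sumProduct ε mP mQ σP σQ) := fun a b => by
  have h0 : (0 : Chom k P P).lin = 0 := rfl
  rw [sumProduct, LinearMap.mk₂_apply]
  simp only [LinearMap.inl_apply, map_zero, h0, LinearMap.zero_apply, smul_zero, add_zero]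
  rfl

theorem isSubproduct_inr_sumProduct (ε : k) (mP : LambdaProduct k P) (mQ : LambdaProduct k Q)
    (σP : P →ₗ[k[X]] Chom k Q Q) (σQ : Q →ₗ[k[X]] Chom k P P) :
    IsSubproduct (LinearMap.inr k[X] P Q) mQ (sumProduct ε mP mQ σP σQ) := fun a b => by
  have h0 : (0 : Chom k Q Q).lin = 0 := rfl
  rw [sumProduct, LinearMap.mk₂_apply]
  simp only [LinearMap.inr_apply, map_zero, h0, LinearMap.zero_apply, smul_zero, add_zero,
    zero_add]
  rfl

end SumProduct

/-! ### Invariance of the product built from the dual actions. -/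

section Coadjoint

variable {k P : Type*} [Field k] [Infinite k] [AddCommGroup P] [Module k P] [Module k[X] P]
  [IsScalarTower k k[X] P] [Module.Finite k[X] P]

/-- Paired with a third element `w`, the product of `u` and `v` is the cyclic sum of the terms "`w`
on the `P`-product of `u` and `v`" and "`u ⊗ v` on the coproduct of `w`". A cyclic sum is invariant,
and exchanging `u` and `v` multiplies it by `ε`. -/
theorem isDouble_sumProduct {ε : k} (hε : ε * ε = 1) {m : LambdaProduct k P} {D : Coproduct k P}
    {σP : P →ₗ[k[X]] Chom k (ConformalDual k P) (ConformalDual k P)}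
    {σQ : ConformalDual k P →ₗ[k[X]] Chom k P P}
    (hσP : ∀ a g x y u, (ev x ((σP a).lin g)).value y u =
      ε * g.value (y - x) (specialize m x a u))
    (hσQ : ∀ f b x (g : ConformalDual k P) y, g.value y (ev x ((σQ f).lin b)) =
      ε * pair (f.value x) (g.value y) (D.toLin b))
    (hm : ∀ (f : ConformalDual k P) x a b y, f.value y (specialize m x a b) =
      ε * f.value y (specialize m (-x - y) b a))
    (hD : ∀ φ ψ v, pair φ ψ (D.toLin v) = ε * pair ψ φ (D.toLin v)) :
    IsDouble ε m D (sumProduct ε m (dualProduct D) σP σQ) := by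
  set n := sumProduct ε m (dualProduct D) σP σQ with hn
  -- Six terms: the two given products, and the four actions, two of them through `-λ-∂`. The factor
  -- `ε` of those two cancels against the one in `hσP` or `hσQ`.
  have hT : ∀ u v w x z, (standardForm k P (specialize n x u v) w).eval z =
      w.2.value (-z) (specialize m x u.1 v.1) +
      ε * pair (u.2.value x) (w.2.value (-z)) (D.toLin v.1) +
      pair (v.2.value (-x + z)) (w.2.value (-z)) (D.toLin u.1) +
      pair (u.2.value x) (v.2.value (z - x)) (D.toLin w.1) +
      ε * v.2.value (z - x) (specialize m x u.1 w.1) +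
      u.2.value x (specialize m (-x + z) v.1 w.1) := by
    intro u v w x z
    have hQ : ∀ f g h : ConformalDual k P, (f + g + ε • h).value z w.1 =
        f.value z w.1 + g.value z w.1 + ε * h.value z w.1 := fun f g h => by
      simp [ConformalDual.value_apply, ConformalDual.add_lin, ConformalDual.csmul_lin]
    have hopp : (ev x (opp (del k (ConformalDual k P)) ((σP v.1).lin u.2))).value z w.1 =
        ε * u.2.value x (specialize m (-x + z) v.1 w.1) := by
      have := eval_opp (isSeparating_evalFunctional.weight (w.1, z)) x ((σP v.1).lin u.2)
      simp only [evalFunctional_apply, hσP] at this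
      rw [this]
      ring_nf
    have hopp' : w.2.value (-z) (ev x (opp (del k P) ((σQ v.2).lin u.1))) =
        ε * pair (v.2.value (-x + z)) (w.2.value (-z)) (D.toLin u.1) := by
      rw [eval_opp (w.2.value_del (-z)), hσQ, sub_neg_eq_add]
    rw [eval_standardForm, hn, specialize_sumProduct, hQ, map_add, map_add, map_smul, hopp, hopp',
      hσP, hσQ, specialize_dualProduct_value, smul_eq_mul, LinearMap.comp_apply]
    linear_combination (pair (v.2.value (-x + z)) (w.2.value (-z)) (D.toLin u.1) +
      u.2.value x (specialize m (-x + z) v.1 w.1)) * hε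
  -- At total weight zero every functional is evaluated at minus its own weight, which makes the
  -- cyclic symmetry visible.
  have hTw : ∀ u v w : (P × ConformalDual k P) × k, u.2 + v.2 + w.2 = 0 →
      wform (standardForm k P) (wmul n u v) w =
      w.1.2.value (-w.2) (specialize m (-u.2) u.1.1 v.1.1) +
      ε * pair (u.1.2.value (-u.2)) (w.1.2.value (-w.2)) (D.toLin v.1.1) +
      pair (v.1.2.value (-v.2)) (w.1.2.value (-w.2)) (D.toLin u.1.1) +
      pair (u.1.2.value (-u.2)) (v.1.2.value (-v.2)) (D.toLin w.1.1) +
      ε * v.1.2.value (-v.2) (specialize m (-u.2) u.1.1 w.1.1) +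
      u.1.2.value (-u.2) (specialize m (-v.2) v.1.1 w.1.1) := by
    intro u v w h
    have e1 : - -u.2 + w.2 = -v.2 := by linear_combination h
    have e2 : w.2 - -u.2 = -v.2 := by linear_combination h
    rw [wform_of_add_eq (u := wmul n u v) h]
    simp only [wmul]
    rw [hT, e1, e2]
  have hms : ∀ (f : ConformalDual k P) a b x y z, x + y + z = 0 →
      f.value (-z) (specialize m (-x) a b) = ε * f.value (-z) (specialize m (-y) b a) := by
    intro f a b x y z h
    have e : - -x - -z = -y := by linear_combination h
    rw [hm, e]
  refine ⟨⟨wform_symm isSymmetricForm_standardForm, fun u v w => ?_, fun u v w => ?_⟩,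
    isSubproduct_inl_sumProduct _ _ _ _ _, isSubproduct_inr_sumProduct _ _ _ _ _⟩
  · rw [wform_symm isSymmetricForm_standardForm u]
    by_cases h : u.2 + v.2 + w.2 = 0
    · have h' : v.2 + w.2 + u.2 = 0 := by rw [← h]; ring
      have h'' : w.2 + u.2 + v.2 = 0 := by rw [← h]; ring
      rw [hTw u v w h, hTw v w u h', hms w.1.2 u.1.1 v.1.1 u.2 v.2 w.2 h,
        hms v.1.2 w.1.1 u.1.1 w.2 u.2 v.2 h'', hD (v.1.2.value _) (u.1.2.value _),
        hD (w.1.2.value _) (u.1.2.value _)]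
      linear_combination -(pair (u.1.2.value (-u.2)) (v.1.2.value (-v.2)) (D.toLin w.1.1)) * hε
    · have h' : v.2 + w.2 + u.2 ≠ 0 := fun e => h (by rw [← e]; ring)
      rw [wform_of_add_ne (u := wmul n u v) h, wform_of_add_ne (u := wmul n v w) h']
  · by_cases h : u.2 + v.2 + w.2 = 0
    · have h' : v.2 + u.2 + w.2 = 0 := by rw [← h]; ring
      have h'' : u.2 + w.2 + v.2 = 0 := by rw [← h]; ring
      rw [hTw u v w h, hTw v u w h', hms w.1.2 u.1.1 v.1.1 u.2 v.2 w.2 h,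
        hD (v.1.2.value _) (u.1.2.value _)]
      linear_combination -(pair (v.1.2.value (-v.2)) (w.1.2.value (-w.2)) (D.toLin u.1.1) +
        pair (u.1.2.value (-u.2)) (v.1.2.value (-v.2)) (D.toLin w.1.1) +
        u.1.2.value (-u.2) (specialize m (-v.2) v.1.1 w.1.1)) * hε
    · have h' : v.2 + u.2 + w.2 ≠ 0 := by rwa [add_comm v.2]
      rw [wform_of_add_ne (u := wmul n u v) h, wform_of_add_ne (u := wmul n v u) h', mul_zero]

variable [Module.Free k[X] P]

theorem IsLieConformalAlgebra.isDouble {br : LambdaProduct k P} (hbr : IsLieConformalAlgebra br)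
    {δ : Coproduct k P} (hδ : IsLieConformalCoalgebra δ) :
    IsDouble (-1) br δ (sumProduct (-1) br (dualProduct δ) (dualRep (leftRep br hbr.sesq))
      (codualRep (dualProduct δ) (dualProduct_sesq δ))) :=
  isDouble_sumProduct (by ring)
    (fun a g x y u => by
      rw [neg_one_mul]; exact dualEnd_value (leftRep br hbr.sesq a) g x y u)
    (fun f b x g y => by rw [neg_one_mul, value_codualRep])
    (fun f x a b y => by
      rw [neg_one_mul]; exact (isSeparating_value.isSkew_iff br).1 hbr.skew (f, y) x a b)
    (fun φ ψ v => by
      conv_lhs => rw [hδ.skew, map_neg, pair_flip₂]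
      rw [neg_one_mul])

/-- The dual of a representation carries a sign. For the bracket it is the required `ε = -1`; here
`ε = 1`, which is why `-𝔏^*` occurs and not `𝔏^*`. -/
theorem IsCommutative.isDouble {mul : LambdaProduct k P} (hmul : IsCommutative mul)
    (hs : IsSesquilinear mul) {Δ : Coproduct k P} (hΔ : IsCocommutative Δ) :
    IsDouble 1 mul Δ (sumProduct 1 mul (dualProduct Δ) (-dualRep (leftRep mul hs))
      (-codualRep (dualProduct Δ) (dualProduct_sesq Δ))) :=
  isDouble_sumProduct (by ring)
    (fun a g x y u => by
      have h1 : ((-dualRep (leftRep mul hs)) a).lin g =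
        -(dualEnd (leftRep mul hs a)).lin g := rfl
      have h2 := dualEnd_value (leftRep mul hs a) g x y u
      rw [h1, map_neg]
      change evalFunctional (u, y) (-_) = _
      rw [map_neg, evalFunctional_apply, h2, neg_neg, one_mul]; rfl)
    (fun f b x g y => by
      have h1 : ((-codualRep (dualProduct Δ) (dualProduct_sesq Δ)) f).lin b =
        -(codualRep (dualProduct Δ) (dualProduct_sesq Δ) f).lin b := rfl
      rw [h1, map_neg, map_neg, value_codualRep, neg_neg, one_mul])
    (fun f x a b y => by
      rw [one_mul]; exact (isSeparating_value.isCommutative_iff mul).1 hmul (f, y) x a b)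
    (fun φ ψ v => by
      conv_lhs => rw [hΔ, pair_flip₂]
      rw [one_mul])

end Coadjoint

/-! ### Mixed identities and the bialgebra conditions. -/

section Bialgebra

theorem JacobiAt.of_add_ne {k R : Type*} [Field k] [AddCommGroup R] [Module k R]
    {B : R →ₗ[k] R →ₗ[k] k[X]} {m : LambdaProduct k R} {u v w t : R × k}
    (h : u.2 + v.2 + w.2 + t.2 ≠ 0) : JacobiAt (wform B) (wmul m) u v w t := by
  have h1 : u.2 + v.2 + (w.2 + t.2) ≠ 0 := fun e => h (by rw [← e]; ring)
  have h2 : v.2 + w.2 + (u.2 + t.2) ≠ 0 := fun e => h (by rw [← e]; ring)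
  have h3 : w.2 + u.2 + (v.2 + t.2) ≠ 0 := fun e => h (by rw [← e]; ring)
  rw [JacobiAt, wform_of_add_ne (u := wmul m u v) (v := wmul m w t) h1,
    wform_of_add_ne (u := wmul m v w) (v := wmul m u t) h2,
    wform_of_add_ne (u := wmul m w u) (v := wmul m v t) h3, add_zero, add_zero]

theorem AssocAt.of_add_ne {k R : Type*} [Field k] [AddCommGroup R] [Module k R]
    {B : R →ₗ[k] R →ₗ[k] k[X]} {m : LambdaProduct k R} {u v w t : R × k}
    (h : u.2 + v.2 + w.2 + t.2 ≠ 0) : AssocAt (wform B) (wmul m) u v w t := by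
  have h1 : u.2 + v.2 + (w.2 + t.2) ≠ 0 := fun e => h (by rw [← e]; ring)
  have h2 : v.2 + w.2 + (u.2 + t.2) ≠ 0 := fun e => h (by rw [← e]; ring)
  have h3 : u.2 + w.2 + (v.2 + t.2) ≠ 0 := fun e => h (by rw [← e]; ring)
  rw [AssocAt, wform_of_add_ne (u := wmul m u v) (v := wmul m w t) h1,
    wform_of_add_ne (u := wmul m v w) (v := wmul m u t) h2,
    wform_of_add_ne (u := wmul m u w) (v := wmul m v t) h3]
  exact ⟨rfl, rfl⟩

theorem LeibnizAt.of_add_ne {k R : Type*} [Field k] [AddCommGroup R] [Module k R]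
    {B : R →ₗ[k] R →ₗ[k] k[X]} {m n : LambdaProduct k R} {u v w t : R × k}
    (h : u.2 + v.2 + w.2 + t.2 ≠ 0) : LeibnizAt (wform B) (wmul m) (wmul n) u v w t := by
  have h1 : u.2 + v.2 + (w.2 + t.2) ≠ 0 := fun e => h (by rw [← e]; ring)
  have h2 : u.2 + w.2 + (v.2 + t.2) ≠ 0 := fun e => h (by rw [← e]; ring)
  have h3 : u.2 + t.2 + (v.2 + w.2) ≠ 0 := fun e => h (by rw [← e]; ring)
  rw [LeibnizAt, wform_of_add_ne (u := wmul m u v) (v := wmul n w t) h1,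
    wform_of_add_ne (u := wmul m u w) (v := wmul n v t) h2,
    wform_of_add_ne (u := wmul m u t) (v := wmul n v w) h3, add_zero, add_zero]

variable {k P : Type*} [Field k] [Infinite k] [AddCommGroup P] [Module k P] [Module k[X] P]
  [IsScalarTower k k[X] P] [Module.Free k[X] P] [Module.Finite k[X] P]

/-- The weight `y` does not occur in the equation. It is carried along so that the test has the
shape of a four-argument identity of total weight zero. -/
theorem lpoly_tensor_ext_iff {p q : LPoly (P ⊗[k] P)} : p = q ↔
    ∀ (f g : ConformalDual k P) (x y z s : k), x + y + z + s = 0 →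
      pair (f.value (-z)) (g.value (-s)) (ev (-x) p) =
        pair (f.value (-z)) (g.value (-s)) (ev (-x) q) := by
  constructor
  · rintro rfl
    intros
    rfl
  · intro h
    refine ev_ext (k := k) fun x => pair_value_ext fun f g z s => ?_
    -- The second weight is solved for from the other three.
    simpa using h f g (-x) (x + z + s) (-z) (-s) (by ring)

variable {br mul : LambdaProduct k P} {δ Δ : Coproduct k P}
  {nb nm : LambdaProduct k (P × ConformalDual k P)}

/-- The term `F([a,b],[f,g])` is `δ([a_λ b])` tested on `f ⊗ g`. The other two summands of the
Jacobi sum are mixed and give two terms each: these are the four terms in which `𝔞𝔡(a)` or `𝔞𝔡(b)`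
acts on the left or right factor. -/
theorem lie_compat_iff (hδ : IsLieConformalCoalgebra δ) (hb : IsDouble (-1) br δ nb) :
    (∀ a b, coeffMap δ.toLin (br a b) =
    (actLeft (br a) (δ.toLin b) + actRight (br a) (δ.toLin b)) -
      opp₂ (actLeft (br b) (δ.toLin a) + actRight (br b) (δ.toLin a))) ↔
    ∀ a b f g x y z s, JacobiAt (wform (standardForm k P)) (wmul nb)
      (winl _ a x) (winl _ b y) (winr _ f z) (winr _ g s) := by
  have hflip : ∀ φ ψ v, pair φ ψ (δ.toLin v) = -pair ψ φ (δ.toLin v) := fun φ ψ v => by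
    conv_lhs => rw [hδ.skew, map_neg, pair_flip₂]
  have key : ∀ a b f g x y z s, x + y + z + s = 0 →
      (JacobiAt (wform (standardForm k P)) (wmul nb)
        (winl _ a x) (winl _ b y) (winr _ f z) (winr _ g s) ↔
      pair (f.value (-z)) (g.value (-s)) (ev (-x) (coeffMap δ.toLin (br a b))) =
        pair (f.value (-z)) (g.value (-s)) (ev (-x)
          ((actLeft (br a) (δ.toLin b) + actRight (br a) (δ.toLin b)) -
            opp₂ (actLeft (br b) (δ.toLin a) + actRight (br b) (δ.toLin a))))) := by
    intro a b f g x y z s h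
    have h' : y + x + z + s = 0 := by rw [← h]; ring
    rw [ev_coeffMap, map_sub, map_sub, pair_value_ev_opp₂ f g h]
    simp only [map_add, pair_ev_actLeft, pair_ev_actRight]
    rw [JacobiAt, hb.wform_winl_winr hb a b f g h, hb.wform_mixed hb b a f g h',
      hb.inv.swap (winr _ f z), hb.wform_mixed hb a b f g h,
      hflip (g.value _) (f.value (-z) ∘ₗ specialize br (-y) b),
      hflip (g.value _) (f.value (-z) ∘ₗ specialize br (-x) a), specialize_apply]
    constructor <;> intro H <;> linear_combination H
  constructor
  · intro H a b f g x y z s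
    by_cases h : x + y + z + s = 0
    · exact (key a b f g x y z s h).2 (lpoly_tensor_ext_iff.1 (H a b) f g x y z s h)
    · exact JacobiAt.of_add_ne h
  · intro H a b
    exact lpoly_tensor_ext_iff.2 fun f g x y z s h =>
      (key a b f g x y z s h).1 (H a b f g x y z s)

/-- The two equalities between the three splittings correspond to the two conditions one by one: the
equality involving `F(ab, fg)` gives the formula for `Δ(a_λ b)`, and the equality of the two mixed
splittings gives the second condition. -/
theorem asi_compat_iff (hmul : IsCommutative mul) (hΔ : IsCocommutative Δ)
    (hm : IsDouble 1 mul Δ nm) :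
    ((∀ a b, coeffMap Δ.toLin (mul a b) =
      actRight (mul a) (Δ.toLin b) + opp₂ (actLeft (rightMul mul b) (Δ.toLin a))) ∧
    (∀ a b, opp₂ (actLeft (mul b) (Δ.toLin a) - actRight (rightMul mul b) (Δ.toLin a)) +
      coeffMap (flip₂ k P)
        (actLeft (mul a) (Δ.toLin b) - actRight (rightMul mul a) (Δ.toLin b)) = 0)) ↔
    ∀ a b f g x y z s, AssocAt (wform (standardForm k P)) (wmul nm)
      (winl _ a x) (winl _ b y) (winr _ f z) (winr _ g s) := by
  -- For a commutative product right and left multiplications coincide.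
  have hright : ∀ b, rightMul mul b = mul b := fun b => LinearMap.ext fun c => (hmul b c).symm
  simp only [hright]
  have hflip : ∀ φ ψ v, pair φ ψ (Δ.toLin v) = pair ψ φ (Δ.toLin v) := fun φ ψ v => by
    conv_lhs => rw [hΔ, pair_flip₂]
  have key : ∀ a b f g x y z s, x + y + z + s = 0 →
      (AssocAt (wform (standardForm k P)) (wmul nm)
        (winl _ a x) (winl _ b y) (winr _ f z) (winr _ g s) ↔
      pair (f.value (-z)) (g.value (-s)) (ev (-x) (coeffMap Δ.toLin (mul a b))) =
        pair (f.value (-z)) (g.value (-s)) (ev (-x)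
          (actRight (mul a) (Δ.toLin b) + opp₂ (actLeft (mul b) (Δ.toLin a)))) ∧
      pair (f.value (-z)) (g.value (-s)) (ev (-x)
        (opp₂ (actLeft (mul b) (Δ.toLin a) - actRight (mul b) (Δ.toLin a)) +
          coeffMap (flip₂ k P) (actLeft (mul a) (Δ.toLin b) - actRight (mul a) (Δ.toLin b)))) =
        pair (f.value (-z)) (g.value (-s)) (ev (-x) 0)) := by
    intro a b f g x y z s h
    have h' : y + x + z + s = 0 := by rw [← h]; ring
    simp only [ev_coeffMap, map_add, map_zero, pair_value_ev_opp₂ f g h, map_sub, pair_flip₂,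
      pair_ev_actLeft, pair_ev_actRight]
    rw [AssocAt, hm.wform_winl_winr hm a b f g h, hm.wform_mixed hm b a f g h',
      hm.wform_mixed hm a b f g h,
      hflip (g.value _) (f.value (-z) ∘ₗ specialize mul (-y) b),
      hflip (g.value _) (f.value (-z) ∘ₗ specialize mul (-x) a),
      hflip (g.value _ ∘ₗ specialize mul (-x) a), specialize_apply]
    refine and_congr ?_ ?_
    · constructor <;> intro H <;> linear_combination H
    · constructor <;> intro H <;> linear_combination -H
  constructor
  · rintro ⟨H1, H2⟩ a b f g x y z s
    by_cases h : x + y + z + s = 0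
    · exact (key a b f g x y z s h).2 ⟨lpoly_tensor_ext_iff.1 (H1 a b) f g x y z s h,
        lpoly_tensor_ext_iff.1 (H2 a b) f g x y z s h⟩
    · exact AssocAt.of_add_ne h
  · intro H
    exact ⟨fun a b => lpoly_tensor_ext_iff.2 fun f g x y z s h =>
        ((key a b f g x y z s h).1 (H a b f g x y z s)).1,
      fun a b => lpoly_tensor_ext_iff.2 fun f g x y z s h =>
        ((key a b f g x y z s h).1 (H a b f g x y z s)).2⟩

/-- The first Leibniz argument is `f`, so every bracket in the identity involves `f`. The condition
lets `𝔞𝔡` act on the second tensor factor; hence it is tested on `g ⊗ f`. -/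
theorem poisson_compat₁_iff (hδ : IsLieConformalCoalgebra δ) (hΔ : IsCocommutative Δ)
    (hb : IsDouble (-1) br δ nb) (hm : IsDouble 1 mul Δ nm) :
    (∀ a b, coeffMap δ.toLin (mul a b) =
    actLeft (mul a) (δ.toLin b) + opp₂ (actLeft (mul b) (δ.toLin a)) +
      actRight (br a) (Δ.toLin b) + opp₂ (actRight (br b) (Δ.toLin a))) ↔
    ∀ f g a b z s x y, LeibnizAt (wform (standardForm k P)) (wmul nb) (wmul nm)
      (winr _ f z) (winr _ g s) (winl _ a x) (winl _ b y) := by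
  have hflip : ∀ φ ψ v, pair φ ψ (Δ.toLin v) = pair ψ φ (Δ.toLin v) := fun φ ψ v => by
    conv_lhs => rw [hΔ, pair_flip₂]
  have hflip' : ∀ φ ψ v, pair φ ψ (δ.toLin v) = -pair ψ φ (δ.toLin v) := fun φ ψ v => by
    conv_lhs => rw [hδ.skew, map_neg, pair_flip₂]
  have key : ∀ a b f g x y z s, x + y + z + s = 0 →
      (LeibnizAt (wform (standardForm k P)) (wmul nb) (wmul nm)
        (winr _ f z) (winr _ g s) (winl _ a x) (winl _ b y) ↔
      pair (g.value (-s)) (f.value (-z)) (ev (-x) (coeffMap δ.toLin (mul a b))) =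
        pair (g.value (-s)) (f.value (-z)) (ev (-x)
          (actLeft (mul a) (δ.toLin b) + opp₂ (actLeft (mul b) (δ.toLin a)) +
            actRight (br a) (Δ.toLin b) + opp₂ (actRight (br b) (Δ.toLin a))))) := by
    intro a b f g x y z s h
    have h' : y + x + z + s = 0 := by rw [← h]; ring
    have h'' : x + y + s + z = 0 := by rw [← h]; ring
    simp only [ev_coeffMap, map_add, pair_value_ev_opp₂ g f h'', pair_ev_actLeft,
      pair_ev_actRight]
    rw [LeibnizAt, hb.inv.symm (wmul nb (winr _ f z) (winr _ g s)),
      hm.wform_winl_winr hb a b f g h, hb.inv.swap (winr _ f z) (winl _ a x),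
      hb.inv.swap (winr _ f z) (winl _ b y), hm.inv.swap_right (winr _ g s) (winl _ b y),
      hm.inv.swap_right (winr _ g s) (winl _ a x), hb.wform_mixed hm a b f g h,
      hb.wform_mixed hm b a f g h', hflip' (f.value _) (g.value _),
      hflip' (f.value _) (g.value _ ∘ₗ specialize mul (-y) b),
      hflip' (f.value _) (g.value _ ∘ₗ specialize mul (-x) a), specialize_apply]
    constructor <;> intro H <;> linear_combination -H
  constructor
  · intro H f g a b z s x y
    by_cases h : x + y + z + s = 0
    · exact (key a b f g x y z s h).2
        (lpoly_tensor_ext_iff.1 (H a b) g f x y s z (by rw [← h]; ring))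
    · exact LeibnizAt.of_add_ne fun e => h (by rw [← e]; ring)
  · intro H a b
    exact lpoly_tensor_ext_iff.2 fun g f x y s z h =>
      (key a b f g x y z s (by rw [← h]; ring)).1 (H f g a b z s x y)

/-- The first Leibniz argument is `a`. Each of the two mixed terms contributes one term with `𝔞𝔡(a)`
acting on `Δ(b)` and one with `𝔏(b)` acting on `δ(a)`. -/
theorem poisson_compat₂_iff (hδ : IsLieConformalCoalgebra δ) (hΔ : IsCocommutative Δ)
    (hb : IsDouble (-1) br δ nb) (hm : IsDouble 1 mul Δ nm) :
    (∀ a b, coeffMap Δ.toLin (br a b) =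
    (actLeft (br a) (Δ.toLin b) + actRight (br a) (Δ.toLin b)) -
      opp₂ (actRight (mul b) (δ.toLin a)) + opp₂ (actLeft (mul b) (δ.toLin a))) ↔
    ∀ a b f g x y z s, LeibnizAt (wform (standardForm k P)) (wmul nb) (wmul nm)
      (winl _ a x) (winl _ b y) (winr _ f z) (winr _ g s) := by
  have hflip : ∀ φ ψ v, pair φ ψ (Δ.toLin v) = pair ψ φ (Δ.toLin v) := fun φ ψ v => by
    conv_lhs => rw [hΔ, pair_flip₂]
  have hflip' : ∀ φ ψ v, pair φ ψ (δ.toLin v) = -pair ψ φ (δ.toLin v) := fun φ ψ v => by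
    conv_lhs => rw [hδ.skew, map_neg, pair_flip₂]
  have key : ∀ a b f g x y z s, x + y + z + s = 0 →
      (LeibnizAt (wform (standardForm k P)) (wmul nb) (wmul nm)
        (winl _ a x) (winl _ b y) (winr _ f z) (winr _ g s) ↔
      pair (f.value (-z)) (g.value (-s)) (ev (-x) (coeffMap Δ.toLin (br a b))) =
        pair (f.value (-z)) (g.value (-s)) (ev (-x)
          ((actLeft (br a) (Δ.toLin b) + actRight (br a) (Δ.toLin b)) -
            opp₂ (actRight (mul b) (δ.toLin a)) + opp₂ (actLeft (mul b) (δ.toLin a))))) := by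
    intro a b f g x y z s h
    have h' : x + y + s + z = 0 := by rw [← h]; ring
    simp only [ev_coeffMap, map_add, map_sub, pair_value_ev_opp₂ f g h, pair_ev_actLeft,
      pair_ev_actRight]
    rw [LeibnizAt, hb.wform_winl_winr hm a b f g h, hb.wform_mixed hm a b f g h,
      hb.wform_mixed hm a b g f h', hflip (g.value _) (f.value _ ∘ₗ specialize br (-x) a),
      hflip' (g.value _) (f.value _ ∘ₗ specialize mul (-y) b), specialize_apply]
    constructor <;> intro H <;> linear_combination H
  constructor
  · intro H a b f g x y z s
    by_cases h : x + y + z + s = 0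
    · exact (key a b f g x y z s h).2 (lpoly_tensor_ext_iff.1 (H a b) f g x y z s h)
    · exact LeibnizAt.of_add_ne h
  · intro H a b
    exact lpoly_tensor_ext_iff.2 fun f g x y z s h =>
      (key a b f g x y z s h).1 (H a b f g x y z s)

/-- The quadratic identities on the double are equivalent to their instances with two arguments in
each summand, the rest being axioms of `P` and `P^{*c}`; those instances are the bialgebra
conditions. The products `nb` and `nm` are arbitrary doubles, so this applies to matched pairs and
to Manin triples alike. -/
theorem isPoissonConformalAlgebra_double_iff (hP : IsPoissonConformalAlgebra br mul)
    (hco : IsPoissonConformalCoalgebra δ Δ)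
    (hb : IsDouble (-1) br δ nb) (hm : IsDouble 1 mul Δ nm) :
    IsPoissonConformalAlgebra nb nm ↔ IsPoissonConformalBialgebra br mul δ Δ := by
  have hQ := hco.dual
  rw [isPoissonConformalAlgebra_iff isConformalForm_standardForm isNondegenerateForm_standardForm
    hb.inv hm.inv]
  constructor
  · rintro ⟨hJ, hA, hL⟩
    obtain ⟨hA1, hA2⟩ := (asi_compat_iff hP.comm hco.cocomm hm).2 fun _ _ _ _ _ _ _ _ =>
      hA _ _ _ _
    exact
      { alg := hP
        coalg := hco
        lie := ⟨hP.lie, hco.lie, (lie_compat_iff hco.lie hb).2 fun _ _ _ _ _ _ _ _ => hJ _ _ _ _⟩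
        asi := ⟨hP.assoc, hco.assoc, hA1, hA2⟩
        comm := hP.comm
        cocomm := hco.cocomm
        compat₁ := (poisson_compat₁_iff hco.lie hco.cocomm hb hm).2 fun _ _ _ _ _ _ _ _ =>
          hL _ _ _ _
        compat₂ := (poisson_compat₂_iff hco.lie hco.cocomm hb hm).2 fun _ _ _ _ _ _ _ _ =>
          hL _ _ _ _ }
  · intro h
    refine ⟨?_, ?_, ?_⟩
    · exact forall₄_of_summands (fun _ _ _ _ H => H.swap₁₂ hb.inv)
        (fun _ _ _ _ H => H.swap₂₃ hb.inv)
        (fun _ _ _ _ H => H.swap₃₄ hb.inv) (fun _ _ _ _ _ _ => JacobiAt.add)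
        (fun a b c x y z t => (jacobiAt_iff hb.inv).2
          (hb.subP.wform_leibniz hb.subP hb.subP hP.lie.jacobi a b c x y z t))
        (fun a b c x y z t => (jacobiAt_iff hb.inv).2
          (hb.subQ.wform_leibniz hb.subQ hb.subQ hQ.lie.jacobi a b c x y z t))
        ((lie_compat_iff hco.lie hb).1 h.lie.compat)
    · exact forall₄_of_summands (fun _ _ _ _ H => H.swap₁₂ hm.inv)
        (fun _ _ _ _ H => H.swap₂₃ hm.inv)
        (fun _ _ _ _ H => H.swap₃₄ hm.inv) (fun _ _ _ _ _ _ => AssocAt.add)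
        (fun a b c x y z t => (assocAt_iff hm.inv).2
          ⟨hm.subP.wform_assoc hP.assoc.assoc a b c x y z t,
            hm.subP.wform_assoc hP.assoc.assoc a c b x z y t⟩)
        (fun a b c x y z t => (assocAt_iff hm.inv).2
          ⟨hm.subQ.wform_assoc hQ.assoc.assoc a b c x y z t,
            hm.subQ.wform_assoc hQ.assoc.assoc a c b x z y t⟩)
        ((asi_compat_iff hP.comm hco.cocomm hm).1 ⟨h.asi.compat₁, h.asi.compat₂⟩)
    · exact forall₄_of_summands' (fun _ _ _ _ H => H.swap₂₃ hm.inv)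
        (fun _ _ _ _ H => H.swap₃₄ hm.inv)
        (fun _ _ _ _ H1 H2 H3 => LeibnizAt.of_rotations hb.inv H1 H2 H3)
        (fun _ _ _ _ _ _ => LeibnizAt.add₁) (fun _ _ _ _ _ _ => LeibnizAt.add₂)
        (fun a b c x y z t => (leibnizAt_iff hb.inv hm.inv).2
          (hb.subP.wform_leibniz hm.subP hm.subP hP.leibniz a b c x y z t))
        (fun a b c x y z t => (leibnizAt_iff hb.inv hm.inv).2
          (hb.subQ.wform_leibniz hm.subQ hm.subQ hQ.leibniz a b c x y z t))
        ((poisson_compat₂_iff hco.lie hco.cocomm hb hm).1 h.compat₂)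
        ((poisson_compat₁_iff hco.lie hco.cocomm hb hm).1 h.compat₁)

end Bialgebra

end PoissonConformal

end

theorem theorem3p8 {k : Type*} [Field k] [CharZero k]
    {P : Type*} [AddCommGroup P] [Module k P] [Module (Polynomial k) P]
    [IsScalarTower k (Polynomial k) P]
    [Module.Free (Polynomial k) P] [Module.Finite (Polynomial k) P]
    (br mul : LambdaProduct k P) (hP : IsPoissonConformalAlgebra br mul)
    (δ Δ : Coproduct k P) (hco : IsPoissonConformalCoalgebra δ Δ) :
    List.TFAE [
      IsPoissonConformalBialgebra br mul δ Δ,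
      IsMatchedPair br mul (dualProduct δ) (dualProduct Δ)
        (dualRep (leftRep br hP.lie.sesq)) (-dualRep (leftRep mul hP.assoc.sesq))
        (codualRep (dualProduct δ) (dualProduct_sesq δ))
        (-codualRep (dualProduct Δ) (dualProduct_sesq Δ)),
      ∃ brR mulR : LambdaProduct k (P × ConformalDual k P),
        IsManinTriple brR mulR br mul (dualProduct δ) (dualProduct Δ)
          (LinearMap.inl (Polynomial k) P (ConformalDual k P))
          (LinearMap.inr (Polynomial k) P (ConformalDual k P)) (standardForm k P)] := by
  have hb := hP.lie.isDouble hco.lie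
  have hm := hP.comm.isDouble hP.assoc.sesq hco.cocomm
  have hiff := isPoissonConformalAlgebra_double_iff hP hco hb hm
  have hc := isConformalForm_standardForm (k := k) (P := P)
  have hs := isSymmetricForm_standardForm (k := k) (P := P)
  have hn := isNondegenerateForm_standardForm (k := k) (P := P)
  -- By definition, a matched pair asks for a Poisson structure on the direct sum, here given by two
  -- doubles.
  tfae_have 1 → 2 := fun h => ⟨hP, hco.dual, hiff.2 h⟩
  tfae_have 2 → 3 := fun h => ⟨_, _,
    { algR := h.sum
      algP := hP
      algQ := hco.dual
      conformal := hc
      symm := hs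
      nondeg := hn
      inv_br := (isInvariantForm_iff hc _).2 hb.inv.inv
      inv_mul := (isInvariantForm_iff hc _).2 hm.inv.inv
      sub_brP := hb.subP
      sub_mulP := hm.subP
      sub_brQ := hb.subQ
      sub_mulQ := hm.subQ
      directSum := by
        rw [LinearMap.coprod_inl_inr]
        exact Function.bijective_id
      isotropicP := fun a b => by
        change (0 : k[X]) + (0 : k[X]).comp _ = 0
        rw [Polynomial.zero_comp, add_zero]
      isotropicQ := fun f g => by
        change f.lin 0 + (g.lin 0).comp _ = 0
        rw [map_zero, map_zero, Polynomial.zero_comp, add_zero] }⟩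
  -- Nothing is assumed about the mixed products of a Manin triple; invariance alone makes its two
  -- products doubles.
  tfae_have 3 → 1 := by
    rintro ⟨brR, mulR, h⟩
    have hb' : IsDouble (-1) br δ brR :=
      ⟨h.algR.lie.isInvariantLambdaProduct hc hs hn h.inv_br, h.sub_brP, h.sub_brQ⟩
    have hm' : IsDouble 1 mul Δ mulR :=
      ⟨h.algR.comm.isInvariantLambdaProduct hc hs hn h.inv_mul, h.sub_mulP, h.sub_mulQ⟩
    exact (isPoissonConformalAlgebra_double_iff hP hco hb' hm').1 h.algR
  tfae_finish
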